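/- Let $H,K$ be complex Hilbert spaces. A TRO in $\mathrm B(H,K)$ is a norm closed subspace $T\subseteq \mathrm B(H,K)$ with $ab^*c\in T$ for all $a,b,c\in T$; a $W^*$-TRO is a TRO that is closed in the weak* ($\sigma$-weak) topology of $\mathrm B(H,K)$. For a TRO $T$ let $$\mathrm A_T=\begin{pmatrix}\langle TT^*\rangle & T\\ T^* & \langle T^*T\rangle\end{pmatrix}\subseteq \mathrm B(K\oplus H)$$ be its linking algebra, where $\langle\cdot\rangle$ denotes the norm closed linear span, and let $\mathsf R_T=\mathrm A_T''$ be the bicommutant of $\mathrm A_T$ in $\mathrm B(K\oplus H)$. Regard $T$ as a subspace of $\mathsf R_T$ through $t\mapsto\begin{pmatrix}0&t\\0&0\end{pmatrix}$. Theorem. Let $X\subseteq T\subseteq \mathrm B(H,K)$ be $W^*$-TROs such that $X$ is nondegenerate in $T$ in the $W^*$-sense, i.e. the linear spans of $XT^*T$ and of $TT^*X$ are weak* dense in $T$. Let $P:T\to X$ be a linear map that is normal (i.e. weak*-continuous), contractive, surjective and idempotent. Then $P$ extends to a normal conditional expectation of $\mathsf R_T$ onto $\mathsf R_X$: we have $\mathsf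 R_X\subseteq\mathsf R_T$, and there is a weak*-continuous linear map $E:\mathsf R_T\to\mathsf R_X$ which is contractive, positive and the identity on $\mathsf R_X$, which satisfies $E(bac)=bE(a)c$ for all $a\in\mathsf R_T$ and $b,c\in\mathsf R_X$, and for which $$E\begin{pmatrix}0&t\\0&0\end{pmatrix}=\begin{pmatrix}0&P(t)\\0&0\end{pmatrix}\qquad\text{for every } t\in T.$$ -/

import Mathlib

namespace WTRO

open ContinuousLinearMap

/-! ### The weak* topology of `B(H, K)` -/

/-- The weak* (ultraweak, σ-weak) topology on `B(H, K)`, i.e. the topology given by the canonical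
predual of trace class operators: the coarsest topology making every functional
`a ↦ ∑ₙ ⟪ηₙ, a ξₙ⟫` continuous, where `∑ₙ ‖ξₙ‖² < ∞` and `∑ₙ ‖ηₙ‖² < ∞`. -/
noncomputable abbrev weakStar (H K : Type*)
    [NormedAddCommGroup H] [InnerProductSpace ℂ H]
    [NormedAddCommGroup K] [InnerProductSpace ℂ K] :
    TopologicalSpace (H →L[ℂ] K) :=
  ⨅ (ξ : lp (fun _ : ℕ => H) 2) (η : lp (fun _ : ℕ => K) 2),
    TopologicalSpace.induced (fun a : H →L[ℂ] K => ∑' n, inner ℂ (η n) (a (ξ n)))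
      (inferInstance : TopologicalSpace ℂ)

/-- The weak* topology inherited by a set of operators. -/
noncomputable abbrev weakStarOn {H K : Type*}
    [NormedAddCommGroup H] [InnerProductSpace ℂ H]
    [NormedAddCommGroup K] [InnerProductSpace ℂ K] (S : Set (H →L[ℂ] K)) :
    TopologicalSpace S :=
  TopologicalSpace.induced Subtype.val (weakStar H K)

/-- A map between sets of operators is normal if it is weak*-to-weak* continuous. -/
def IsNormalMap {H K H' K' : Type*}
    [NormedAddCommGroup H] [InnerProductSpace ℂ H]
    [NormedAddCommGroup K] [InnerProductSpace ℂ K]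
    [NormedAddCommGroup H'] [InnerProductSpace ℂ H']
    [NormedAddCommGroup K'] [InnerProductSpace ℂ K']
    {S : Set (H →L[ℂ] K)} {S' : Set (H' →L[ℂ] K')} (f : S → S') : Prop :=
  @Continuous S S' (weakStarOn S) (weakStarOn S') f

section TRO

variable {H K : Type*}
  [NormedAddCommGroup H] [InnerProductSpace ℂ H] [CompleteSpace H]
  [NormedAddCommGroup K] [InnerProductSpace ℂ K] [CompleteSpace K]

/-! ### (W*-)TROs -/

/-- A ternary ring of operators: a norm closed subspace `T ⊆ B(H, K)` with `T T* T ⊆ T`. -/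
structure IsTRO (T : Submodule ℂ (H →L[ℂ] K)) : Prop where
  isClosed : IsClosed (T : Set (H →L[ℂ] K))
  ternary_mem : ∀ a ∈ T, ∀ b ∈ T, ∀ c ∈ T, a ∘L adjoint b ∘L c ∈ T

/-- A W*-TRO: a TRO which is weak* closed. -/
structure IsWStarTRO (T : Submodule ℂ (H →L[ℂ] K)) : Prop extends IsTRO T where
  isClosed_weakStar : @IsClosed _ (weakStar H K) (T : Set (H →L[ℂ] K))

/-- Nondegeneracy of `X` in `T` in the weak* sense: the linear spans of `X T* T` and `T T* X`
are weak* dense in `T`. (If `X ⊆ T` and `T` is a W*-TRO, both spans are contained in `T`.) -/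
structure IsWStarNondegenerate (X T : Submodule ℂ (H →L[ℂ] K)) : Prop where
  dense_left : (T : Set (H →L[ℂ] K)) ⊆ @closure _ (weakStar H K)
    (Submodule.span ℂ {a | ∃ x ∈ X, ∃ s ∈ T, ∃ t ∈ T, a = x ∘L adjoint s ∘L t} :
      Set (H →L[ℂ] K))
  dense_right : (T : Set (H →L[ℂ] K)) ⊆ @closure _ (weakStar H K)
    (Submodule.span ℂ {a | ∃ s ∈ T, ∃ t ∈ T, ∃ x ∈ X, a = s ∘L adjoint t ∘L x} :
      Set (H →L[ℂ] K))

/-! ### Linking algebras -/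

/-- `⟨T T*⟩`, the norm closed linear span of `T T*` in `B(K)`. -/
noncomputable def leftLinking (T : Submodule ℂ (H →L[ℂ] K)) : Submodule ℂ (K →L[ℂ] K) :=
  (Submodule.span ℂ {a | ∃ s ∈ T, ∃ t ∈ T, a = s ∘L adjoint t}).topologicalClosure

/-- `⟨T* T⟩`, the norm closed linear span of `T* T` in `B(H)`. -/
noncomputable def rightLinking (T : Submodule ℂ (H →L[ℂ] K)) : Submodule ℂ (H →L[ℂ] H) :=
  (Submodule.span ℂ {a | ∃ s ∈ T, ∃ t ∈ T, a = adjoint s ∘L t}).topologicalClosure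

/-- The operator on the Hilbert space direct sum `K ⊕ H` with matrix `(a b; c d)`. -/
noncomputable def blockOp (a : K →L[ℂ] K) (b : H →L[ℂ] K) (c : K →L[ℂ] H) (d : H →L[ℂ] H) :
    WithLp 2 (K × H) →L[ℂ] WithLp 2 (K × H) :=
  ((WithLp.prodContinuousLinearEquiv 2 ℂ K H).symm : K × H →L[ℂ] WithLp 2 (K × H)) ∘L
    ((a.coprod b).prod (c.coprod d)) ∘L
      (WithLp.prodContinuousLinearEquiv 2 ℂ K H : WithLp 2 (K × H) →L[ℂ] K × H)

/-- The linking algebra `A_T = (⟨T T*⟩ T; T* ⟨T* T⟩) ⊆ B(K ⊕ H)`, as a set of operators. -/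
noncomputable def linkingSet (T : Submodule ℂ (H →L[ℂ] K)) :
    Set (WithLp 2 (K × H) →L[ℂ] WithLp 2 (K × H)) :=
  {m | ∃ a ∈ leftLinking T, ∃ b ∈ T, ∃ c ∈ T, ∃ d ∈ rightLinking T,
    m = blockOp a b (adjoint c) d}

theorem adjoint_blockOp (a : K →L[ℂ] K) (b : H →L[ℂ] K) (c : K →L[ℂ] H) (d : H →L[ℂ] H) :
    adjoint (blockOp a b c d) = blockOp (adjoint a) (adjoint c) (adjoint b) (adjoint d) := by
  symm
  rw [eq_adjoint_iff]
  intro x y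
  simp [blockOp, WithLp.prod_inner_apply, inner_add_left, inner_add_right,
    adjoint_inner_left]
  ring

theorem adjoint_mem_leftLinking {T : Submodule ℂ (H →L[ℂ] K)} {a : K →L[ℂ] K}
    (ha : a ∈ leftLinking T) : adjoint a ∈ leftLinking T := by
  refine map_mem_closure (adjoint (𝕜 := ℂ) (E := K) (F := K)).continuous ha ?_
  intro m hm
  induction hm using Submodule.span_induction with
  | mem x hx =>
    obtain ⟨s, hs, t, ht, rfl⟩ := hx
    exact Submodule.subset_span ⟨t, ht, s, hs, by simp [adjoint_comp]⟩
  | zero => simp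
  | add x y _ _ hx hy => simpa using add_mem hx hy
  | smul c x _ hx =>
    rw [map_smulₛₗ]
    exact Submodule.smul_mem _ _ hx

theorem adjoint_mem_rightLinking {T : Submodule ℂ (H →L[ℂ] K)} {a : H →L[ℂ] H}
    (ha : a ∈ rightLinking T) : adjoint a ∈ rightLinking T := by
  refine map_mem_closure (adjoint (𝕜 := ℂ) (E := H) (F := H)).continuous ha ?_
  intro m hm
  induction hm using Submodule.span_induction with
  | mem x hx =>
    obtain ⟨s, hs, t, ht, rfl⟩ := hx
    exact Submodule.subset_span ⟨t, ht, s, hs, by simp [adjoint_comp]⟩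
  | zero => simp
  | add x y _ _ hx hy => simpa using add_mem hx hy
  | smul c x _ hx =>
    rw [map_smulₛₗ]
    exact Submodule.smul_mem _ _ hx

theorem star_linkingSet (T : Submodule ℂ (H →L[ℂ] K)) :
    star (linkingSet T) = linkingSet T := by
  have key : ∀ m ∈ linkingSet T, star m ∈ linkingSet T := by
    rintro m ⟨a, ha, b, hb, c, hc, d, hd, rfl⟩
    refine ⟨_, adjoint_mem_leftLinking ha, c, hc, b, hb, _, adjoint_mem_rightLinking hd, ?_⟩
    rw [star_eq_adjoint, adjoint_blockOp, adjoint_adjoint]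
  ext m
  exact ⟨fun h => by simpa using key _ h, fun h => key m h⟩

/-- The von Neumann linking algebra `R_T = A_T''`, the bicommutant of `A_T` in `B(K ⊕ H)`. -/
noncomputable def vnLinking (T : Submodule ℂ (H →L[ℂ] K)) :
    VonNeumannAlgebra (WithLp 2 (K × H)) where
  toSubalgebra := Subalgebra.centralizer ℂ (Set.centralizer (linkingSet T))
  star_mem' := by
    intro m hm
    have hm' : m ∈ Set.centralizer (Set.centralizer (linkingSet T)) := hm
    change star m ∈ Set.centralizer (Set.centralizer (linkingSet T))
    intro c hc
    have h1 : star c ∈ Set.centralizer (linkingSet T) := by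
      intro g hg
      have h2 : star g ∈ linkingSet T := by
        rw [← star_linkingSet T]; simpa using hg
      have := congrArg star (hc _ h2)
      simpa using this.symm
    have := congrArg star (hm' _ h1)
    simpa using this.symm
  centralizer_centralizer' := Set.centralizer_centralizer_centralizer _

theorem coe_vnLinking (T : Submodule ℂ (H →L[ℂ] K)) :
    (vnLinking T : Set (WithLp 2 (K × H) →L[ℂ] WithLp 2 (K × H))) =
      Set.centralizer (Set.centralizer (linkingSet T)) := rfl

theorem blockOp_mem_vnLinking {T : Submodule ℂ (H →L[ℂ] K)} (t : T) :
    blockOp 0 (t : H →L[ℂ] K) 0 0 ∈ (vnLinking T).toStarSubalgebra := by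
  have h : blockOp 0 (t : H →L[ℂ] K) 0 0 ∈ linkingSet T :=
    ⟨0, zero_mem _, t, t.2, 0, zero_mem _, 0, zero_mem _, by simp⟩
  exact Set.subset_centralizer_centralizer h

/-- The canonical embedding of `T` into `R_T` as the upper right corner, `t ↦ (0 t; 0 0)`. -/
noncomputable def corner {T : Submodule ℂ (H →L[ℂ] K)} (t : T) :
    (vnLinking T).toStarSubalgebra :=
  ⟨blockOp 0 (t : H →L[ℂ] K) 0 0, blockOp_mem_vnLinking t⟩

end TRO

/-! ### Conditional expectations -/

/-- `E : M → N` is a conditional expectation of the von Neumann algebra `M` onto its von Neumann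
subalgebra `N`: a contractive positive linear `N`-bimodule map restricting to the identity
on `N`. -/
structure IsCondExp {L : Type*} [NormedAddCommGroup L] [InnerProductSpace ℂ L] [CompleteSpace L]
    (M N : VonNeumannAlgebra L) (E : M.toStarSubalgebra →ₗ[ℂ] N.toStarSubalgebra) : Prop where
  le : N ≤ M
  apply_of_mem : ∀ b : M.toStarSubalgebra, (b : L →L[ℂ] L) ∈ N → (E b : L →L[ℂ] L) = b
  norm_le : ∀ a : M.toStarSubalgebra, ‖E a‖ ≤ ‖a‖
  isPositive : ∀ a : M.toStarSubalgebra, (a : L →L[ℂ] L).IsPositive → (E a : L →L[ℂ] L).IsPositive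
  bimodule : ∀ a b c : M.toStarSubalgebra, (b : L →L[ℂ] L) ∈ N → (c : L →L[ℂ] L) ∈ N →
    (E (b * a * c) : L →L[ℂ] L) = (b : L →L[ℂ] L) * (E a : L →L[ℂ] L) * (c : L →L[ℂ] L)

end WTRO

/-!
The corner of the von Neumann linking algebra `R_T` is `T` itself: this is a form of the bicommutant
theorem (`entry_mem_of_mem_vnLinking`). Let `e` and `f` be the left and right supports of `X`, that
is, the projections onto the closed spans of `X H ⊆ K` and `X* K ⊆ H`. They belong to `R_X`,
nondegeneracy gives `e t f = t` for `t ∈ T`, and `P` becomes a contractive projection `Φ` of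
`e R_T f` onto `e R_X f` (`IsCornerProj`, `isCornerProj_upper_entry`). Moreover, `p = e + f` commutes
with `R_T`, it is the support of `e` and of `f` in `R_X`, and `R_T` and `R_X` agree on the range of
`1 - p` (`IsWStarNondegenerate.isCentralSupport_leftSupport`,
`IsWStarNondegenerate.compl_support_mul_mem`).

The main point is to pass from `Φ` to a contractive projection of `p R_T p` onto `p R_X p`. The proof
of Tomiyama's theorem shows that `Φ` is modular on both sides (`IsCornerProj.map_mul_left`,
`IsCornerProj.map_mul_right`): a self-adjoint `h` is cut into spectral slices, on which it is almost
scalar, and orthogonality of distinct slices is preserved by `Φ`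
(`IsCornerProj.mul_map_mul_eq_zero`). By modularity, `n ξ ↦ Φ(a n) ξ` for `n ∈ R_X f` defines for
each `a ∈ R_T` an operator of norm at most `‖a‖` on the closed span of the ranges of `R_X f`, which
is the range of `p` (`IsCornerProj.norm_sum_map_apply_le`). This enlarges the right projection of the
corner to `p`, and the left one is enlarged by passing to adjoints (`IsCornerProj.exists_extension`).
Adding the identity on the range of `1 - p` gives a contractive projection `E` of `R_T` onto `R_X`
(`IsCornerProj.add_compl`). It is modular by the same argument, and positive because it is unital and
contractive (`IsCornerProj.isPositive_map`).

For `k, n ∈ R_X` the functional `a ↦ ⟪k e w, E(a) (n f v)⟫ = ⟪w, Φ(k* a n) v⟫` is normal, as `P` is.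
These vectors span dense subspaces of the range of `p`, and norm limits of normal functionals on a
weak* closed space of operators are normal, its predual being complete
(`continuous_weakStarOn_of_approx`). So all vector functionals of `E` are normal
(`IsCornerProj.isNormalOn_inner`), and again by norm limits, `E` is normal (`isNormalOn_uw_of_inner`).
-/

open ContinuousLinearMap

namespace WTRO

/-! ### Ultraweakly continuous functionals -/

section SquareSummable

variable {H : Type*} [NormedAddCommGroup H]

theorem hasSum_norm_sq (ξ : lp (fun _ : ℕ => H) 2) : HasSum (fun n => ‖ξ n‖ ^ 2) (‖ξ‖ ^ 2) := by
  have := lp.hasSum_norm (p := 2) (by simp) ξ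
  simpa using this

theorem memlp_two_of_summable {ξ : ℕ → H} (h : Summable fun n => ‖ξ n‖ ^ 2) :
    Memℓp (E := fun _ : ℕ => H) ξ 2 := by
  refine memℓp_gen ?_
  simpa using h

theorem hasSum_norm_sq_prod {ξ : ℕ → lp (fun _ : ℕ => H) 2} (h : Summable fun k => ‖ξ k‖ ^ 2) :
    HasSum (fun m => ‖ξ (Nat.unpair m).1 (Nat.unpair m).2‖ ^ 2) (∑' k, ‖ξ k‖ ^ 2) := by
  have hs : Summable fun p : ℕ × ℕ => ‖ξ p.1 p.2‖ ^ 2 := by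
    refine (summable_prod_of_nonneg (fun _ => by positivity)).2
      ⟨fun k => (hasSum_norm_sq (ξ k)).summable, ?_⟩
    simpa only [(hasSum_norm_sq _).tsum_eq] using h
  have h1 : HasSum (fun p : ℕ × ℕ => ‖ξ p.1 p.2‖ ^ 2) (∑' k, ‖ξ k‖ ^ 2) := by
    convert hs.hasSum using 1
    rw [hs.tsum_prod]
    simp only [(hasSum_norm_sq _).tsum_eq]
  exact (Nat.pairEquiv.symm.hasSum_iff (f := fun p : ℕ × ℕ => ‖ξ p.1 p.2‖ ^ 2)).2 h1

/-- A square summable sequence of square summable sequences, rearranged into a single one. -/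
noncomputable def stack (ξ : ℕ → lp (fun _ : ℕ => H) 2) (h : Summable fun k => ‖ξ k‖ ^ 2) :
    lp (fun _ : ℕ => H) 2 :=
  ⟨fun m => ξ (Nat.unpair m).1 (Nat.unpair m).2,
    memlp_two_of_summable (hasSum_norm_sq_prod h).summable⟩

theorem norm_stack_sq (ξ : ℕ → lp (fun _ : ℕ => H) 2) (h : Summable fun k => ‖ξ k‖ ^ 2) :
    ‖stack ξ h‖ ^ 2 = ∑' k, ‖ξ k‖ ^ 2 :=
  (hasSum_norm_sq (stack ξ h)).unique (hasSum_norm_sq_prod h)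

end SquareSummable

section Functional

variable {H K : Type*}
  [NormedAddCommGroup H] [InnerProductSpace ℂ H]
  [NormedAddCommGroup K] [InnerProductSpace ℂ K]

theorem norm_sq_apply_le (a : H →L[ℂ] K) (v : H) : ‖a v‖ ^ 2 ≤ ‖a‖ ^ 2 * ‖v‖ ^ 2 := by
  rw [← mul_pow]
  exact pow_le_pow_left₀ (norm_nonneg _) (a.le_opNorm _) 2

theorem memlp_map (a : H →L[ℂ] K) (ξ : lp (fun _ : ℕ => H) 2) :
    Memℓp (E := fun _ : ℕ => K) (fun n => a (ξ n)) 2 :=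
  memlp_two_of_summable (Summable.of_nonneg_of_le (fun _ => by positivity)
    (fun _ => norm_sq_apply_le a _) ((hasSum_norm_sq ξ).summable.mul_left _))

/-- The ampliation `a ⊗ 1` of an operator `a`, acting entrywise on square summable sequences, as
a linear map. -/
noncomputable def amplLinear (a : H →L[ℂ] K) :
    lp (fun _ : ℕ => H) 2 →ₗ[ℂ] lp (fun _ : ℕ => K) 2 where
  toFun ξ := ⟨fun n => a (ξ n), memlp_map a ξ⟩
  map_add' ξ η := lp.ext (funext fun n => map_add a (ξ n) (η n))
  map_smul' c ξ := lp.ext (funext fun n => map_smul a c (ξ n))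

theorem norm_amplLinear_le (a : H →L[ℂ] K) (ξ : lp (fun _ : ℕ => H) 2) :
    ‖amplLinear a ξ‖ ≤ ‖a‖ * ‖ξ‖ := by
  refine (abs_le_of_sq_le_sq' ?_ (by positivity)).2
  rw [mul_pow]
  exact hasSum_le (fun _ => norm_sq_apply_le a _) (hasSum_norm_sq (amplLinear a ξ))
    ((hasSum_norm_sq ξ).mul_left _)

/-- The ampliation `a ⊗ 1` of an operator `a`, acting entrywise on square summable sequences. -/
noncomputable def ampl (a : H →L[ℂ] K) :
    lp (fun _ : ℕ => H) 2 →L[ℂ] lp (fun _ : ℕ => K) 2 :=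
  LinearMap.mkContinuous (amplLinear a) ‖a‖ (norm_amplLinear_le a)

@[simp]
theorem ampl_apply (a : H →L[ℂ] K) (ξ : lp (fun _ : ℕ => H) 2) (n : ℕ) :
    ampl a ξ n = a (ξ n) := rfl

theorem hasSum_inner_ampl (ξ : lp (fun _ : ℕ => H) 2) (η : lp (fun _ : ℕ => K) 2)
    (a : H →L[ℂ] K) : HasSum (fun n => inner ℂ (η n) (a (ξ n))) (inner ℂ η (ampl a ξ)) :=
  lp.hasSum_inner η (ampl a ξ)

/-- The ultraweakly continuous functional `a ↦ ∑ₙ ⟪ηₙ, a ξₙ⟫`. -/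
noncomputable def uw (ξ : lp (fun _ : ℕ => H) 2) (η : lp (fun _ : ℕ => K) 2) :
    StrongDual ℂ (H →L[ℂ] K) :=
  LinearMap.mkContinuous
    { toFun := fun a => ∑' n, inner ℂ (η n) (a (ξ n))
      map_add' := fun a b => by
        rw [← ((hasSum_inner_ampl ξ η a).summable.tsum_add (hasSum_inner_ampl ξ η b).summable)]
        exact tsum_congr fun n => by rw [add_apply, inner_add_right]
      map_smul' := fun c a => by
        rw [RingHom.id_apply, smul_eq_mul, ← tsum_mul_left]
        exact tsum_congr fun n => by rw [smul_apply, inner_smul_right] }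
    (‖η‖ * ‖ξ‖) (fun a => by
      change ‖∑' n, inner ℂ (η n) (a (ξ n))‖ ≤ _
      rw [(hasSum_inner_ampl ξ η a).tsum_eq]
      calc _ ≤ ‖η‖ * ‖ampl a ξ‖ := norm_inner_le_norm _ _
        _ ≤ ‖η‖ * (‖a‖ * ‖ξ‖) := by
          gcongr
          exact norm_amplLinear_le a ξ
        _ = _ := by ring)

theorem uw_apply (ξ : lp (fun _ : ℕ => H) 2) (η : lp (fun _ : ℕ => K) 2) (a : H →L[ℂ] K) :
    uw ξ η a = ∑' n, inner ℂ (η n) (a (ξ n)) := rfl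

theorem uw_eq_inner (ξ : lp (fun _ : ℕ => H) 2) (η : lp (fun _ : ℕ => K) 2) (a : H →L[ℂ] K) :
    uw ξ η a = inner ℂ η (ampl a ξ) := (hasSum_inner_ampl ξ η a).tsum_eq

theorem hasSum_uw (ξ : lp (fun _ : ℕ => H) 2) (η : lp (fun _ : ℕ => K) 2) (a : H →L[ℂ] K) :
    HasSum (fun n => inner ℂ (η n) (a (ξ n))) (uw ξ η a) := by
  rw [uw_eq_inner]; exact hasSum_inner_ampl ξ η a

theorem norm_uw_apply_le (ξ : lp (fun _ : ℕ => H) 2) (η : lp (fun _ : ℕ => K) 2)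
    (a : H →L[ℂ] K) : ‖uw ξ η a‖ ≤ ‖η‖ * ‖ξ‖ * ‖a‖ :=
  (le_opNorm _ _).trans (by gcongr; exact LinearMap.mkContinuous_norm_le _ (by positivity) _)

theorem uw_single (v : H) (w : K) (a : H →L[ℂ] K) :
    uw (lp.single 2 0 v) (lp.single 2 0 w) a = inner ℂ w (a v) := by
  rw [uw_apply, tsum_eq_single 0]
  · simp
  · intro n hn
    rw [lp.single_apply_ne _ _ _ hn]; simp

theorem uw_smul_left (c : ℂ) (ξ : lp (fun _ : ℕ => H) 2) (η : lp (fun _ : ℕ => K) 2) :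
    uw (c • ξ) η = c • uw ξ η := by
  ext a
  simp [uw_eq_inner]

theorem uw_zero_left (η : lp (fun _ : ℕ => K) 2) : uw (0 : lp (fun _ : ℕ => H) 2) η = 0 := by
  ext a
  simp [uw_eq_inner]

/-- Countably many ultraweakly continuous functionals with square summable data add up to a
single one. -/
theorem hasSum_uw_stack {ξ : ℕ → lp (fun _ : ℕ => H) 2} {η : ℕ → lp (fun _ : ℕ => K) 2}
    (hξ : Summable fun k => ‖ξ k‖ ^ 2) (hη : Summable fun k => ‖η k‖ ^ 2) (a : H →L[ℂ] K) :
    HasSum (fun k => uw (ξ k) (η k) a) (uw (stack ξ hξ) (stack η hη) a) := by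
  have h := (Nat.pairEquiv.hasSum_iff (f := fun m => inner ℂ (stack η hη m) (a (stack ξ hξ m)))).2
    (hasSum_uw (stack ξ hξ) (stack η hη) a)
  have h' : HasSum (fun p : ℕ × ℕ => inner ℂ (η p.1 p.2) (a (ξ p.1 p.2)))
      (uw (stack ξ hξ) (stack η hη) a) := by
    convert h using 2 with p
    change _ = inner ℂ (η (Nat.unpair (Nat.pair p.1 p.2)).1 (Nat.unpair (Nat.pair p.1 p.2)).2)
      (a (ξ (Nat.unpair (Nat.pair p.1 p.2)).1 (Nat.unpair (Nat.pair p.1 p.2)).2))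
    rw [Nat.unpair_pair]
  exact h'.prod_fiberwise fun k => hasSum_uw (ξ k) (η k) a

theorem hasSum_of_two_le_eq_zero {E : Type*} [AddCommMonoid E] [TopologicalSpace E] (f : ℕ → E)
    (h : ∀ n, 2 ≤ n → f n = 0) : HasSum f (f 0 + f 1) := by
  have := hasSum_sum_of_ne_finset_zero (L := .unconditional ℕ) (f := f) (s := Finset.range 2)
    (fun b hb => h b (by simpa [Nat.succ_le_iff] using hb))
  rwa [Finset.sum_range_succ, Finset.sum_range_one] at this

/-- The vector functionals in `uw ξ η` are interlaced with those in `uw ξ' η'`. -/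
theorem exists_uw_add (ξ ξ' : lp (fun _ : ℕ => H) 2) (η η' : lp (fun _ : ℕ => K) 2) :
    ∃ ξ'' η'', ‖ξ''‖ ^ 2 = ‖ξ‖ ^ 2 + ‖ξ'‖ ^ 2 ∧ ‖η''‖ ^ 2 = ‖η‖ ^ 2 + ‖η'‖ ^ 2 ∧
      uw ξ'' η'' = uw ξ η + uw ξ' η' := by
  let X : ℕ → lp (fun _ : ℕ => H) 2 := fun k => if k = 0 then ξ else if k = 1 then ξ' else 0
  let Y : ℕ → lp (fun _ : ℕ => K) 2 := fun k => if k = 0 then η else if k = 1 then η' else 0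
  have h0 (n : ℕ) (hn : 2 ≤ n) : X n = 0 ∧ Y n = 0 := by
    simp [X, Y, show n ≠ 0 by omega, show n ≠ 1 by omega]
  have hX : HasSum (fun k => ‖X k‖ ^ 2) (‖ξ‖ ^ 2 + ‖ξ'‖ ^ 2) :=
    hasSum_of_two_le_eq_zero (fun k => ‖X k‖ ^ 2) fun n hn => by simp [(h0 n hn).1]
  have hY : HasSum (fun k => ‖Y k‖ ^ 2) (‖η‖ ^ 2 + ‖η'‖ ^ 2) :=
    hasSum_of_two_le_eq_zero (fun k => ‖Y k‖ ^ 2) fun n hn => by simp [(h0 n hn).2]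
  refine ⟨stack X hX.summable, stack Y hY.summable, ?_, ?_, ?_⟩
  · rw [norm_stack_sq, hX.tsum_eq]
  · rw [norm_stack_sq, hY.tsum_eq]
  · ext a
    exact (hasSum_uw_stack hX.summable hY.summable a).unique
      (hasSum_of_two_le_eq_zero (fun k => uw (X k) (Y k) a) fun n hn => by
        simp [(h0 n hn).1, uw_zero_left])

theorem weakStarOn_eq (S : Submodule ℂ (H →L[ℂ] K)) :
    weakStarOn (S : Set (H →L[ℂ] K)) =
      ⨅ p : lp (fun _ : ℕ => H) 2 × lp (fun _ : ℕ => K) 2, TopologicalSpace.induced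
        ((uw p.1 p.2).toLinearMap ∘ₗ S.subtype) inferInstance := by
  rw [weakStarOn, weakStar, iInf_prod, induced_iInf]
  simp_rw [induced_iInf, induced_compose]
  rfl

/-- Weak* continuous functionals on a space of operators are the ultraweak ones. -/
theorem continuous_weakStarOn_iff {S : Submodule ℂ (H →L[ℂ] K)} (φ : S →ₗ[ℂ] ℂ) :
    @Continuous S ℂ (weakStarOn (S : Set (H →L[ℂ] K))) _ φ ↔
      ∃ ξ η, ∀ s : S, φ s = uw ξ η (s : H →L[ℂ] K) := by
  rw [weakStarOn_eq, ← LinearMap.mem_span_iff_continuous]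
  constructor
  · intro h
    induction h using Submodule.span_induction with
    | mem x hx =>
      obtain ⟨p, rfl⟩ := hx
      exact ⟨p.1, p.2, fun s => rfl⟩
    | zero => exact ⟨0, 0, fun s => by simp [uw_zero_left]⟩
    | add x y _ _ hx hy =>
      obtain ⟨ξ, η, hx⟩ := hx
      obtain ⟨ξ', η', hy⟩ := hy
      obtain ⟨ξ'', η'', -, -, h⟩ := exists_uw_add ξ ξ' η η'
      exact ⟨ξ'', η'', fun s => by simp [h, hx, hy]⟩
    | smul c x _ hx =>
      obtain ⟨ξ, η, hx⟩ := hx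
      exact ⟨c • ξ, η, fun s => by simp [uw_smul_left, hx]⟩
  · rintro ⟨ξ, η, h⟩
    exact Submodule.subset_span ⟨(ξ, η), by ext s; simp [h]⟩

/-- A point outside a subspace which is closed for the topology induced by a family of linear
functionals is separated from it by a combination of these functionals. -/
theorem exists_separating_functional {V ι : Type*} [AddCommGroup V] [Module ℂ V]
    (f : ι → V →ₗ[ℂ] ℂ) (S : Submodule ℂ V)
    (hS : @IsClosed V (⨅ i, TopologicalSpace.induced (f i) inferInstance) (S : Set V))
    {a : V} (ha : a ∉ S) :
    ∃ φ ∈ Submodule.span ℂ (Set.range f), (∀ s ∈ S, φ s = 0) ∧ φ a ≠ 0 := by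
  let _ : TopologicalSpace V := ⨅ i, TopologicalSpace.induced (f i) inferInstance
  have : IsTopologicalAddGroup V := topologicalAddGroup_iInf fun _ => topologicalAddGroup_induced _
  have : ContinuousSMul ℂ V := continuousSMul_iInf fun _ => continuousSMul_induced _
  let _ : Module ℝ V := Module.complexToReal V
  have : LocallyConvexSpace ℝ V := LocallyConvexSpace.iInf fun i =>
    LocallyConvexSpace.induced ((f i).restrictScalars ℝ)
  obtain ⟨φ, u, h1, h2⟩ := RCLike.geometric_hahn_banach_point_closed (𝕜 := ℂ) (x := a)
    (t := (S : Set V)) (S.restrictScalars ℝ).convex hS ha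
  have hu : u < 0 := by simpa using h2 0 S.zero_mem
  have hφ : ∀ s ∈ S, φ s = 0 := by
    intro s hs
    by_contra hne
    have := h2 (((2 * u : ℝ) / φ s : ℂ) • s) (S.smul_mem _ hs)
    rw [map_smul, smul_eq_mul, div_mul_cancel₀ _ hne] at this
    simp at this
    linarith
  refine ⟨φ.toLinearMap, (LinearMap.mem_span_iff_continuous _).2 φ.cont, hφ, ?_⟩
  intro h
  have h' : φ a = 0 := h
  rw [h'] at h1
  simp at h1
  linarith

theorem exists_uw_separating {S : Submodule ℂ (H →L[ℂ] K)}
    (hS : @IsClosed _ (weakStar H K) (S : Set (H →L[ℂ] K))) {a : H →L[ℂ] K} (ha : a ∉ S) :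
    ∃ ξ η, (∀ s ∈ S, uw ξ η s = 0) ∧ uw ξ η a ≠ 0 := by
  have htop : weakStar H K = ⨅ p : lp (fun _ : ℕ => H) 2 × lp (fun _ : ℕ => K) 2,
      TopologicalSpace.induced ((uw p.1 p.2 : StrongDual ℂ (H →L[ℂ] K)).toLinearMap)
        inferInstance := by
    rw [weakStar, iInf_prod]; rfl
  rw [htop] at hS
  obtain ⟨φ, hφ, h1, h2⟩ := exists_separating_functional _ S hS ha
  suffices h : ∃ ξ η, φ = (uw ξ η).toLinearMap by
    obtain ⟨ξ, η, rfl⟩ := h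
    exact ⟨ξ, η, h1, h2⟩
  clear h1 h2
  induction hφ using Submodule.span_induction with
  | mem x hx =>
    obtain ⟨p, rfl⟩ := hx
    exact ⟨p.1, p.2, rfl⟩
  | zero => exact ⟨0, 0, by simp [uw_zero_left]⟩
  | add x y _ _ hx hy =>
    obtain ⟨ξ, η, rfl⟩ := hx
    obtain ⟨ξ', η', rfl⟩ := hy
    obtain ⟨ξ'', η'', -, -, h⟩ := exists_uw_add ξ ξ' η η'
    exact ⟨ξ'', η'', by simp [h]⟩
  | smul c x _ hx =>
    obtain ⟨ξ, η, rfl⟩ := hx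
    exact ⟨c • ξ, η, by simp [uw_smul_left]⟩

end Functional

/-! ### Norm limits of normal functionals -/

section Functional

variable {H K : Type*}
  [NormedAddCommGroup H] [InnerProductSpace ℂ H]
  [NormedAddCommGroup K] [InnerProductSpace ℂ K]
  {E : Type*} [NormedAddCommGroup E] [NormedSpace ℂ E]

/-- The functional on a space `E` of operators, isometrically embedded by `j`, which is given by
the ultraweakly continuous functional `a ↦ ∑ₙ ⟪ηₙ, a ξₙ⟫`. -/
noncomputable def uwOn (j : E →ₗᵢ[ℂ] (H →L[ℂ] K)) (ξ : lp (fun _ : ℕ => H) 2)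
    (η : lp (fun _ : ℕ => K) 2) : StrongDual ℂ E :=
  (uw ξ η).comp j.toContinuousLinearMap

theorem uwOn_apply (j : E →ₗᵢ[ℂ] (H →L[ℂ] K)) (ξ : lp (fun _ : ℕ => H) 2)
    (η : lp (fun _ : ℕ => K) 2) (s : E) : uwOn j ξ η s = uw ξ η (j s) := rfl

/-- The predual of a space `E` of operators, isometrically embedded by `j`: the functionals on `E`
which are given by ultraweakly continuous ones. -/
noncomputable def normalDual (j : E →ₗᵢ[ℂ] (H →L[ℂ] K)) : Submodule ℂ (StrongDual ℂ E) where
  carrier := {φ | ∃ ξ η, φ = uwOn j ξ η}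
  add_mem' := by
    rintro _ _ ⟨ξ, η, rfl⟩ ⟨ξ', η', rfl⟩
    obtain ⟨ξ'', η'', -, -, h⟩ := exists_uw_add ξ ξ' η η'
    exact ⟨ξ'', η'', by simp only [uwOn, h, add_comp]⟩
  zero_mem' := ⟨0, 0, by simp only [uwOn, uw_zero_left, zero_comp]⟩
  smul_mem' := by
    rintro c _ ⟨ξ, η, rfl⟩
    exact ⟨c • ξ, η, by simp only [uwOn, uw_smul_left, smul_comp]⟩

theorem hasSum_uw_single (j : E →ₗᵢ[ℂ] (H →L[ℂ] K)) (ξ : lp (fun _ : ℕ => H) 2)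
    (η : lp (fun _ : ℕ => K) 2) :
    HasSum (fun n => uwOn j (lp.single 2 0 (ξ n)) (lp.single 2 0 (η n)))
      (uwOn j ξ η) := by
  have hbd (n : ℕ) : ‖uwOn j (lp.single 2 0 (ξ n)) (lp.single 2 0 (η n))‖ ≤
      (‖η n‖ ^ 2 + ‖ξ n‖ ^ 2) := by
    refine opNorm_le_bound _ (by positivity) fun s => ?_
    have h1 : ‖inner ℂ (η n) ((j s) (ξ n))‖ ≤ ‖η n‖ * (‖s‖ * ‖ξ n‖) :=
      (norm_inner_le_norm _ _).trans (by gcongr; rw [← j.norm_map s]; exact le_opNorm _ _)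
    rw [uwOn_apply, uw_single]
    nlinarith [two_mul_le_add_sq ‖η n‖ ‖ξ n‖, norm_nonneg s, norm_nonneg (η n), norm_nonneg (ξ n),
      mul_nonneg (norm_nonneg s) (mul_nonneg (norm_nonneg (η n)) (norm_nonneg (ξ n))),
      mul_le_mul_of_nonneg_left (two_mul_le_add_sq ‖η n‖ ‖ξ n‖) (norm_nonneg s)]
  have hs := (Summable.of_norm_bounded
    ((hasSum_norm_sq η).summable.add (hasSum_norm_sq ξ).summable) hbd).hasSum
  suffices hsum : uwOn j ξ η =
      ∑' n, uwOn j (lp.single 2 0 (ξ n)) (lp.single 2 0 (η n)) by rw [hsum]; exact hs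
  refine ContinuousLinearMap.ext fun s => ?_
  have h1 := hs.map (AddMonoidHom.mk' (fun φ : StrongDual ℂ E => φ s) fun _ _ => rfl)
    (ContinuousLinearMap.apply ℂ ℂ s).continuous
  refine (hasSum_uw ξ η (j s)).unique ?_
  rw [show (AddMonoidHom.mk' (fun φ : StrongDual ℂ E => φ s) (fun _ _ => rfl) ∘ fun n =>
    uwOn j (lp.single 2 0 (ξ n)) (lp.single 2 0 (η n))) =
    fun n => inner ℂ (η n) (j s (ξ n)) from funext fun n => uw_single _ _ _] at h1
  exact h1

/-- The functionals on `E` of the form `a ↦ ∑ₙ ⟪ηₙ, a ξₙ⟫` with `∑ₙ ‖ξₙ‖² ≤ r` and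
`∑ₙ ‖ηₙ‖² ≤ r`. -/
def uwBall (j : E →ₗᵢ[ℂ] (H →L[ℂ] K)) (r : ℝ) : Set (StrongDual ℂ E) :=
  {φ | ∃ (ξ : lp (fun _ : ℕ => H) 2) (η : lp (fun _ : ℕ => K) 2), ‖ξ‖ ^ 2 ≤ r ∧
    ‖η‖ ^ 2 ≤ r ∧ φ = uwOn j ξ η}

theorem uw_smul_smul {a : ℝ} (ha : 0 ≤ a) (ξ : lp (fun _ : ℕ => H) 2)
    (η : lp (fun _ : ℕ => K) 2) :
    uw (((√a : ℝ) : ℂ) • ξ) (((√a : ℝ) : ℂ) • η) = a • uw ξ η := by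
  ext x
  have h : ((√a : ℝ) : ℂ) * ((√a : ℝ) : ℂ) = (a : ℂ) := by
    rw [← Complex.ofReal_mul, Real.mul_self_sqrt ha]
  simp only [uw_eq_inner, map_smul, inner_smul_left, inner_smul_right, Complex.conj_ofReal,
    smul_apply, ← mul_assoc, h, Complex.real_smul]

theorem norm_sqrt_smul_sq {E : Type*} [NormedAddCommGroup E] [NormedSpace ℂ E] {a : ℝ}
    (ha : 0 ≤ a) (x : E) : ‖((√a : ℝ) : ℂ) • x‖ ^ 2 = a * ‖x‖ ^ 2 := by
  rw [norm_smul, mul_pow, Complex.norm_real, Real.norm_of_nonneg (Real.sqrt_nonneg a),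
    Real.sq_sqrt ha]

theorem convex_uwBall (j : E →ₗᵢ[ℂ] (H →L[ℂ] K)) (r : ℝ) : Convex ℝ (uwBall j r) := by
  rintro _ ⟨ξ, η, h1, h2, rfl⟩ _ ⟨ξ', η', h1', h2', rfl⟩ a b ha hb hab
  obtain ⟨ξ'', η'', h3, h4, h5⟩ := exists_uw_add (((√a : ℝ) : ℂ) • ξ) (((√b : ℝ) : ℂ) • ξ')
    (((√a : ℝ) : ℂ) • η) (((√b : ℝ) : ℂ) • η')
  rw [norm_sqrt_smul_sq ha, norm_sqrt_smul_sq hb] at h3 h4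
  refine ⟨ξ'', η'', ?_, ?_, ?_⟩
  · rw [h3]; nlinarith
  · rw [h4]; nlinarith
  · ext s
    rw [uwOn_apply, h5, uw_smul_smul ha, uw_smul_smul hb]
    rfl

theorem smul_mem_uwBall {j : E →ₗᵢ[ℂ] (H →L[ℂ] K)} {r : ℝ} {c : ℂ} (hc : ‖c‖ = 1)
    {φ : StrongDual ℂ E} (hφ : φ ∈ uwBall j r) : c • φ ∈ uwBall j r := by
  obtain ⟨ξ, η, h1, h2, rfl⟩ := hφ
  exact ⟨c • ξ, η, by simpa [norm_smul, hc] using h1, h2,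
    by simp only [uwOn, uw_smul_left, smul_comp]⟩

/-- A bounded functional on the dual of `E` acts on ultraweakly continuous functionals as the
evaluation at an operator. -/
theorem exists_operator_of_bidual [CompleteSpace H] [CompleteSpace K]
    (j : E →ₗᵢ[ℂ] (H →L[ℂ] K))
    (Φ : StrongDual ℂ (StrongDual ℂ E)) :
    ∃ a : H →L[ℂ] K, ∀ ξ η, Φ (uwOn j ξ η) = uw ξ η a := by
  let V (w : K) (v : H) : StrongDual ℂ E :=
    uwOn j (lp.single 2 0 v) (lp.single 2 0 w)
  have hV (w : K) (v : H) (s : E) : V w v s = inner ℂ w ((j s) v) := uw_single _ _ _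
  let B : K →ₗ⋆[ℂ] H →ₗ[ℂ] ℂ := LinearMap.mk₂'ₛₗ (starRingEnd ℂ) (RingHom.id ℂ)
    (fun w v => Φ (V w v))
    (fun w w' v => by
      rw [← map_add]; congr 1; ext s; simp only [hV, inner_add_left, add_apply])
    (fun c w v => by
      rw [smul_eq_mul, ← smul_eq_mul, ← map_smul]; congr 1; ext s; simp [hV, mul_comm])
    (fun w v v' => by
      rw [← map_add]; congr 1; ext s; simp only [hV, map_add, inner_add_right, add_apply])
    (fun c w v => by
      rw [RingHom.id_apply, ← map_smul]; congr 1; ext s; simp [hV])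
  have hB (w : K) (v : H) : ‖B w v‖ ≤ ‖Φ‖ * ‖w‖ * ‖v‖ := by
    refine (le_opNorm Φ (V w v)).trans ?_
    rw [mul_assoc]
    gcongr
    refine opNorm_le_bound _ (by positivity) fun s => ?_
    rw [hV]
    calc _ ≤ ‖w‖ * (‖s‖ * ‖v‖) :=
          (norm_inner_le_norm _ _).trans (by gcongr; rw [← j.norm_map s]; exact le_opNorm _ _)
      _ = _ := by ring
  let B' : K →L⋆[ℂ] H →L[ℂ] ℂ := B.mkContinuous₂ ‖Φ‖ hB
  let T : K →L[ℂ] H :=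
    ((InnerProductSpace.toDual ℂ H).symm.toContinuousLinearEquiv :
      StrongDual ℂ H →L⋆[ℂ] H).comp B'
  have hT (w : K) (v : H) : inner ℂ w (adjoint T v) = Φ (V w v) := by
    rw [adjoint_inner_right]
    exact InnerProductSpace.toDual_symm_apply
  refine ⟨adjoint T, fun ξ η => ?_⟩
  have h1 := (hasSum_uw_single j ξ η).map (AddMonoidHom.mk' Φ (map_add Φ)) Φ.continuous
  refine h1.unique ?_
  rw [show (AddMonoidHom.mk' Φ (map_add Φ) ∘ fun n =>
    uwOn j (lp.single 2 0 (ξ n)) (lp.single 2 0 (η n))) =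
    fun n => inner ℂ (η n) (adjoint T (ξ n)) from funext fun n => (hT _ _).symm]
  exact hasSum_uw ξ η (adjoint T)

/-- A norm limit of normal functionals, of norm at most `r`, is a limit of functionals represented
by vectors of square norm at most `r`. Otherwise it is separated from them by an element of the
bidual, which is the evaluation at an operator `b ∈ E` by weak* closedness, and the functionals in
`uwBall j r` norm `b` up to the factor `r`. -/
theorem mem_closure_uwBall [CompleteSpace H] [CompleteSpace K]
    {j : E →ₗᵢ[ℂ] (H →L[ℂ] K)}
    (hS : @IsClosed _ (weakStar H K) (LinearMap.range j.toLinearMap : Set (H →L[ℂ] K)))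
    {r : ℝ} (hr : 0 < r)
    {ρ : StrongDual ℂ E} (hρ : ρ ∈ (normalDual j).topologicalClosure) (hρr : ‖ρ‖ ≤ r) :
    ρ ∈ closure (uwBall j r) := by
  by_contra hcon
  obtain ⟨Φ, u, h1, h2⟩ := RCLike.geometric_hahn_banach_closed_point (𝕜 := ℂ)
    (convex_uwBall j r).closure isClosed_closure hcon
  obtain ⟨a, ha⟩ := exists_operator_of_bidual j Φ
  obtain ⟨b, rfl⟩ : a ∈ LinearMap.range j.toLinearMap := by
    by_contra haS
    obtain ⟨ξ, η, h3, h4⟩ := exists_uw_separating hS haS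
    apply h4
    rw [← ha, show uwOn j ξ η = 0 by
      ext s; exact h3 (j s) ⟨s, rfl⟩, map_zero]
  -- The bidual element is the evaluation at `b ∈ E` on all limits of normal functionals.
  have hΦ : ∀ φ ∈ (normalDual j).topologicalClosure, Φ φ = φ b := by
    intro φ hφ
    refine closure_minimal (s := (normalDual j : Set (StrongDual ℂ E)))
      (t := {φ | Φ φ = φ b}) ?_ ?_ hφ
    · rintro _ ⟨ξ, η, rfl⟩
      exact ha ξ η
    · exact isClosed_eq Φ.continuous (ContinuousLinearMap.apply ℂ ℂ (b : E)).continuous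
  have hball : ∀ φ ∈ uwBall j r, ‖Φ φ‖ ≤ u := by
    intro φ hφ
    by_cases h0 : Φ φ = 0
    · have := h1 _ (subset_closure hφ)
      rw [h0] at this ⊢
      simp at this ⊢
      exact this.le
    · have h3 := h1 _ (subset_closure (smul_mem_uwBall (c := starRingEnd ℂ (Φ φ) / ‖Φ φ‖)
        (by simp [h0]) hφ))
      rw [map_smul, smul_eq_mul, div_mul_eq_mul_div, Complex.conj_mul', sq, mul_div_assoc,
        div_self (by simpa using h0), mul_one] at h3
      simpa using h3.le
  have hu : 0 ≤ u := (norm_nonneg _).trans (hball 0 ⟨0, 0, by simpa using hr.le,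
    by simpa using hr.le, by simp only [uwOn, uw_zero_left, zero_comp]⟩)
  have hnorm : ‖b‖ ≤ u / r := by
    rw [← j.norm_map]
    refine opNorm_le_bound _ (by positivity) fun v => ?_
    by_contra hlt
    push Not at hlt
    have hav : j b v ≠ 0 := by
      intro h
      rw [h, norm_zero] at hlt
      exact absurd hlt (not_lt.2 (by positivity))
    have hv : v ≠ 0 := by rintro rfl; simp at hav
    have h3 := hball _ ⟨lp.single 2 0 (((√r / ‖v‖ : ℝ) : ℂ) • v),
      lp.single 2 0 (((√r / ‖j b v‖ : ℝ) : ℂ) • j b v), ?_, ?_, rfl⟩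
    · rw [ha, uw_single, LinearIsometry.coe_toLinearMap, map_smul, inner_smul_left,
        inner_smul_right, inner_self_eq_norm_sq_to_K] at h3
      simp only [norm_mul, Complex.norm_conj, Complex.norm_real, norm_pow, norm_div, norm_norm,
        Real.norm_of_nonneg (Real.sqrt_nonneg r), Complex.coe_algebraMap] at h3
      have hv' : 0 < ‖v‖ := norm_pos_iff.2 hv
      have hav' : 0 < ‖j b v‖ := norm_pos_iff.2 hav
      have h4 : √r / ‖j b v‖ * (√r / ‖v‖ * ‖j b v‖ ^ 2) = r * ‖j b v‖ / ‖v‖ := by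
        field_simp
        rw [Real.sq_sqrt hr.le]
      rw [h4, div_le_iff₀ hv'] at h3
      rw [div_mul_eq_mul_div, div_lt_iff₀ hr] at hlt
      linarith
    · rw [lp.norm_single (by simp), norm_smul, Complex.norm_real, norm_div, norm_norm,
        Real.norm_of_nonneg (Real.sqrt_nonneg r), div_mul_cancel₀ _ (norm_ne_zero_iff.2 hv),
        Real.sq_sqrt hr.le]
    · rw [lp.norm_single (by simp), norm_smul, Complex.norm_real, norm_div, norm_norm,
        Real.norm_of_nonneg (Real.sqrt_nonneg r), div_mul_cancel₀ _ (norm_ne_zero_iff.2 hav),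
        Real.sq_sqrt hr.le]
  rw [hΦ ρ hρ] at h2
  have h3 : ‖ρ b‖ ≤ r * (u / r) :=
    (le_opNorm _ _).trans (mul_le_mul hρr hnorm (norm_nonneg _) hr.le)
  rw [mul_div_cancel₀ _ hr.ne'] at h3
  exact absurd ((Complex.re_le_norm _).trans h3) (not_le.2 h2)

/-- The predual of a weak* closed space of operators is complete: norm limits of ultraweak
functionals are ultraweak. -/
theorem exists_uw_of_mem_closure [CompleteSpace H] [CompleteSpace K]
    {j : E →ₗᵢ[ℂ] (H →L[ℂ] K)}
    (hS : @IsClosed _ (weakStar H K) (LinearMap.range j.toLinearMap : Set (H →L[ℂ] K)))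
    {ψ : StrongDual ℂ E} (hψ : ψ ∈ (normalDual j).topologicalClosure) :
    ∃ ξ η, ψ = uwOn j ξ η := by
  -- Successive approximation: representing vectors with geometrically decreasing norms are stacked.
  have step : ∀ (ρ : StrongDual ℂ E) (r : ℝ), ∃ ξ η,
      ρ ∈ (normalDual j).topologicalClosure → 0 < r → ‖ρ‖ ≤ r →
      ‖ξ‖ ^ 2 ≤ r ∧ ‖η‖ ^ 2 ≤ r ∧ ‖ρ - uwOn j ξ η‖ ≤ r / 2 := by
    intro ρ r
    by_cases h : ρ ∈ (normalDual j).topologicalClosure ∧ 0 < r ∧ ‖ρ‖ ≤ r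
    · obtain ⟨_, ⟨ξ, η, h1, h2, rfl⟩, h3⟩ := Metric.mem_closure_iff.1
        (mem_closure_uwBall hS h.2.1 h.1 h.2.2) (r / 2) (half_pos h.2.1)
      exact ⟨ξ, η, fun _ _ _ => ⟨h1, h2, by rw [← dist_eq_norm]; exact h3.le⟩⟩
    · exact ⟨0, 0, fun h1 h2 h3 => absurd ⟨h1, h2, h3⟩ h⟩
  choose X Y hXY using step
  let R (k : ℕ) : ℝ := (‖ψ‖ + 1) * (1 / 2) ^ k
  have hR (k : ℕ) : 0 < R k := by positivity
  let ρ (k : ℕ) : StrongDual ℂ E :=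
    Nat.rec ψ (fun k ρ => ρ - uwOn j (X ρ (R k)) (Y ρ (R k))) k
  have hρ_succ (k : ℕ) : ρ (k + 1) =
    ρ k - uwOn j (X (ρ k) (R k)) (Y (ρ k) (R k)) := rfl
  have hρ (k : ℕ) : ρ k ∈ (normalDual j).topologicalClosure ∧ ‖ρ k‖ ≤ R k := by
    induction k with
    | zero => exact ⟨hψ, by change ‖ψ‖ ≤ (‖ψ‖ + 1) * (1 / 2) ^ 0; linarith⟩
    | succ k ih =>
      refine ⟨?_, ?_⟩
      · rw [hρ_succ]
        exact sub_mem ih.1 (Submodule.le_topologicalClosure _ ⟨_, _, rfl⟩)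
      · rw [hρ_succ]
        refine (hXY _ _ ih.1 (hR k) ih.2).2.2.trans_eq ?_
        simp only [R, pow_succ]; ring
  have hsR : Summable R := (summable_geometric_of_lt_one (by norm_num) (by norm_num)).mul_left _
  have hX : Summable fun k => ‖X (ρ k) (R k)‖ ^ 2 := Summable.of_nonneg_of_le
    (fun _ => by positivity) (fun k => (hXY _ _ (hρ k).1 (hR k) (hρ k).2).1) hsR
  have hY : Summable fun k => ‖Y (ρ k) (R k)‖ ^ 2 := Summable.of_nonneg_of_le
    (fun _ => by positivity) (fun k => (hXY _ _ (hρ k).1 (hR k) (hρ k).2).2.1) hsR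
  refine ⟨stack _ hX, stack _ hY, ?_⟩
  ext s
  have h1 := (hasSum_uw_stack hX hY (j s)).tendsto_sum_nat
  have h2 (n : ℕ) : ∑ k ∈ Finset.range n, uw (X (ρ k) (R k)) (Y (ρ k) (R k)) (j s) =
      ψ s - ρ n s := by
    induction n with
    | zero => simp [ρ]
    | succ n ih =>
      rw [Finset.sum_range_succ, ih, hρ_succ, sub_apply, uwOn_apply]
      ring
  simp_rw [h2] at h1
  have h3 : Filter.Tendsto (fun n => ρ n) Filter.atTop (nhds 0) :=
    squeeze_zero_norm (fun n => (hρ n).2) hsR.tendsto_atTop_zero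
  have h4 : Filter.Tendsto (fun n => ψ s - ρ n s) Filter.atTop (nhds (ψ s - 0)) :=
    tendsto_const_nhds.sub
      (((ContinuousLinearMap.apply ℂ ℂ s).continuous.tendsto (0 : StrongDual ℂ E)).comp h3)
  rw [sub_zero] at h4
  exact tendsto_nhds_unique h4 h1

theorem exists_uw_of_approx [CompleteSpace H] [CompleteSpace K] {j : E →ₗᵢ[ℂ] (H →L[ℂ] K)}
    (hS : @IsClosed _ (weakStar H K) (LinearMap.range j.toLinearMap : Set (H →L[ℂ] K)))
    (ψ : E →ₗ[ℂ] ℂ)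
    (h : ∀ ε > 0, ∃ ξ η, ∀ s, ‖ψ s - uw ξ η (j s)‖ ≤ ε * ‖s‖) :
    ∃ ξ η, ∀ s, ψ s = uw ξ η (j s) := by
  obtain ⟨ξ, η, hφψ⟩ := h 1 one_pos
  let ψ' : StrongDual ℂ E := ψ.mkContinuous (1 + ‖η‖ * ‖ξ‖) fun s => by
    have h1 := hφψ s
    have h2 := norm_uw_apply_le ξ η (j s)
    have h3 := norm_le_norm_sub_add (ψ s) (uw ξ η (j s))
    rw [j.norm_map] at h2
    linarith
  have hψ' : ψ' ∈ (normalDual j).topologicalClosure := by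
    refine Metric.mem_closure_iff.2 fun ε hε => ?_
    obtain ⟨ξ, η, hφψ⟩ := h (ε / 2) (half_pos hε)
    refine ⟨_, ⟨ξ, η, rfl⟩, ?_⟩
    rw [dist_eq_norm]
    exact (opNorm_le_bound _ (half_pos hε).le hφψ).trans_lt (half_lt_self hε)
  obtain ⟨ξ, η, h⟩ := exists_uw_of_mem_closure hS hψ'
  exact ⟨ξ, η, fun s => DFunLike.congr_fun h s⟩

/-- Norm limits of weak* continuous functionals on a weak* closed space of operators are weak*
continuous. -/
theorem continuous_weakStarOn_of_approx [CompleteSpace H] [CompleteSpace K]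
    {S : Submodule ℂ (H →L[ℂ] K)}
    (hS : @IsClosed _ (weakStar H K) (S : Set (H →L[ℂ] K))) (ψ : S →ₗ[ℂ] ℂ)
    (h : ∀ ε > 0, ∃ φ : S →ₗ[ℂ] ℂ, @Continuous S ℂ (weakStarOn (S : Set (H →L[ℂ] K))) _ φ ∧
      ∀ s : S, ‖ψ s - φ s‖ ≤ ε * ‖(s : H →L[ℂ] K)‖) :
    @Continuous S ℂ (weakStarOn (S : Set (H →L[ℂ] K))) _ ψ := by
  refine (continuous_weakStarOn_iff ψ).2 (exists_uw_of_approx (E := S) (j := S.subtypeₗᵢ) ?_ ψ ?_)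
  · rw [show LinearMap.range S.subtypeₗᵢ.toLinearMap = S from S.range_subtype]
    exact hS
  · intro ε hε
    obtain ⟨φ, hφ, hφψ⟩ := h ε hε
    obtain ⟨ξ, η, hφ⟩ := (continuous_weakStarOn_iff φ).1 hφ
    refine ⟨ξ, η, fun s => ?_⟩
    have := hφψ s
    rw [hφ] at this
    exact this

end Functional

/-! ### Contractive projections between corners of von Neumann algebras -/

section Corner

variable {L : Type*} [NormedAddCommGroup L] [InnerProductSpace ℂ L] [CompleteSpace L]

theorem vn_smul_mem {N : VonNeumannAlgebra L} (c : ℂ) {a : L →L[ℂ] L} (ha : a ∈ N) :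
    c • a ∈ N :=
  N.toStarSubalgebra.smul_mem ha c

theorem vn_mem_iff {N : VonNeumannAlgebra L} {a : L →L[ℂ] L} :
    a ∈ N ↔ ∀ g ∈ N.commutant, g * a = a * g := by
  rw [← VonNeumannAlgebra.mem_commutant_iff, VonNeumannAlgebra.commutant_commutant]

theorem vn_cfc_mem {N : VonNeumannAlgebra L} {h : L →L[ℂ] L} (hN : h ∈ N) (φ : ℝ → ℝ) :
    cfc φ h ∈ N := by
  refine vn_mem_iff.2 fun g hg => ?_
  have h1 : Commute h g := (vn_mem_iff.1 hN g hg).symm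
  exact (h1.cfc_real φ).symm

/-- `Φ` is a contractive projection of the corner `e M f` onto the corner `e N f`. It is encoded
as a linear map on all of `B(L)`, of which only the restriction to `M` matters, precomposed with
the compression `a ↦ e a f`. -/
structure IsCornerProj (M N : VonNeumannAlgebra L) (e f : L →L[ℂ] L)
    (Φ : (L →L[ℂ] L) →ₗ[ℂ] (L →L[ℂ] L)) : Prop where
  le : N ≤ M
  left_proj : IsStarProjection e
  right_proj : IsStarProjection f
  left_mem : e ∈ N
  right_mem : f ∈ N
  map_mem : ∀ a ∈ M, Φ a ∈ N
  mul_map : ∀ a ∈ M, e * Φ a = Φ a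
  map_mul : ∀ a ∈ M, Φ a * f = Φ a
  map_compress : ∀ a ∈ M, Φ (e * a * f) = Φ a
  map_of_mem : ∀ n ∈ N, Φ n = e * n * f
  norm_le : ∀ a ∈ M, ‖Φ a‖ ≤ ‖a‖

namespace IsCornerProj

variable {M N : VonNeumannAlgebra L} {e f : L →L[ℂ] L} {Φ : (L →L[ℂ] L) →ₗ[ℂ] (L →L[ℂ] L)}

theorem norm_sq_le_inner_of_mul_self_le {g : L →L[ℂ] L} (hg : IsSelfAdjoint g) (hgg : g * g ≤ g)
    (w : L) : ‖g w‖ ^ 2 ≤ (inner ℂ (g w) w).re := by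
  have h1 := ((le_def _ _).1 hgg).re_inner_nonneg_left w
  have h2 : inner ℂ ((g * g) w) w = inner ℂ (g w) (g w) := by
    rw [mul_apply_eq_comp, ← adjoint_inner_right, ← star_eq_adjoint, hg.star_eq]
  rw [sub_apply, inner_sub_left, h2, inner_self_eq_norm_sq_to_K] at h1
  simp [← Complex.ofReal_pow] at h1
  exact h1

theorem norm_apply_le_of_mul_self_le {g : L →L[ℂ] L} (hg : IsSelfAdjoint g) (hgg : g * g ≤ g)
    (w : L) : ‖g w‖ ≤ ‖w‖ := by
  have h1 := norm_sq_le_inner_of_mul_self_le hg hgg w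
  have h2 : (inner ℂ (g w) w).re ≤ ‖g w‖ * ‖w‖ :=
    (Complex.re_le_norm _).trans (norm_inner_le_norm _ _)
  by_contra hlt
  push Not at hlt
  nlinarith [norm_nonneg w, norm_nonneg (g w)]

theorem norm_sq_add_le {g k : L →L[ℂ] L} (hg : IsSelfAdjoint g) (hgk : g * k = 0)
    (a z : L →L[ℂ] L) {t : ℝ} (ht : 0 ≤ t) :
    ‖k * a + (t : ℂ) • (g * z)‖ ^ 2 ≤ ‖k * a‖ ^ 2 + t ^ 2 * ‖g * z‖ ^ 2 := by
  have key : ‖k * a + (t : ℂ) • (g * z)‖ ≤ √(‖k * a‖ ^ 2 + t ^ 2 * ‖g * z‖ ^ 2) := by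
    refine opNorm_le_bound _ (by positivity) fun v => ?_
    refine (abs_le_of_sq_le_sq' ?_ (by positivity)).2
    rw [mul_pow, Real.sq_sqrt (by positivity)]
    have h0 : inner ℂ ((k * a) v) (((t : ℂ) • (g * z)) v) = 0 := by
      rw [smul_apply, inner_smul_right, mul_apply_eq_comp g z,
        ← adjoint_inner_left, ← star_eq_adjoint, hg.star_eq, ← mul_apply_eq_comp, ← mul_assoc, hgk]
      simp
    have h1 := norm_add_sq_eq_norm_sq_add_norm_sq_of_inner_eq_zero _ _ h0
    rw [add_apply, sq, h1, ← sq, ← sq, smul_apply, norm_smul, Complex.norm_real,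
      Real.norm_of_nonneg ht]
    have h2 : ‖(k * a) v‖ ^ 2 ≤ (‖k * a‖ * ‖v‖) ^ 2 := by gcongr; exact le_opNorm _ _
    have h3 : ‖(g * z) v‖ ^ 2 ≤ (‖g * z‖ * ‖v‖) ^ 2 := by gcongr; exact le_opNorm _ _
    nlinarith [mul_le_mul_of_nonneg_left h3 (sq_nonneg t)]
  calc _ ≤ √(‖k * a‖ ^ 2 + t ^ 2 * ‖g * z‖ ^ 2) ^ 2 := by gcongr
    _ = _ := Real.sq_sqrt (by positivity)

theorem norm_mul_le_norm_add {g : L →L[ℂ] L} (hg : IsSelfAdjoint g) (hgg : g * g ≤ g)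
    (z : L →L[ℂ] L) {t : ℝ} (ht : 0 ≤ t) :
    (1 + t) * ‖g * z‖ ≤ ‖z + (t : ℂ) • (g * z)‖ := by
  rw [← le_div_iff₀' (by positivity)]
  refine opNorm_le_bound _ (by positivity) fun v => ?_
  rw [div_mul_eq_mul_div, le_div_iff₀' (by positivity)]
  refine le_trans ?_ (le_opNorm _ v)
  refine (abs_le_of_sq_le_sq' ?_ (by positivity)).2
  have h1 := norm_sq_le_inner_of_mul_self_le hg hgg (z v)
  have h2 := norm_apply_le_of_mul_self_le hg hgg (z v)
  have h3 : ‖(z + (t : ℂ) • (g * z)) v‖ ^ 2 =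
      ‖z v‖ ^ 2 + 2 * t * (inner ℂ (g (z v)) (z v)).re + t ^ 2 * ‖g (z v)‖ ^ 2 := by
    have h4 := norm_add_sq (𝕜 := ℂ) (z v) ((t : ℂ) • g (z v))
    rw [inner_smul_right, norm_smul, Complex.norm_real, Real.norm_of_nonneg ht] at h4
    have h5 : (inner ℂ (z v) (g (z v))).re = (inner ℂ (g (z v)) (z v)).re :=
      inner_re_symm (𝕜 := ℂ) _ _
    simp only [Complex.coe_smul, RCLike.re_to_complex, Complex.re_ofReal_mul, h5] at h4
    simp only [add_apply, smul_apply, mul_apply_eq_comp, Complex.coe_smul, h4]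
    ring
  rw [h3, mul_apply_eq_comp]
  nlinarith [mul_le_mul_of_nonneg_left h1 ht, pow_le_pow_left₀ (norm_nonneg _) h2 2]

/-- Tomiyama's argument. If `g k = 0` and `z = Φ (k a)`, then `k a` and `g z` are orthogonal, so
that `‖k a + t g z‖²` is at most `‖k a‖² + t² ‖g z‖²`, whereas its image `z + t g z` has norm at
least `(1 + t) ‖g z‖`. -/
theorem mul_map_mul_eq_zero (hΦ : IsCornerProj M N e f Φ) {g k : L →L[ℂ] L} (hgN : g ∈ N)
    (hkN : k ∈ N) (hg : IsSelfAdjoint g) (hgg : g * g ≤ g) (hge : g * e = e * g)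
    (hgk : g * k = 0) {a : L →L[ℂ] L} (ha : a ∈ M) : g * Φ (k * a) = 0 := by
  set z := Φ (k * a) with hz
  have hka : k * a ∈ M := mul_mem (hΦ.le hkN) ha
  have hzN : z ∈ N := hΦ.map_mem _ hka
  have hgz : Φ (g * z) = g * z := by
    rw [hΦ.map_of_mem _ (mul_mem hgN hzN), ← mul_assoc, ← hge, mul_assoc g, hΦ.mul_map _ hka,
      mul_assoc, hΦ.map_mul _ hka]
  have key (t : ℝ) (ht : 0 ≤ t) : (1 + 2 * t) * ‖g * z‖ ^ 2 ≤ ‖k * a‖ ^ 2 := by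
    have h1 := norm_mul_le_norm_add hg hgg z ht
    have h2 : ‖z + (t : ℂ) • (g * z)‖ ≤ ‖k * a + (t : ℂ) • (g * z)‖ := by
      have h3 := hΦ.norm_le (k * a + (t : ℂ) • (g * z))
        (add_mem hka (vn_smul_mem _ (hΦ.le (mul_mem hgN hzN))))
      rwa [map_add, map_smul, hgz, ← hz] at h3
    have h3 := norm_sq_add_le hg hgk a z ht
    have h4 : ((1 + t) * ‖g * z‖) ^ 2 ≤ ‖k * a + (t : ℂ) • (g * z)‖ ^ 2 := by
      gcongr; exact h1.trans h2
    nlinarith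
  by_contra hne
  have hpos : 0 < ‖g * z‖ ^ 2 := by positivity
  have := key (‖k * a‖ ^ 2 / ‖g * z‖ ^ 2) (by positivity)
  have h5 : (1 + 2 * (‖k * a‖ ^ 2 / ‖g * z‖ ^ 2)) * ‖g * z‖ ^ 2 =
      ‖g * z‖ ^ 2 + 2 * ‖k * a‖ ^ 2 := by
    field_simp
  nlinarith [sq_nonneg ‖k * a‖]

/-- A tent function of width `2` centered at `i`, in the variable `x / δ`. -/
noncomputable def tent (δ : ℝ) (i : ℤ) (x : ℝ) : ℝ := max 0 (1 - |x / δ - i|)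

/-- A plateau function which is `1` on the support of `tent δ i`. -/
noncomputable def plateau (δ : ℝ) (i : ℤ) (x : ℝ) : ℝ := max 0 (min 1 (2 - |x / δ - i|))

theorem continuous_tent (δ : ℝ) (i : ℤ) : Continuous (tent δ i) := by unfold tent; fun_prop

theorem continuous_plateau (δ : ℝ) (i : ℤ) : Continuous (plateau δ i) := by
  unfold plateau; fun_prop

theorem tent_nonneg (δ : ℝ) (i : ℤ) (x : ℝ) : 0 ≤ tent δ i x := le_max_left _ _

theorem tent_le_one (δ : ℝ) (i : ℤ) (x : ℝ) : tent δ i x ≤ 1 :=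
  max_le zero_le_one (by linarith [abs_nonneg (x / δ - i)])

theorem tent_mul_plateau (δ : ℝ) (i : ℤ) (x : ℝ) : tent δ i x * (1 - plateau δ i x) = 0 := by
  unfold tent plateau
  rcases le_total (1 : ℝ) |x / δ - i| with h | h
  · rw [max_eq_left (by linarith), zero_mul]
  · rw [min_eq_left (by linarith), max_eq_right zero_le_one, sub_self, mul_zero]

theorem abs_sub_mul_tent_le {δ : ℝ} (hδ : 0 < δ) (i : ℤ) (x : ℝ) :
    |tent δ i x * (x - δ * i)| ≤ δ := by
  have h1 : x - δ * i = δ * (x / δ - i) := by field_simp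
  rw [abs_mul, h1, abs_mul, abs_of_pos hδ, abs_of_nonneg (tent_nonneg _ _ _)]
  unfold tent
  rcases le_total (1 : ℝ) |x / δ - i| with h | h
  · rw [max_eq_left (by linarith), zero_mul]; exact hδ.le
  · rw [max_eq_right (by linarith)]
    have h2 : (1 - |x / δ - i|) * |x / δ - i| ≤ 1 := by nlinarith [abs_nonneg (x / δ - i)]
    nlinarith

theorem abs_sub_mul_plateau_le {δ : ℝ} (hδ : 0 < δ) (i : ℤ) (x : ℝ) :
    |plateau δ i x * (x - δ * i)| ≤ 2 * δ := by
  have h1 : x - δ * i = δ * (x / δ - i) := by field_simp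
  have h0 : 0 ≤ plateau δ i x := le_max_left _ _
  have h2 : plateau δ i x ≤ 1 := max_le zero_le_one (min_le_left _ _)
  rw [abs_mul, h1, abs_mul, abs_of_pos hδ, abs_of_nonneg h0]
  rcases le_total (2 : ℝ) |x / δ - i| with h | h
  · have h3 : plateau δ i x = 0 := by
      unfold plateau
      rw [min_eq_right (by linarith), max_eq_left (by linarith)]
    rw [h3, zero_mul]; positivity
  · have h3 : plateau δ i x * |x / δ - i| ≤ 1 * 2 :=
      mul_le_mul h2 h (abs_nonneg _) zero_le_one
    nlinarith

theorem one_le_sum_tent_sq {δ : ℝ} (hδ : 0 < δ) {n : ℕ} {x : ℝ} (hx : |x| ≤ δ * n) :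
    1 ≤ ∑ i ∈ Finset.Icc (-(n : ℤ)) n, 4 * (tent δ i x * tent δ i x) := by
  have h1 : |x / δ| ≤ n := by
    rw [abs_div, abs_of_pos hδ, div_le_iff₀' hδ]; exact hx
  have h2 := abs_sub_round (x / δ)
  have h3 : round (x / δ) ∈ Finset.Icc (-(n : ℤ)) n := by
    have h4 := abs_le.1 h1
    have h5 := abs_le.1 h2
    have h6 : (round (x / δ) : ℝ) < (n + 1 : ℤ) := by push_cast; linarith
    have h7 : ((-(n : ℤ) - 1 : ℤ) : ℝ) < round (x / δ) := by push_cast; linarith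
    rw [Int.cast_lt] at h6 h7
    rw [Finset.mem_Icc]; omega
  refine le_trans ?_ (Finset.single_le_sum
    (f := fun i => 4 * (tent δ i x * tent δ i x)) (fun i _ => by
      have := tent_nonneg δ i x; positivity) h3)
  have h8 : 1 / 2 ≤ tent δ (round (x / δ)) x := le_max_of_le_right (by linarith)
  nlinarith

/-- The defect of modularity `h Φ(a) - Φ(h a)` is small where `h` is close to `δ i`: there `h` may
be replaced by `h - δ i`, and `Φ ((1 - plateau) ⋯)` is annihilated by the tent. -/
theorem norm_tent_mul_sub_le (hΦ : IsCornerProj M N e f Φ) {h : L →L[ℂ] L} (hN : h ∈ N)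
    (hh : IsSelfAdjoint h) (hhe : h * e = e * h) {a : L →L[ℂ] L} (ha : a ∈ M) {δ : ℝ}
    (hδ : 0 < δ) (i : ℤ) :
    ‖cfc (tent δ i) h * (h * Φ a - Φ (h * a))‖ ≤ 3 * δ * ‖a‖ := by
  set g := cfc (tent δ i) h with hg
  set p := cfc (plateau δ i) h with hp
  have hct := (continuous_tent δ i).continuousOn (s := spectrum ℝ h)
  have hcp := (continuous_plateau δ i).continuousOn (s := spectrum ℝ h)
  have hid : ContinuousOn (fun x : ℝ => x - δ * i) (spectrum ℝ h) := by fun_prop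
  set k := cfc (fun x : ℝ => x - δ * i) h with hk
  have hk' : k = h - ((δ * i : ℝ) : ℂ) • (1 : L →L[ℂ] L) := by
    rw [hk, cfc_sub (fun x => x) (fun _ => δ * i) h, cfc_id' ℝ h, cfc_const _ h,
      Algebra.algebraMap_eq_smul_one]
    rfl
  have hgs : IsSelfAdjoint g := cfc_predicate _ _
  have hgg : g * g ≤ g := by
    rw [hg, ← cfc_mul (tent δ i) (tent δ i) h]
    refine cfc_mono (fun x _ => ?_)
    nlinarith [tent_nonneg δ i x, tent_le_one δ i x]
  have hge : g * e = e * g := Commute.cfc_real hhe _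
  have hgp : g * (1 - p) = 0 := by
    rw [← cfc_one ℝ h, hg, hp, ← cfc_sub _ _ h, ← cfc_mul _ _ h, ← cfc_zero (R := ℝ) (a := h)]
    exact cfc_congr fun x _ => tent_mul_plateau δ i x
  have hnorm : ‖g‖ ≤ 1 := by
    refine norm_cfc_le zero_le_one fun x _ => ?_
    rw [Real.norm_of_nonneg (tent_nonneg _ _ _)]
    exact tent_le_one _ _ _
  have hgk : ‖g * k‖ ≤ δ := by
    rw [hg, hk, ← cfc_mul _ _ h]
    exact norm_cfc_le hδ.le fun x _ => abs_sub_mul_tent_le hδ i x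
  have hpk : ‖p * k‖ ≤ 2 * δ := by
    rw [hp, hk, ← cfc_mul _ _ h]
    exact norm_cfc_le (by positivity) fun x _ => abs_sub_mul_plateau_le hδ i x
  have hkN : k ∈ N := vn_cfc_mem hN _
  have hpN : p ∈ N := vn_cfc_mem hN _
  have hka : k * a ∈ M := mul_mem (hΦ.le hkN) ha
  have h1 : g * Φ (k * a) = g * Φ (p * k * a) := by
    have := hΦ.mul_map_mul_eq_zero (vn_cfc_mem hN _) (sub_mem (one_mem N) hpN) hgs hgg hge hgp hka
    rw [sub_mul, one_mul, map_sub, mul_sub, sub_eq_zero] at this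
    rw [this, mul_assoc]
  have h2 : h * Φ a - Φ (h * a) = k * Φ a - Φ (k * a) := by
    rw [hk', sub_mul, sub_mul, map_sub, smul_mul_assoc, smul_mul_assoc, map_smul, one_mul, one_mul]
    abel
  rw [h2, mul_sub, h1, ← mul_assoc]
  have h3 : ‖g * k * Φ a‖ ≤ δ * ‖a‖ :=
    (norm_mul_le _ _).trans (mul_le_mul hgk (hΦ.norm_le a ha) (norm_nonneg _) hδ.le)
  have h4 : ‖g * Φ (p * k * a)‖ ≤ 2 * δ * ‖a‖ := by
    calc _ ≤ ‖g‖ * ‖Φ (p * k * a)‖ := norm_mul_le _ _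
      _ ≤ 1 * ‖p * k * a‖ := by
        gcongr
        exact hΦ.norm_le _ (mul_mem (hΦ.le (mul_mem hpN hkN)) ha)
      _ ≤ ‖p * k‖ * ‖a‖ := by rw [one_mul]; exact norm_mul_le _ _
      _ ≤ _ := by gcongr
  calc _ ≤ ‖g * k * Φ a‖ + ‖g * Φ (p * k * a)‖ := norm_sub_le _ _
    _ ≤ _ := by linarith

/-- The tents centered at `δ i`, `|i| ≤ n`, form a partition of unity on the spectrum of `h`, up to
a constant. -/
theorem norm_sq_le_sum_tent {h : L →L[ℂ] L} (hh : IsSelfAdjoint h) {δ : ℝ} (hδ : 0 < δ) {n : ℕ}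
    (hn : ‖h‖ ≤ δ * n) (v : L) :
    ‖v‖ ^ 2 ≤ ∑ i ∈ Finset.Icc (-(n : ℤ)) n, 4 * ‖cfc (tent δ i) h v‖ ^ 2 := by
  have h1 : (1 : L →L[ℂ] L) ≤
      ∑ i ∈ Finset.Icc (-(n : ℤ)) n, (4 : ℂ) • (cfc (tent δ i) h * cfc (tent δ i) h) := by
    have hc (i : ℤ) : ContinuousOn (fun x => 4 * (tent δ i x * tent δ i x)) (spectrum ℝ h) := by
      have hct := (continuous_tent δ i).continuousOn (s := spectrum ℝ h)
      fun_prop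
    have h2 : ∑ i ∈ Finset.Icc (-(n : ℤ)) n, (4 : ℂ) • (cfc (tent δ i) h * cfc (tent δ i) h) =
        cfc (∑ i ∈ Finset.Icc (-(n : ℤ)) n, fun x => 4 * (tent δ i x * tent δ i x)) h := by
      rw [cfc_sum _ _ _ (fun i _ => hc i)]
      refine Finset.sum_congr rfl fun i _ => ?_
      have hct := (continuous_tent δ i).continuousOn (s := spectrum ℝ h)
      rw [cfc_const_mul (4 : ℝ) (fun x => tent δ i x * tent δ i x) h, cfc_mul _ _ h]
      norm_cast
    rw [h2, ← cfc_one ℝ h]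
    refine cfc_mono (fun x hx => ?_) (by fun_prop) ?_
    · rw [Finset.sum_apply]
      refine one_le_sum_tent_sq hδ ?_
      refine (spectrum.norm_le_norm_mul_of_mem hx).trans (le_trans ?_ hn)
      exact mul_le_of_le_one_right (norm_nonneg _) norm_id_le
    · rw [show (∑ i ∈ Finset.Icc (-(n : ℤ)) n, fun x => 4 * (tent δ i x * tent δ i x)) =
        fun x => ∑ i ∈ Finset.Icc (-(n : ℤ)) n, 4 * (tent δ i x * tent δ i x) from
        funext fun x => Finset.sum_apply _ _ _]
      exact continuousOn_finsetSum _ fun i _ => hc i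
  have h3 := ((le_def _ _).1 h1).re_inner_nonneg_left v
  have h4 (i : ℤ) : inner ℂ ((cfc (tent δ i) h * cfc (tent δ i) h) v) v =
      inner ℂ (cfc (tent δ i) h v) (cfc (tent δ i) h v) := by
    have hs : IsSelfAdjoint (cfc (tent δ i) h) := cfc_predicate _ _
    rw [mul_apply_eq_comp, ← adjoint_inner_right, ← star_eq_adjoint, hs.star_eq]
  rw [sub_apply, inner_sub_left, sum_apply, sum_inner] at h3
  simp only [smul_apply, inner_smul_left, h4, inner_self_eq_norm_sq_to_K] at h3
  simp [← Complex.ofReal_pow] at h3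
  exact h3

theorem map_mul_left_of_isSelfAdjoint (hΦ : IsCornerProj M N e f Φ) {h : L →L[ℂ] L} (hN : h ∈ N)
    (hh : IsSelfAdjoint h) (hhe : h * e = e * h) {a : L →L[ℂ] L} (ha : a ∈ M) :
    Φ (h * a) = h * Φ a := by
  set D := h * Φ a - Φ (h * a) with hD
  suffices hD0 : D = 0 from (sub_eq_zero.1 hD0).symm
  set R := ‖h‖ + 1
  have hR : 0 < R := by positivity
  -- Only about `2n + 1` tents of width `R / n` are needed, and each contributes `O(n⁻²)`.
  have key (n : ℕ) (hn : 0 < n) : n * ‖D‖ ^ 2 ≤ 108 * R ^ 2 * ‖a‖ ^ 2 := by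
    have hn' : (1 : ℝ) ≤ n := by exact_mod_cast hn
    set δ := R / n with hδ
    have hδ0 : 0 < δ := by positivity
    have hδn : δ * n = R := by rw [hδ]; field_simp
    have h1 : ‖D‖ ≤ √((2 * n + 1) * (4 * (3 * δ * ‖a‖) ^ 2)) := by
      refine opNorm_le_bound _ (by positivity) fun v => ?_
      refine (abs_le_of_sq_le_sq' ?_ (by positivity)).2
      rw [mul_pow, Real.sq_sqrt (by positivity)]
      refine (norm_sq_le_sum_tent hh hδ0 (n := n) (by rw [hδn]; simp [R]) (D v)).trans ?_
      have h2 : ∀ i ∈ Finset.Icc (-(n : ℤ)) n, 4 * ‖cfc (tent δ i) h (D v)‖ ^ 2 ≤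
          4 * (3 * δ * ‖a‖) ^ 2 * ‖v‖ ^ 2 := by
        intro i _
        have h3 : ‖cfc (tent δ i) h (D v)‖ ≤ 3 * δ * ‖a‖ * ‖v‖ :=
          (le_opNorm (cfc (tent δ i) h * D) v).trans
            (by gcongr; exact hΦ.norm_tent_mul_sub_le hN hh hhe ha hδ0 i)
        calc _ ≤ 4 * (3 * δ * ‖a‖ * ‖v‖) ^ 2 := by gcongr
          _ = _ := by ring
      refine (Finset.sum_le_sum h2).trans_eq ?_
      rw [Finset.sum_const, Int.card_Icc, nsmul_eq_mul, ← mul_assoc]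
      congr 2
      have : ((n : ℤ) + 1 - -(n : ℤ)).toNat = 2 * n + 1 := by omega
      rw [this]; push_cast; ring
    have h2 : ‖D‖ ^ 2 ≤ (2 * n + 1) * (4 * (3 * δ * ‖a‖) ^ 2) := by
      calc _ ≤ √((2 * n + 1) * (4 * (3 * δ * ‖a‖) ^ 2)) ^ 2 := by gcongr
        _ = _ := Real.sq_sqrt (by positivity)
    calc n * ‖D‖ ^ 2 ≤ n * ((3 * n) * (4 * (3 * δ * ‖a‖) ^ 2)) := by
          gcongr; refine h2.trans ?_; gcongr; linarith
      _ = 108 * (δ * n) ^ 2 * ‖a‖ ^ 2 := by ring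
      _ = _ := by rw [hδn]
  by_contra hne
  have hpos : 0 < ‖D‖ ^ 2 := by positivity
  obtain ⟨n, hn⟩ := exists_nat_gt (108 * R ^ 2 * ‖a‖ ^ 2 / ‖D‖ ^ 2)
  rw [div_lt_iff₀ hpos] at hn
  have hn0 : 0 < n := by
    rcases Nat.eq_zero_or_pos n with rfl | h0
    · exact absurd hn (not_lt.2 (by simp; positivity))
    · exact h0
  exact absurd (key n hn0) (not_le.2 hn)

/-- A contractive projection between corners is left modular over the elements of `N` commuting
with the left projection of the corner. -/
theorem map_mul_left (hΦ : IsCornerProj M N e f Φ) {n : L →L[ℂ] L} (hn : n ∈ N)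
    (hne : n * e = e * n) {a : L →L[ℂ] L} (ha : a ∈ M) : Φ (n * a) = n * Φ a := by
  have hes : star e = e := hΦ.left_proj.isSelfAdjoint.star_eq
  have hne' : star n * e = e * star n := by
    have := congrArg star hne
    rw [star_mul, star_mul, hes] at this
    exact this.symm
  have h1 := hΦ.map_mul_left_of_isSelfAdjoint (h := n + star n) (add_mem hn (star_mem hn))
    (IsSelfAdjoint.add_star_self n) (by rw [add_mul, mul_add, hne, hne']) ha
  have h2 := hΦ.map_mul_left_of_isSelfAdjoint (h := Complex.I • (n - star n))
    (vn_smul_mem _ (sub_mem hn (star_mem hn)))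
    (by rw [IsSelfAdjoint, star_smul, star_sub, star_star, Complex.star_def, Complex.conj_I,
          neg_smul, ← smul_neg, neg_sub])
    (by rw [smul_mul_assoc, mul_smul_comm, sub_mul, mul_sub, hne, hne']) ha
  rw [smul_mul_assoc, map_smul, smul_mul_assoc] at h2
  have h3 := smul_right_injective _ Complex.I_ne_zero h2
  simp only [add_mul, sub_mul, map_add, map_sub] at h1 h3
  have h4 : (2 : ℂ) • Φ (n * a) = (2 : ℂ) • (n * Φ a) := by
    have := congrArg₂ (· + ·) h1 h3
    simp only [add_add_sub_cancel] at this
    rw [two_smul, two_smul]; exact this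
  exact smul_right_injective _ two_ne_zero h4

/-- The map `a ↦ Φ(a*)*`. -/
noncomputable def conjStar (Φ : (L →L[ℂ] L) →ₗ[ℂ] (L →L[ℂ] L)) :
    (L →L[ℂ] L) →ₗ[ℂ] (L →L[ℂ] L) where
  toFun a := star (Φ (star a))
  map_add' a b := by simp
  map_smul' c a := by simp [star_smul]

theorem conjStar_apply (a : L →L[ℂ] L) : conjStar Φ a = star (Φ (star a)) := rfl

theorem conjStar_isCornerProj (hΦ : IsCornerProj M N e f Φ) :
    IsCornerProj M N f e (conjStar Φ) where
  le := hΦ.le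
  left_proj := hΦ.right_proj
  right_proj := hΦ.left_proj
  left_mem := hΦ.right_mem
  right_mem := hΦ.left_mem
  map_mem a ha := star_mem (hΦ.map_mem _ (star_mem ha))
  mul_map a ha := by
    nth_rw 1 [conjStar_apply, ← hΦ.right_proj.isSelfAdjoint.star_eq]
    rw [← star_mul, hΦ.map_mul _ (star_mem ha), conjStar_apply]
  map_mul a ha := by
    nth_rw 1 [conjStar_apply, ← hΦ.left_proj.isSelfAdjoint.star_eq]
    rw [← star_mul, hΦ.mul_map _ (star_mem ha), conjStar_apply]
  map_compress a ha := by
    rw [conjStar_apply, star_mul, star_mul, hΦ.right_proj.isSelfAdjoint.star_eq,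
      hΦ.left_proj.isSelfAdjoint.star_eq, ← mul_assoc, hΦ.map_compress _ (star_mem ha),
      conjStar_apply]
  map_of_mem n hn := by
    rw [conjStar_apply, hΦ.map_of_mem _ (star_mem hn), star_mul, star_mul, star_star,
      hΦ.right_proj.isSelfAdjoint.star_eq, hΦ.left_proj.isSelfAdjoint.star_eq, mul_assoc]
  norm_le a ha := by
    rw [conjStar_apply, norm_star, ← norm_star a]
    exact hΦ.norm_le _ (star_mem ha)

/-- A contractive projection between corners is right modular over the elements of `N` commuting
with the right projection of the corner. -/
theorem map_mul_right (hΦ : IsCornerProj M N e f Φ) {n : L →L[ℂ] L} (hn : n ∈ N)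
    (hnf : n * f = f * n) {a : L →L[ℂ] L} (ha : a ∈ M) : Φ (a * n) = Φ a * n := by
  have hfs : star f = f := hΦ.right_proj.isSelfAdjoint.star_eq
  have h1 := hΦ.conjStar_isCornerProj.map_mul_left (star_mem hn) (by
    have := congrArg star hnf
    rw [star_mul, star_mul, hfs] at this
    exact this.symm) (star_mem ha)
  simp only [conjStar_apply, star_mul, star_star] at h1
  have := congrArg star h1
  simpa using this

end IsCornerProj

end Corner

section Corner

variable {L : Type*} [NormedAddCommGroup L] [InnerProductSpace ℂ L] [CompleteSpace L]

/-! ### Extension of corner projections -/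

/-- `p` is the support of the projection `f` in `N`: a projection of `N` commuting with `M` such
that the vectors `n (f v)`, for `n ∈ N`, span a dense subspace of the range of `p`. Density is
stated in terms of orthogonal complements. -/
structure IsCentralSupport (M N : VonNeumannAlgebra L) (f p : L →L[ℂ] L) : Prop where
  proj : IsStarProjection p
  mem : p ∈ N
  comm : ∀ m ∈ M, m * p = p * m
  mul_eq : p * f = f
  eq_zero : ∀ v : L, (∀ n ∈ N, f (n v) = 0) → p v = 0

theorem IsCentralSupport.mul_eq_zero {M N : VonNeumannAlgebra L} {f p : L →L[ℂ] L}
    (hp : IsCentralSupport M N f p) (hf : IsStarProjection f) {d : L →L[ℂ] L}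
    (hd : ∀ n ∈ N, d * (n * f) = 0) : d * p = 0 := by
  have h1 : p * star d = 0 := by
    ext v
    refine hp.eq_zero _ fun n hn => ?_
    have h2 := congrArg star (hd _ (star_mem hn))
    rw [star_mul, star_mul, star_star, hf.isSelfAdjoint.star_eq, star_zero] at h2
    exact DFunLike.congr_fun h2 v
  have h2 := congrArg star h1
  rwa [star_mul, star_star, hp.proj.isSelfAdjoint.star_eq, star_zero] at h2

theorem norm_apply_sq_eq (q : L →L[ℂ] L) (v : L) :
    ‖q v‖ ^ 2 = (inner ℂ ((star q * q) v) v).re := by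
  rw [mul_apply_eq_comp, star_eq_adjoint, adjoint_inner_left, inner_self_eq_norm_sq_to_K]
  simp [← Complex.ofReal_pow]

/-- The norm of an element of `N p` can be tested on `N f`, if `p` is the support of `f`. -/
theorem IsCentralSupport.norm_le {M N : VonNeumannAlgebra L} {f p : L →L[ℂ] L}
    (hp : IsCentralSupport M N f p) (hf : IsStarProjection f) (hfN : f ∈ N)
    {q : L →L[ℂ] L} (hq : q ∈ N) (hqp : q * p = q) {R : ℝ} (hR : 0 ≤ R)
    (h : ∀ n ∈ N, n * f = n → ‖q * n‖ ≤ R * ‖n‖) : ‖q‖ ≤ R := by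
  by_contra hlt
  push Not at hlt
  -- With `R² < s < ‖q‖²`, the positive part `b` of `q* q - s` is nonzero, and `q` expands the
  -- range of `b` by a factor of at least `√s > R`.
  set s : ℝ := (R ^ 2 + ‖q‖ ^ 2) / 2 with hs
  have hRq : R ^ 2 < ‖q‖ ^ 2 := by gcongr
  have hs1 : R ^ 2 < s := by linarith
  have hs2 : s < ‖q‖ ^ 2 := by linarith
  have hs0 : 0 < s := (sq_nonneg R).trans_lt hs1
  set a : L →L[ℂ] L := star q * q - (s : ℂ) • 1 with ha
  have haN : a ∈ N := sub_mem (mul_mem (star_mem hq) hq) (vn_smul_mem _ (one_mem N))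
  have has : IsSelfAdjoint a := (IsSelfAdjoint.star_mul_self q).sub (by
    rw [IsSelfAdjoint, star_smul, star_one, Complex.star_def, Complex.conj_ofReal])
  set b := cfc (fun x : ℝ => max x 0) a with hb
  have hbN : b ∈ N := vn_cfc_mem haN _
  have hbs : IsSelfAdjoint b := cfc_predicate _ _
  have hb0 : 0 ≤ b := cfc_nonneg fun x _ => le_max_right _ _
  have hab : a ≤ b := by
    nth_rw 1 [← cfc_id' ℝ a]
    exact cfc_mono fun x _ => le_max_left _ _
  have hba : b * a = b * b := by
    have h1 : b * a = b * cfc (fun x : ℝ => x) a := by rw [cfc_id' ℝ a]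
    rw [h1, hb, ← cfc_mul _ _ a, ← cfc_mul _ _ a]
    refine cfc_congr fun x _ => ?_
    rcases le_total x 0 with hx | hx
    · simp [max_eq_right hx]
    · simp [max_eq_left hx]
  have hqq : star q * q = a + (s : ℂ) • 1 := by rw [ha]; abel
  have hexp (w : L) : s * ‖b w‖ ^ 2 ≤ ‖q (b w)‖ ^ 2 := by
    have h1 : inner ℂ (a (b w)) (b w) = inner ℂ (b (b w)) (b w) := by
      have h2 (y : L) : inner ℂ y (b w) = inner ℂ (b y) w := by
        rw [← adjoint_inner_left, ← star_eq_adjoint, hbs.star_eq]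
      rw [h2, h2, ← mul_apply_eq_comp, ← mul_apply_eq_comp b b, hba]
    have h2 := (nonneg_iff_isPositive b).1 hb0 |>.re_inner_nonneg_left (b w)
    rw [norm_apply_sq_eq q, hqq, add_apply, inner_add_left, h1, smul_apply, one_apply_eq_self,
      inner_smul_left, inner_self_eq_norm_sq_to_K, Complex.conj_ofReal, Complex.add_re]
    simp [-Complex.ofReal_pow] at h2 ⊢
    simpa [← Complex.ofReal_pow, ← Complex.ofReal_mul] using h2
  have hbn : ∀ n ∈ N, b * (n * f) = 0 := by
    intro n hn
    by_contra hne
    have hnorm : 0 < ‖b * (n * f)‖ := norm_pos_iff.2 hne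
    have h1 := h (b * (n * f)) (mul_mem hbN (mul_mem hn hfN)) (by
      rw [mul_assoc, mul_assoc, hf.isIdempotentElem.eq])
    have h2 : ‖b * (n * f)‖ ≤ ‖q * (b * (n * f))‖ / √s := by
      refine opNorm_le_bound _ (by positivity) fun v => ?_
      rw [div_mul_eq_mul_div, le_div_iff₀ (by positivity)]
      refine le_trans ?_ (le_opNorm _ v)
      refine (abs_le_of_sq_le_sq' ?_ (norm_nonneg _)).2
      rw [mul_pow, Real.sq_sqrt hs0.le, mul_comm]
      exact hexp _
    rw [le_div_iff₀ (by positivity)] at h2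
    have h3 : √s ≤ R := by
      have := h2.trans h1
      rw [mul_comm] at this
      exact le_of_mul_le_mul_right this hnorm
    exact absurd (Real.sqrt_le_iff.1 h3).2 (not_le.2 hs1)
  have hbp := hp.mul_eq_zero hf hbn
  have hb_zero : b = 0 := by
    have h1 : b * (star q * q) = 0 := by
      rw [← hqp, star_mul, hp.proj.isSelfAdjoint.star_eq, mul_assoc, ← mul_assoc b, hbp, zero_mul]
    rw [hqq, mul_add, hba, mul_smul_comm, mul_one] at h1
    ext v
    have h2 := (nonneg_iff_isPositive b).1 hb0 |>.re_inner_nonneg_left v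
    have h3 : inner ℂ ((b * b + (s : ℂ) • b) v) v = 0 := by rw [h1]; simp
    have h4 : ‖b v‖ ^ 2 + s * (inner ℂ (b v) v).re = 0 := by
      have h5 := norm_apply_sq_eq b v
      rw [hbs.star_eq] at h5
      have h6 := congrArg Complex.re h3
      rw [add_apply, inner_add_left, Complex.add_re, ← h5, smul_apply, inner_smul_left,
        Complex.conj_ofReal, Complex.re_ofReal_mul] at h6
      exact h6
    have h7 : 0 ≤ s * (inner ℂ (b v) v).re := mul_nonneg hs0.le h2
    have h8 : ‖b v‖ ^ 2 = 0 := le_antisymm (by linarith) (sq_nonneg _)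
    simpa using h8
  have hq_le : ‖q‖ ≤ √s := by
    refine opNorm_le_bound _ (by positivity) fun v => ?_
    refine (abs_le_of_sq_le_sq' ?_ (by positivity)).2
    rw [mul_pow, Real.sq_sqrt hs0.le, norm_apply_sq_eq]
    rw [hb_zero] at hab
    have h1 := ((le_def _ _).1 hab).re_inner_nonneg_left v
    rw [hqq, add_apply, inner_add_left, smul_apply, one_apply_eq_self, inner_smul_left,
      Complex.conj_ofReal, inner_self_eq_norm_sq_to_K, Complex.add_re]
    rw [zero_sub, neg_apply, inner_neg_left, map_neg] at h1
    have h2 : ((s : ℂ) * (‖v‖ : ℂ) ^ 2).re = s * ‖v‖ ^ 2 := by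
      rw [← Complex.ofReal_pow, ← Complex.ofReal_mul, Complex.ofReal_re]
    have h3 : 0 ≤ -(inner ℂ (a v) v).re := h1
    refine (add_le_add (neg_nonneg.1 h3) h2.le).trans_eq (zero_add _)
  have h1 : ‖q‖ ^ 2 ≤ s := (Real.le_sqrt' (hR.trans_lt hlt)).1 hq_le
  linarith

/-- The resolvent `(c + ε)⁻¹` of a positive element `c` of a von Neumann algebra. -/
theorem exists_resolvent {N : VonNeumannAlgebra L} {c : L →L[ℂ] L} (hcN : c ∈ N) (hc0 : 0 ≤ c)
    {ε : ℝ} (hε : 0 < ε) :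
    ∃ r ∈ N, IsSelfAdjoint r ∧ 1 - c * r = (ε : ℂ) • r ∧ ‖c * r‖ ≤ 1 ∧ ‖r * c * r‖ ≤ ε⁻¹ := by
  have hcs : IsSelfAdjoint c := .of_nonneg hc0
  have hspec : ∀ x ∈ spectrum ℝ c, 0 ≤ x := fun x hx => spectrum_nonneg_of_nonneg hc0 hx
  have hcont : ContinuousOn (fun x : ℝ => (x + ε)⁻¹) (spectrum ℝ c) :=
    ContinuousOn.inv₀ (by fun_prop) fun x hx => by have := hspec x hx; positivity
  have hcont' : ContinuousOn (fun x : ℝ => x * (x + ε)⁻¹) (spectrum ℝ c) :=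
    continuousOn_id.mul hcont
  have hcr : c * cfc (fun x : ℝ => (x + ε)⁻¹) c = cfc (fun x : ℝ => x * (x + ε)⁻¹) c := by
    rw [cfc_mul (fun x : ℝ => x) (fun x : ℝ => (x + ε)⁻¹) c continuousOn_id hcont, cfc_id' ℝ c]
  have hle {x : ℝ} (hx : x ∈ spectrum ℝ c) : x * (x + ε)⁻¹ ≤ 1 := by
    have := hspec x hx
    rw [← div_eq_mul_inv, div_le_one (by positivity)]
    linarith
  refine ⟨cfc (fun x : ℝ => (x + ε)⁻¹) c, vn_cfc_mem hcN _, cfc_predicate _ _, ?_, ?_, ?_⟩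
  · have h1 : (ε : ℂ) • cfc (fun x : ℝ => (x + ε)⁻¹) c = cfc (fun x : ℝ => ε * (x + ε)⁻¹) c := by
      rw [cfc_const_mul ε (fun x : ℝ => (x + ε)⁻¹) c hcont]
      rfl
    rw [h1, hcr, ← cfc_one ℝ c, ← cfc_sub _ _ c (by fun_prop) hcont']
    refine cfc_congr fun x hx => ?_
    have := hspec x hx
    have h2 : x + ε ≠ 0 := by positivity
    simp only [Pi.one_apply]
    field_simp
    ring
  · rw [hcr]
    refine norm_cfc_le zero_le_one fun x hx => ?_
    have := hspec x hx
    rw [Real.norm_of_nonneg (by positivity)]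
    exact hle hx
  · rw [mul_assoc, hcr, ← cfc_mul _ _ c hcont hcont']
    refine norm_cfc_le (by positivity) fun x hx => ?_
    have := hspec x hx
    rw [Real.norm_of_nonneg (by positivity)]
    have h2 : (x + ε)⁻¹ ≤ ε⁻¹ := by gcongr; linarith
    calc _ ≤ ε⁻¹ * 1 := by gcongr; exact hle hx
      _ = _ := mul_one _

namespace IsCornerProj

variable {M N : VonNeumannAlgebra L} {e f p : L →L[ℂ] L} {Φ : (L →L[ℂ] L) →ₗ[ℂ] (L →L[ℂ] L)}

/-- The estimate which makes the operator `n ξ ↦ Φ(a n) ξ`, for `n ∈ N f`, well defined and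
bounded by `‖a‖` on the span of `N f L`. -/
theorem norm_sum_map_apply_le (hΦ : IsCornerProj M N e f Φ) (hp : IsCentralSupport M N f p)
    {a : L →L[ℂ] L} (ha : a ∈ M) {ι : Type*} (s : Finset ι) (n : ι → L →L[ℂ] L)
    (hn : ∀ i, n i ∈ N) (hnf : ∀ i, n i * f = n i) (ξ : ι → L) :
    ‖∑ i ∈ s, Φ (a * n i) (ξ i)‖ ≤ ‖a‖ * ‖∑ i ∈ s, n i (ξ i)‖ := by
  have hf := hΦ.right_proj
  have hfn (i : ι) : f * star (n i) = star (n i) := by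
    have := congrArg star (hnf i)
    rwa [star_mul, hf.isSelfAdjoint.star_eq] at this
  have hfp : f * p = f := by
    rw [hp.comm _ (hΦ.le hΦ.right_mem), hp.mul_eq]
  have hnp (i : ι) : star (n i) * p = star (n i) := by
    have h1 : n i * p = n i := by rw [← hnf i, mul_assoc, hfp]
    have h2 : p * n i = n i := by rw [← hp.comm _ (hΦ.le (hn i)), h1]
    have := congrArg star h2
    rwa [star_mul, hp.proj.isSelfAdjoint.star_eq] at this
  have key (δ : ℝ) (hδ : 0 < δ) : ‖∑ i ∈ s, Φ (a * n i) (ξ i)‖ ≤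
      ‖a‖ * ‖∑ i ∈ s, n i (ξ i)‖ + δ * (‖a‖ * ∑ i ∈ s, ‖ξ i‖) := by
    -- `r` is the resolvent `(c + δ²)⁻¹` of `c = ∑ᵢ nᵢ nᵢ*`; the operator `q = ∑ᵢ Φ(a nᵢ) nᵢ* r`
    -- satisfies `q n = Φ(a c r n)`, so that it has norm at most `‖a‖`.
    set c := ∑ i ∈ s, n i * star (n i) with hc
    have hcN : c ∈ N := sum_mem fun i _ => mul_mem (hn i) (star_mem (hn i))
    have hc0 : 0 ≤ c := Finset.sum_nonneg fun i _ => mul_star_self_nonneg _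
    obtain ⟨r, hrN, hrs, hcr_sub, hcr_norm, hrcr⟩ := exists_resolvent hcN hc0 (sq_pos_of_pos hδ)
    have hrn (i : ι) (hi : i ∈ s) : ‖((δ ^ 2 : ℝ) : ℂ) • r * n i‖ ≤ δ := by
      have h1 : ‖r * n i‖ ^ 2 ≤ (δ ^ 2)⁻¹ := by
        rw [sq, ← CStarRing.norm_self_mul_star, star_mul, hrs.star_eq,
          show r * n i * (star (n i) * r) = r * (n i * star (n i)) * r by simp only [mul_assoc]]
        refine (CStarAlgebra.norm_le_norm_of_nonneg_of_le ?_ ?_).trans hrcr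
        · exact hrs.conjugate_nonneg (mul_star_self_nonneg _)
        · refine hrs.conjugate_le_conjugate ?_
          exact Finset.single_le_sum (f := fun i => n i * star (n i))
            (fun i _ => mul_star_self_nonneg _) hi
      rw [smul_mul_assoc, norm_smul, Complex.norm_real, Real.norm_of_nonneg (by positivity)]
      have h2 : ‖r * n i‖ ≤ δ⁻¹ := by
        refine (abs_le_of_sq_le_sq' ?_ (by positivity)).2
        rwa [inv_pow]
      calc _ ≤ δ ^ 2 * δ⁻¹ := by gcongr
        _ = δ := by field_simp
    set q := ∑ i ∈ s, Φ (a * n i) * (star (n i) * r) with hq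
    have hqn (m : L →L[ℂ] L) (hm : m ∈ N) (hmf : m * f = m) :
        q * m = Φ (a * (c * r) * m) := by
      rw [hq, Finset.sum_mul, hc, Finset.sum_mul, Finset.mul_sum, Finset.sum_mul, map_sum]
      refine Finset.sum_congr rfl fun i _ => ?_
      rw [mul_assoc, ← hΦ.map_mul_right
        (mul_mem (mul_mem (star_mem (hn i)) hrN) hm) ?_ (mul_mem ha (hΦ.le (hn i)))]
      · simp only [mul_assoc]
      · rw [mul_assoc, hmf, ← mul_assoc, ← mul_assoc, hfn]
    have hrp : r * p = p * r := (hp.comm _ (hΦ.le hrN))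
    have hq_norm : ‖q‖ ≤ ‖a‖ := by
      refine hp.norm_le hf hΦ.right_mem ?_ ?_ (norm_nonneg a) ?_
      · exact sum_mem fun i _ => mul_mem (hΦ.map_mem _ (mul_mem ha (hΦ.le (hn i))))
          (mul_mem (star_mem (hn i)) hrN)
      · rw [hq, Finset.sum_mul]
        refine Finset.sum_congr rfl fun i _ => ?_
        rw [mul_assoc, mul_assoc, hrp, ← mul_assoc (star (n i)), hnp]
      · intro m hm hmf
        rw [hqn m hm hmf]
        calc _ ≤ ‖a * (c * r) * m‖ :=
              hΦ.norm_le _ (mul_mem (mul_mem ha (hΦ.le (mul_mem hcN hrN))) (hΦ.le hm))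
          _ ≤ ‖a‖ * ‖c * r‖ * ‖m‖ :=
              (norm_mul_le _ _).trans (by gcongr; exact norm_mul_le _ _)
          _ ≤ ‖a‖ * 1 * ‖m‖ := by gcongr
          _ = _ := by rw [mul_one]
    have hsplit : ∑ i ∈ s, Φ (a * n i) (ξ i) = q (∑ i ∈ s, n i (ξ i)) +
        ∑ i ∈ s, Φ (a * (((δ ^ 2 : ℝ) : ℂ) • r * n i)) (ξ i) := by
      rw [map_sum, ← Finset.sum_add_distrib]
      refine Finset.sum_congr rfl fun i _ => ?_
      rw [← mul_apply_eq_comp, hqn _ (hn i) (hnf i), ← add_apply, ← map_add, ← hcr_sub]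
      congr 2
      noncomm_ring
    rw [hsplit]
    refine (norm_add_le _ _).trans (add_le_add ?_ ?_)
    · exact (le_opNorm _ _).trans (by gcongr)
    · rw [Finset.mul_sum, Finset.mul_sum]
      refine (norm_sum_le _ _).trans (Finset.sum_le_sum fun i hi => ?_)
      calc _ ≤ ‖Φ (a * (((δ ^ 2 : ℝ) : ℂ) • r * n i))‖ * ‖ξ i‖ := le_opNorm _ _
        _ ≤ (‖a‖ * δ) * ‖ξ i‖ := by
          gcongr
          refine (hΦ.norm_le _ (mul_mem ha (mul_mem (hΦ.le (vn_smul_mem _ hrN))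
            (hΦ.le (hn i))))).trans ((norm_mul_le _ _).trans ?_)
          gcongr
          exact hrn i hi
        _ = _ := by ring
  refine le_of_forall_pos_le_add fun ε hε => ?_
  set B := ‖a‖ * ∑ i ∈ s, ‖ξ i‖
  have hB : 0 ≤ B := by positivity
  refine (key (ε / (B + 1)) (by positivity)).trans ?_
  gcongr
  rw [div_mul_eq_mul_div, div_le_iff₀ (by positivity)]
  nlinarith

/-- The value at `a` of the extension of `Φ` from the right projection `f` to its support `p`. -/
theorem exists_extension_apply (hΦ : IsCornerProj M N e f Φ) (hp : IsCentralSupport M N f p)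
    {a : L →L[ℂ] L} (ha : a ∈ M) :
    ∃ q : L →L[ℂ] L, (∀ n ∈ N, n * f = n → q * n = Φ (a * n)) ∧ q * p = q ∧ ‖q‖ ≤ ‖a‖ := by
  let C := {n : L →L[ℂ] L // n ∈ N ∧ n * f = n}
  let i₀ : (C →₀ L) →ₗ[ℂ] L := Finsupp.lsum ℂ fun n : C => (n : L →L[ℂ] L).toLinearMap
  let g₀ : (C →₀ L) →ₗ[ℂ] L := Finsupp.lsum ℂ fun n : C => (Φ (a * n) : L →L[ℂ] L).toLinearMap
  have hbound (x : C →₀ L) : ‖g₀ x‖ ≤ ‖a‖ * ‖i₀ x‖ := by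
    simp only [g₀, i₀, Finsupp.lsum_apply, Finsupp.sum]
    exact hΦ.norm_sum_map_apply_le hp ha x.support (fun n : C => (n : L →L[ℂ] L))
      (fun n => n.2.1) (fun n => n.2.2) x
  let D : Submodule ℂ L := (LinearMap.range i₀).topologicalClosure
  have hD (x : C →₀ L) : i₀ x ∈ D := Submodule.le_topologicalClosure _ ⟨x, rfl⟩
  have hDc : IsClosed (D : Set L) := Submodule.isClosed_topologicalClosure _
  have : CompleteSpace D := hDc.completeSpace_coe
  let i₁ : (C →₀ L) →ₗ[ℂ] D := i₀.codRestrict D hD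
  have hi₁ (x : C →₀ L) : ‖i₁ x‖ = ‖i₀ x‖ := rfl
  have hdense : DenseRange i₁ := by
    intro y
    rw [Metric.mem_closure_iff]
    intro ε hε
    obtain ⟨_, ⟨x, rfl⟩, hx⟩ := Metric.mem_closure_iff.1 y.2 ε hε
    exact ⟨i₁ x, ⟨x, rfl⟩, hx⟩
  let q₀ : D →L[ℂ] L := g₀.extendOfNorm i₁
  have hq₀ (x : C →₀ L) : q₀ (i₁ x) = g₀ x :=
    LinearMap.extendOfNorm_eq hdense ⟨‖a‖, hbound⟩ x
  have hq₀n (y : D) : ‖q₀ y‖ ≤ ‖a‖ * ‖y‖ := LinearMap.norm_extendOfNorm_apply_le hdense _ hbound y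
  have hpn (n : C) (v : L) : p ((n : L →L[ℂ] L) v) = (n : L →L[ℂ] L) v := by
    have h1 : p * n = (n : L →L[ℂ] L) := by
      rw [← hp.comm _ (hΦ.le n.2.1), ← n.2.2, mul_assoc, hp.comm _ (hΦ.le hΦ.right_mem), hp.mul_eq]
    exact DFunLike.congr_fun h1 v
  refine ⟨q₀.comp D.orthogonalProjectionOnto, ?_, ?_, ?_⟩
  · intro n hn hnf
    ext v
    have h1 : n v = i₁ (Finsupp.single ⟨n, hn, hnf⟩ v) := by simp [i₁, i₀]
    change q₀ (D.orthogonalProjectionOnto (n v)) = _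
    rw [h1, Submodule.orthogonalProjectionOnto_mem_subspace_eq_self, hq₀]
    simp [g₀]
  · ext v
    change q₀ (D.orthogonalProjectionOnto (p v)) = q₀ (D.orthogonalProjectionOnto v)
    have h1 : D.orthogonalProjectionOnto (v - p v) = 0 := by
      rw [Submodule.orthogonalProjectionOnto_eq_zero_iff]
      rw [Submodule.orthogonal_closure, Submodule.mem_orthogonal]
      rintro _ ⟨x, rfl⟩
      simp only [i₀, Finsupp.lsum_apply, Finsupp.sum, sum_inner]
      refine Finset.sum_eq_zero fun n _ => ?_
      change inner ℂ ((n : L →L[ℂ] L) (x n)) (v - p v) = 0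
      rw [← hpn, ← adjoint_inner_right, ← star_eq_adjoint, hp.proj.isSelfAdjoint.star_eq, map_sub,
        ← mul_apply_eq_comp p p, hp.proj.isIdempotentElem.eq, sub_self, inner_zero_right]
    rw [map_sub, sub_eq_zero] at h1
    rw [h1]
  · refine opNorm_le_bound _ (norm_nonneg a) fun v => (hq₀n _).trans ?_
    gcongr
    exact D.norm_orthogonalProjectionOnto_apply_le v

end IsCornerProj

end Corner

section Corner

variable {L : Type*} [NormedAddCommGroup L] [InnerProductSpace ℂ L] [CompleteSpace L]

theorem IsCentralSupport.eq_of_mul_eq {M N : VonNeumannAlgebra L} {f p : L →L[ℂ] L}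
    (hp : IsCentralSupport M N f p) (hf : IsStarProjection f) (hfN : f ∈ N)
    {q q' : L →L[ℂ] L} (hq : q * p = q) (hq' : q' * p = q')
    (h : ∀ n ∈ N, n * f = n → q * n = q' * n) : q = q' := by
  have h1 := hp.mul_eq_zero hf (d := q - q') fun n hn => by
    rw [sub_mul, sub_eq_zero]
    exact h _ (mul_mem hn hfN) (by rw [mul_assoc, hf.isIdempotentElem.eq])
  rw [sub_mul, hq, hq'] at h1
  exact sub_eq_zero.1 h1

namespace IsCornerProj

variable {M N : VonNeumannAlgebra L} {e f p : L →L[ℂ] L} {Φ : (L →L[ℂ] L) →ₗ[ℂ] (L →L[ℂ] L)}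

/-- The right corner of a corner projection can be enlarged to its support: the extension `Ψ` is
determined by `Ψ a * n = Φ (a * n)` for `n ∈ N f`. -/
theorem exists_extension_right (hΦ : IsCornerProj M N e f Φ) (hp : IsCentralSupport M N f p) :
    ∃ Ψ, IsCornerProj M N e p Ψ ∧ ∀ a ∈ M, Ψ a * f = Φ a := by
  have hf := hΦ.right_proj
  have hfN := hΦ.right_mem
  have hfp : f * p = f := by rw [hp.comm _ (hΦ.le hfN), hp.mul_eq]
  let M' : Submodule ℂ (L →L[ℂ] L) := Subalgebra.toSubmodule M.toStarSubalgebra.toSubalgebra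
  choose q hq hqp hqn using fun a : M' => hΦ.exists_extension_apply hp a.2
  let Ψ₀ : M' →ₗ[ℂ] (L →L[ℂ] L) :=
    { toFun := q
      map_add' := fun a b => hp.eq_of_mul_eq hf hfN (hqp _) (by rw [add_mul, hqp, hqp])
        fun n hn hnf => by
          rw [add_mul, hq _ n hn hnf, hq _ n hn hnf, hq _ n hn hnf, ← map_add, ← add_mul]; rfl
      map_smul' := fun c a => hp.eq_of_mul_eq hf hfN (hqp _)
        (by rw [smul_mul_assoc, hqp])
        fun n hn hnf => by
          rw [smul_mul_assoc, hq _ n hn hnf, hq _ n hn hnf, RingHom.id_apply, ← map_smul,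
            ← smul_mul_assoc]; rfl }
  obtain ⟨Ψ, hΨ⟩ := LinearMap.exists_extend Ψ₀
  have hΨq (a : L →L[ℂ] L) (ha : a ∈ M) : Ψ a = q ⟨a, ha⟩ :=
    DFunLike.congr_fun hΨ (⟨a, ha⟩ : M')
  have hn (a : L →L[ℂ] L) (ha : a ∈ M) (n : L →L[ℂ] L) (hn : n ∈ N) (hnf : n * f = n) :
      Ψ a * n = Φ (a * n) := by rw [hΨq a ha]; exact hq _ n hn hnf
  have hΨp (a : L →L[ℂ] L) (ha : a ∈ M) : Ψ a * p = Ψ a := by rw [hΨq a ha]; exact hqp _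
  refine ⟨Ψ, ⟨hΦ.le, hΦ.left_proj, hp.proj, hΦ.left_mem, hp.mem, ?_, ?_, hΨp, ?_, ?_, ?_⟩, ?_⟩
  · intro a ha
    refine vn_mem_iff.2 fun g hg => ?_
    have hgN : ∀ n ∈ N, n * g = g * n := VonNeumannAlgebra.mem_commutant_iff.1 hg
    refine hp.eq_of_mul_eq hf hfN (by rw [mul_assoc, hΨp a ha])
      (by rw [mul_assoc, ← hgN p hp.mem, ← mul_assoc, hΨp a ha]) fun n hn' hnf => ?_
    rw [mul_assoc, hn a ha n hn' hnf, mul_assoc, ← hgN n hn', ← mul_assoc, hn a ha n hn' hnf,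
      hgN _ (hΦ.map_mem _ (mul_mem ha (hΦ.le hn')))]
  · intro a ha
    refine hp.eq_of_mul_eq hf hfN (by rw [mul_assoc, hΨp a ha]) (hΨp a ha) fun n hn' hnf => ?_
    rw [mul_assoc, hn a ha n hn' hnf, hΦ.mul_map _ (mul_mem ha (hΦ.le hn'))]
  · intro a ha
    have hea : e * a * p ∈ M :=
      mul_mem (mul_mem (hΦ.le hΦ.left_mem) ha) (hΦ.le hp.mem)
    refine hp.eq_of_mul_eq hf hfN (hΨp _ hea) (hΨp a ha) fun n hn' hnf => ?_
    have hpn : p * n = n := by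
      rw [← hp.comm _ (hΦ.le hn'), ← hnf, mul_assoc, hfp]
    rw [hn _ hea n hn' hnf, hn a ha n hn' hnf, mul_assoc _ p, hpn,
      ← hΦ.map_compress (a * n) (mul_mem ha (hΦ.le hn')), mul_assoc e (a * n), mul_assoc a, hnf,
      mul_assoc e]
  · intro m hm
    refine hp.eq_of_mul_eq hf hfN (hΨp m (hΦ.le hm))
      (by rw [mul_assoc, hp.proj.isIdempotentElem.eq]) fun n hn' hnf => ?_
    have hpn : p * n = n := by
      rw [← hp.comm _ (hΦ.le hn'), ← hnf, mul_assoc, hfp]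
    rw [hn m (hΦ.le hm) n hn' hnf, hΦ.map_of_mem _ (mul_mem hm hn'), mul_assoc, mul_assoc m, hnf,
      mul_assoc _ p, hpn, mul_assoc]
  · intro a ha
    rw [hΨq a ha]; exact hqn _
  · intro a ha
    have haf : a * f ∈ M := mul_mem ha (hΦ.le hfN)
    rw [hn a ha f hfN hf.isIdempotentElem.eq, ← hΦ.map_compress _ haf, ← hΦ.map_compress a ha,
      mul_assoc e, mul_assoc a, hf.isIdempotentElem.eq, ← mul_assoc]

/-- A corner projection extends to the common support of the two projections. -/
theorem exists_extension (hΦ : IsCornerProj M N e f Φ) (hpe : IsCentralSupport M N e p)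
    (hpf : IsCentralSupport M N f p) :
    ∃ Ψ, IsCornerProj M N p p Ψ ∧ ∀ a ∈ M, e * Ψ a * f = Φ a := by
  obtain ⟨Ψ₁, h₁, h₁f⟩ := hΦ.exists_extension_right hpf
  obtain ⟨Ψ₂, h₂, h₂e⟩ := h₁.conjStar_isCornerProj.exists_extension_right hpe
  refine ⟨conjStar Ψ₂, h₂.conjStar_isCornerProj, fun a ha => ?_⟩
  have h3 : e * conjStar Ψ₂ a = Ψ₁ a := by
    have h4 := congrArg star (h₂e (star a) (star_mem ha))
    rwa [star_mul, hΦ.left_proj.isSelfAdjoint.star_eq, conjStar_apply, star_star, star_star] at h4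
  rw [h3, h₁f a ha]

/-- If `(1 - p) M ⊆ N`, then a projection of `p M p` onto `p N p` extends to `M`. -/
theorem add_compl (hΦ : IsCornerProj M N p p Φ) (hcomm : ∀ m ∈ M, m * p = p * m)
    (hcompl : ∀ m ∈ M, (1 - p) * m ∈ N) :
    IsCornerProj M N 1 1 (Φ + LinearMap.mulLeft ℂ (1 - p)) where
  le := hΦ.le
  left_proj := .one _
  right_proj := .one _
  left_mem := one_mem N
  right_mem := one_mem N
  map_mem a ha := add_mem (hΦ.map_mem a ha) (hcompl a ha)
  mul_map a _ := one_mul _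
  map_mul a _ := mul_one _
  map_compress a _ := by rw [one_mul, mul_one]
  map_of_mem n hn := by
    rw [one_mul, mul_one, LinearMap.add_apply, LinearMap.mulLeft_apply, hΦ.map_of_mem n hn,
      mul_assoc, hcomm n (hΦ.le hn), ← mul_assoc, hΦ.left_proj.isIdempotentElem.eq, sub_mul,
      one_mul, add_sub_cancel]
  norm_le a ha := by
    refine opNorm_le_bound _ (norm_nonneg a) fun v => ?_
    refine (abs_le_of_sq_le_sq' ?_ (by positivity)).2
    have hps : star p = p := hΦ.left_proj.isSelfAdjoint.star_eq
    have hp := hΦ.left_proj.isIdempotentElem.eq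
    have hsplit (w w' : L) : ‖p w + (1 - p) w'‖ ^ 2 = ‖p w‖ ^ 2 + ‖(1 - p) w'‖ ^ 2 := by
      have h0 : inner ℂ (p w) ((1 - p) w') = 0 := by
        rw [← adjoint_inner_right, ← star_eq_adjoint, hps, ← mul_apply_eq_comp, mul_sub, hp,
          mul_one, sub_self, zero_apply, inner_zero_right]
      rw [sq, norm_add_sq_eq_norm_sq_add_norm_sq_of_inner_eq_zero _ _ h0, sq, sq]
    have h1 : (Φ + LinearMap.mulLeft ℂ (1 - p)) a v = p (Φ a (p v)) + (1 - p) (a ((1 - p) v)) := by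
      have h2 : p * Φ a * p = Φ a := by rw [hΦ.mul_map a ha, hΦ.map_mul a ha]
      have h3 : (1 - p) * a * (1 - p) = (1 - p) * a := by
        rw [mul_sub, mul_one, mul_assoc _ a, hcomm a ha, ← mul_assoc, sub_mul 1 p p, hp, one_mul,
          sub_self, zero_mul, sub_zero]
      change Φ a v + ((1 - p) * a) v = (p * Φ a * p) v + ((1 - p) * a * (1 - p)) v
      rw [h2, h3]
    have h2 : v = p v + (1 - p) v := by simp
    have h2' : ‖v‖ ^ 2 = ‖p v‖ ^ 2 + ‖(1 - p) v‖ ^ 2 := by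
      rw [← hsplit, ← h2]
    have h3 : ‖p (Φ a (p v))‖ ≤ ‖a‖ * ‖p v‖ := by
      rw [← mul_apply_eq_comp p, hΦ.mul_map a ha]
      exact (le_opNorm _ _).trans (by gcongr; exact hΦ.norm_le a ha)
    have h4 : ‖(1 - p) (a ((1 - p) v))‖ ≤ ‖a‖ * ‖(1 - p) v‖ := by
      refine le_trans ?_ (le_opNorm a _)
      have h5 := hsplit (a ((1 - p) v)) (a ((1 - p) v))
      have h6 : p (a ((1 - p) v)) + (1 - p) (a ((1 - p) v)) = a ((1 - p) v) := by simp
      rw [h6] at h5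
      refine (abs_le_of_sq_le_sq' ?_ (by positivity)).2
      nlinarith [sq_nonneg ‖p (a ((1 - p) v))‖]
    rw [h1, hsplit, mul_pow, h2', mul_add, ← mul_pow, ← mul_pow]
    gcongr

/-- A contractive unital projection is positive. -/
theorem isPositive_map (hΦ : IsCornerProj M N 1 1 Φ) {a : L →L[ℂ] L} (ha : a ∈ M)
    (ha0 : a.IsPositive) : (Φ a).IsPositive := by
  have has : IsSelfAdjoint a := ha0.isSelfAdjoint
  have h1 : Φ 1 = 1 := by rw [hΦ.map_of_mem 1 (one_mem N), one_mul, mul_one]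
  have hbound (c : ℂ) (v : L) : ‖inner ℂ (Φ a v) v + c * ‖v‖ ^ 2‖ ≤
      ‖a + (starRingEnd ℂ c) • (1 : L →L[ℂ] L)‖ * ‖v‖ ^ 2 := by
    have h2 := hΦ.norm_le (a + (starRingEnd ℂ c) • (1 : L →L[ℂ] L))
      (add_mem ha (vn_smul_mem _ (one_mem M)))
    rw [map_add, map_smul, h1] at h2
    have h3 : inner ℂ (Φ a v) v + c * ‖v‖ ^ 2 =
        inner ℂ ((Φ a + (starRingEnd ℂ c) • (1 : L →L[ℂ] L)) v) v := by
      rw [add_apply, inner_add_left, smul_apply, one_apply_eq_self, inner_smul_left,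
        Complex.conj_conj, inner_self_eq_norm_sq_to_K]
      rfl
    rw [h3]
    refine (norm_inner_le_norm _ _).trans ?_
    rw [sq, ← mul_assoc]
    gcongr
    exact (le_opNorm _ _).trans (by gcongr)
  rw [isPositive_iff_complex]
  intro v
  set z := inner ℂ (Φ a v) v with hz
  -- The numbers `z + i s ‖v‖²` have modulus at most `√(‖a‖² + s²) ‖v‖²`, so that `z` is real.
  have him : z.im = 0 := by
    have key (s : ℝ) : (z.im + s * ‖v‖ ^ 2) ^ 2 ≤ (‖a‖ ^ 2 + s ^ 2) * (‖v‖ ^ 2) ^ 2 := by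
      have h2 := hbound (Complex.I * s) v
      have h3 : ‖a + (starRingEnd ℂ (Complex.I * s)) • (1 : L →L[ℂ] L)‖ ^ 2 ≤ ‖a‖ ^ 2 + s ^ 2 := by
        rw [sq, ← CStarRing.norm_star_mul_self]
        have h4 : star (a + (starRingEnd ℂ (Complex.I * s)) • (1 : L →L[ℂ] L)) *
            (a + (starRingEnd ℂ (Complex.I * s)) • (1 : L →L[ℂ] L)) =
            a * a + ((s ^ 2 : ℝ) : ℂ) • (1 : L →L[ℂ] L) := by
          set d := starRingEnd ℂ (Complex.I * s) with hd
          have hd1 : star d = -d := by simp [hd]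
          have hd2 : d * d = -((s ^ 2 : ℝ) : ℂ) := by
            rw [hd, RingHom.map_mul, Complex.conj_I, Complex.conj_ofReal, Complex.ofReal_pow]
            linear_combination (s : ℂ) ^ 2 * Complex.I_mul_I
          rw [star_add, star_smul, star_one, has.star_eq, hd1]
          simp only [add_mul, mul_add, smul_mul_assoc, mul_smul_comm, one_mul, mul_one, neg_smul,
            neg_mul]
          rw [smul_add, smul_neg, smul_smul, hd2, neg_smul]
          abel
        rw [h4]
        refine (norm_add_le _ _).trans (add_le_add ?_ ?_)
        · rw [sq]; exact norm_mul_le _ _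
        · rw [norm_smul, Complex.norm_real, Real.norm_of_nonneg (by positivity)]
          exact mul_le_of_le_one_right (by positivity) norm_id_le
      have h4 : |z.im + s * ‖v‖ ^ 2| ≤ ‖z + Complex.I * s * ‖v‖ ^ 2‖ := by
        refine le_trans (le_of_eq ?_) (Complex.abs_im_le_norm _)
        congr 1
        simp [← Complex.ofReal_pow, Complex.mul_im, Complex.mul_re]
      calc _ = |z.im + s * ‖v‖ ^ 2| ^ 2 := (sq_abs _).symm
        _ ≤ (‖a + (starRingEnd ℂ (Complex.I * s)) • (1 : L →L[ℂ] L)‖ * ‖v‖ ^ 2) ^ 2 := by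
          gcongr; exact h4.trans h2
        _ ≤ _ := by rw [mul_pow]; gcongr
    by_contra hne
    rcases eq_or_ne v 0 with rfl | hv
    · exact hne (by simp [hz])
    have hw : 0 < ‖v‖ ^ 2 := by positivity
    set w := ‖v‖ ^ 2
    have h2 := key ((‖a‖ ^ 2 * w ^ 2 + 1) / (2 * z.im * w))
    have h3 : 2 * z.im * (((‖a‖ ^ 2 * w ^ 2 + 1) / (2 * z.im * w)) * w) = ‖a‖ ^ 2 * w ^ 2 + 1 := by
      field_simp
    nlinarith [sq_nonneg z.im]
  have hre : 0 ≤ z.re := by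
    have h2 := hbound (-(‖a‖ : ℂ)) v
    have h3 : ‖a + (starRingEnd ℂ (-(‖a‖ : ℂ))) • (1 : L →L[ℂ] L)‖ ≤ ‖a‖ := by
      have h4 : a + (starRingEnd ℂ (-(‖a‖ : ℂ))) • (1 : L →L[ℂ] L) =
          -(algebraMap ℝ (L →L[ℂ] L) ‖a‖ - a) := by
        rw [map_neg, Complex.conj_ofReal, neg_smul, Algebra.algebraMap_eq_smul_one,
          Complex.coe_smul]
        abel
      rw [h4, norm_neg]
      have h5 : a ≤ algebraMap ℝ (L →L[ℂ] L) ‖a‖ := has.le_algebraMap_norm_self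
      have h6 : 0 ≤ a := (nonneg_iff_isPositive a).2 ha0
      refine (CStarAlgebra.norm_le_norm_of_nonneg_of_le (sub_nonneg.2 h5)
        (sub_le_self _ h6)).trans ?_
      rw [Algebra.algebraMap_eq_smul_one, norm_smul, norm_norm]
      exact mul_le_of_le_one_right (norm_nonneg _) norm_id_le
    have h4 := (Complex.abs_re_le_norm _).trans
      (h2.trans (mul_le_mul_of_nonneg_right h3 (sq_nonneg _)))
    have h5 : (z + -(‖a‖ : ℂ) * (‖v‖ : ℂ) ^ 2).re = z.re - ‖a‖ * ‖v‖ ^ 2 := by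
      simp [← Complex.ofReal_pow, ← Complex.ofReal_mul, sub_eq_add_neg]
    rw [h5] at h4
    linarith [(abs_le.1 h4).1]
  exact ⟨Complex.ext rfl him.symm, hre⟩

end IsCornerProj

end Corner

/-! ### Block operators and the bicommutant of a linking algebra -/

section Block

variable {H K : Type*}
  [NormedAddCommGroup H] [InnerProductSpace ℂ H] [NormedAddCommGroup K] [InnerProductSpace ℂ K]

/-- The inclusion `K → K ⊕ H`. -/
noncomputable def inlL (K H : Type*)
    [NormedAddCommGroup H] [InnerProductSpace ℂ H]
    [NormedAddCommGroup K] [InnerProductSpace ℂ K] : K →L[ℂ] WithLp 2 (K × H) :=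
  ((WithLp.prodContinuousLinearEquiv 2 ℂ K H).symm : K × H →L[ℂ] WithLp 2 (K × H)) ∘L
    ContinuousLinearMap.inl ℂ K H

/-- The inclusion `H → K ⊕ H`. -/
noncomputable def inrL (K H : Type*)
    [NormedAddCommGroup H] [InnerProductSpace ℂ H]
    [NormedAddCommGroup K] [InnerProductSpace ℂ K] : H →L[ℂ] WithLp 2 (K × H) :=
  ((WithLp.prodContinuousLinearEquiv 2 ℂ K H).symm : K × H →L[ℂ] WithLp 2 (K × H)) ∘L
    ContinuousLinearMap.inr ℂ K H

/-- The projection `K ⊕ H → K`. -/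
noncomputable def fstL (K H : Type*)
    [NormedAddCommGroup H] [InnerProductSpace ℂ H]
    [NormedAddCommGroup K] [InnerProductSpace ℂ K] : WithLp 2 (K × H) →L[ℂ] K :=
  ContinuousLinearMap.fst ℂ K H ∘L
    (WithLp.prodContinuousLinearEquiv 2 ℂ K H : WithLp 2 (K × H) →L[ℂ] K × H)

/-- The projection `K ⊕ H → H`. -/
noncomputable def sndL (K H : Type*)
    [NormedAddCommGroup H] [InnerProductSpace ℂ H]
    [NormedAddCommGroup K] [InnerProductSpace ℂ K] : WithLp 2 (K × H) →L[ℂ] H :=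
  ContinuousLinearMap.snd ℂ K H ∘L
    (WithLp.prodContinuousLinearEquiv 2 ℂ K H : WithLp 2 (K × H) →L[ℂ] K × H)

theorem inlL_apply (k : K) : inlL K H k = WithLp.toLp 2 (k, 0) := rfl

theorem inrL_apply (h : H) : inrL K H h = WithLp.toLp 2 (0, h) := rfl

theorem fstL_apply (v : WithLp 2 (K × H)) : fstL K H v = v.fst := rfl

theorem sndL_apply (v : WithLp 2 (K × H)) : sndL K H v = v.snd := rfl

theorem inner_inlL_left (k : K) (v : WithLp 2 (K × H)) :
    inner ℂ (inlL K H k) v = inner ℂ k (fstL K H v) := by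
  simp [inlL_apply, fstL_apply, WithLp.prod_inner_apply]

theorem inner_inrL_left (h : H) (v : WithLp 2 (K × H)) :
    inner ℂ (inrL K H h) v = inner ℂ h (sndL K H v) := by
  simp [inrL_apply, sndL_apply, WithLp.prod_inner_apply]

theorem norm_inlL_le : ‖inlL K H‖ ≤ 1 := by
  refine opNorm_le_bound _ zero_le_one fun k => ?_
  rw [inlL_apply]; simp

theorem norm_inrL_le : ‖inrL K H‖ ≤ 1 := by
  refine opNorm_le_bound _ zero_le_one fun k => ?_
  rw [inrL_apply]; simp

theorem norm_fstL_le : ‖fstL K H‖ ≤ 1 := by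
  refine opNorm_le_bound _ zero_le_one fun v => ?_
  rw [one_mul, fstL_apply]
  exact WithLp.norm_fst_le _ v

theorem norm_sndL_le : ‖sndL K H‖ ≤ 1 := by
  refine opNorm_le_bound _ zero_le_one fun v => ?_
  rw [one_mul, sndL_apply]
  exact WithLp.norm_snd_le _ v

theorem fstL_blockOp (a : K →L[ℂ] K) (b : H →L[ℂ] K) (c : K →L[ℂ] H) (d : H →L[ℂ] H)
    (v : WithLp 2 (K × H)) : fstL K H (blockOp a b c d v) = a (fstL K H v) + b (sndL K H v) := by
  simp [fstL, sndL, blockOp]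

theorem sndL_blockOp (a : K →L[ℂ] K) (b : H →L[ℂ] K) (c : K →L[ℂ] H) (d : H →L[ℂ] H)
    (v : WithLp 2 (K × H)) : sndL K H (blockOp a b c d v) = c (fstL K H v) + d (sndL K H v) := by
  simp [fstL, sndL, blockOp]

theorem ext_fstL_sndL {v w : WithLp 2 (K × H)} (h1 : fstL K H v = fstL K H w)
    (h2 : sndL K H v = sndL K H w) : v = w :=
  (WithLp.equiv 2 (K × H)).injective (Prod.ext h1 h2)

@[simp] theorem fstL_inlL (k : K) : fstL K H (inlL K H k) = k := rfl
@[simp] theorem sndL_inlL (k : K) : sndL K H (inlL K H k) = 0 := rfl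
@[simp] theorem fstL_inrL (h : H) : fstL K H (inrL K H h) = 0 := rfl
@[simp] theorem sndL_inrL (h : H) : sndL K H (inrL K H h) = h := rfl

/-- The upper right entry of an operator on `K ⊕ H`. -/
noncomputable def entry (K H : Type*)
    [NormedAddCommGroup H] [InnerProductSpace ℂ H]
    [NormedAddCommGroup K] [InnerProductSpace ℂ K] :
    (WithLp 2 (K × H) →L[ℂ] WithLp 2 (K × H)) →ₗ[ℂ] (H →L[ℂ] K) where
  toFun m := fstL K H ∘L m ∘L inrL K H
  map_add' _ _ := by simp
  map_smul' _ _ := by simp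

/-- The operator `(0 b; 0 0)`. -/
noncomputable def upper (K H : Type*)
    [NormedAddCommGroup H] [InnerProductSpace ℂ H]
    [NormedAddCommGroup K] [InnerProductSpace ℂ K] :
    (H →L[ℂ] K) →ₗ[ℂ] (WithLp 2 (K × H) →L[ℂ] WithLp 2 (K × H)) where
  toFun b := inlL K H ∘L b ∘L sndL K H
  map_add' _ _ := by simp
  map_smul' _ _ := by simp

theorem upper_apply (b : H →L[ℂ] K) (v : WithLp 2 (K × H)) :
    upper K H b v = inlL K H (b (sndL K H v)) := rfl

theorem upper_eq_blockOp (b : H →L[ℂ] K) : upper K H b = blockOp 0 b 0 0 := by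
  ext v
  refine ext_fstL_sndL ?_ ?_
  · rw [fstL_blockOp, upper_apply]; simp
  · rw [sndL_blockOp, upper_apply]; simp

theorem entry_upper (b : H →L[ℂ] K) : entry K H (upper K H b) = b := rfl

theorem norm_entry_le (m : WithLp 2 (K × H) →L[ℂ] WithLp 2 (K × H)) : ‖entry K H m‖ ≤ ‖m‖ :=
  calc ‖entry K H m‖ ≤ ‖fstL K H‖ * (‖m‖ * ‖inrL K H‖) :=
        (opNorm_comp_le _ _).trans (by gcongr; exact opNorm_comp_le _ _)
    _ ≤ 1 * (‖m‖ * 1) := by gcongr; exacts [norm_fstL_le, norm_inrL_le]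
    _ = ‖m‖ := by ring

theorem norm_upper_le (b : H →L[ℂ] K) : ‖upper K H b‖ ≤ ‖b‖ :=
  calc ‖upper K H b‖ ≤ ‖inlL K H‖ * (‖b‖ * ‖sndL K H‖) :=
        (opNorm_comp_le _ _).trans (by gcongr; exact opNorm_comp_le _ _)
    _ ≤ 1 * (‖b‖ * 1) := by gcongr; exacts [norm_inlL_le, norm_sndL_le]
    _ = ‖b‖ := by ring

variable [CompleteSpace H] [CompleteSpace K]

theorem IsTRO.leftLinking_comp_mem {T : Submodule ℂ (H →L[ℂ] K)} (hT : IsTRO T) {a : K →L[ℂ] K}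
    (ha : a ∈ leftLinking T) {t : H →L[ℂ] K} (ht : t ∈ T) : a ∘L t ∈ T := by
  have hcl : IsClosed {a : K →L[ℂ] K | a ∘L t ∈ T} :=
    hT.isClosed.preimage (continuous_id.clm_comp continuous_const)
  refine closure_minimal (fun m hm => ?_) hcl ha
  induction hm using Submodule.span_induction with
  | mem x hx =>
    obtain ⟨s, hs, s', hs', rfl⟩ := hx
    exact hT.ternary_mem s hs s' hs' t ht
  | zero => simp
  | add x y _ _ hx hy => simpa using add_mem hx hy
  | smul c x _ hx => simpa using T.smul_mem c hx

theorem IsTRO.comp_rightLinking_mem {T : Submodule ℂ (H →L[ℂ] K)} (hT : IsTRO T) {d : H →L[ℂ] H}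
    (hd : d ∈ rightLinking T) {t : H →L[ℂ] K} (ht : t ∈ T) : t ∘L d ∈ T := by
  have hcl : IsClosed {d : H →L[ℂ] H | t ∘L d ∈ T} :=
    hT.isClosed.preimage (continuous_const.clm_comp continuous_id)
  refine closure_minimal (fun m hm => ?_) hcl hd
  induction hm using Submodule.span_induction with
  | mem x hx =>
    obtain ⟨s, hs, s', hs', rfl⟩ := hx
    exact hT.ternary_mem t ht s hs s' hs'
  | zero => simp
  | add x y _ _ hx hy => simpa using add_mem hx hy
  | smul c x _ hx => simpa using T.smul_mem c hx

/-- An operator commutes with the projection onto a reducing subspace. -/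
theorem mul_starProjection_comm {L : Type*} [NormedAddCommGroup L] [InnerProductSpace ℂ L]
    [CompleteSpace L] {V : Submodule ℂ L} [V.HasOrthogonalProjection] {g : L →L[ℂ] L}
    (h : V ≤ V.comap g.toLinearMap) (h' : V ≤ V.comap (star g).toLinearMap) :
    g * V.starProjection = V.starProjection * g := by
  ext x : 1
  rw [mul_apply_eq_comp, mul_apply_eq_comp]
  refine (Submodule.eq_starProjection_of_mem_of_inner_eq_zero (K := V)
    (h (Submodule.starProjection_apply_mem V x)) fun w hw => ?_).symm
  change inner ℂ (g x - g (V.starProjection x)) w = 0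
  rw [← map_sub, ← adjoint_inner_right]
  exact Submodule.starProjection_inner_eq_zero x _ (h' hw)

theorem ampl_single {L : Type*} [NormedAddCommGroup L] [InnerProductSpace ℂ L] (a : L →L[ℂ] L)
    (i : ℕ) (v : L) : ampl a (lp.single 2 i v) = lp.single 2 i (a v) := by
  ext n
  rw [ampl_apply]
  rcases eq_or_ne n i with rfl | h
  · simp
  · rw [lp.single_apply_ne _ _ _ h, lp.single_apply_ne _ _ _ h, map_zero]

theorem adjoint_ampl {L : Type*} [NormedAddCommGroup L] [InnerProductSpace ℂ L] [CompleteSpace L]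
    (a : L →L[ℂ] L) : adjoint (ampl a) = ampl (adjoint a) := by
  symm
  rw [eq_adjoint_iff]
  intro x y
  refine (lp.hasSum_inner (ampl (adjoint a) x) y).unique ?_
  convert lp.hasSum_inner x (ampl a y) using 2 with n
  rw [ampl_apply, ampl_apply, adjoint_inner_left]

/-- An operator commuting with all amplifications of a set `S` commutes with the amplifications of
the bicommutant of `S`. -/
theorem commute_ampl_of_mem_bicommutant {L : Type*} [NormedAddCommGroup L] [InnerProductSpace ℂ L]
    {S : Set (L →L[ℂ] L)} {q : lp (fun _ : ℕ => L) 2 →L[ℂ] lp (fun _ : ℕ => L) 2}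
    (hq : ∀ a ∈ S, ampl a * q = q * ampl a) {m : L →L[ℂ] L}
    (hm : m ∈ Set.centralizer (Set.centralizer S)) : ampl m * q = q * ampl m := by
  -- The matrix entries of `q` commute with `S`, hence with `m`.
  let E (i : ℕ) : lp (fun _ : ℕ => L) 2 →L[ℂ] L := lp.evalCLM ℂ (fun _ : ℕ => L) 2 i
  let J (j : ℕ) : L →L[ℂ] lp (fun _ : ℕ => L) 2 :=
    lp.singleContinuousLinearMap ℂ (fun _ : ℕ => L) 2 j
  have hE (i : ℕ) (x : lp (fun _ : ℕ => L) 2) : E i x = x i := rfl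
  have hJ (j : ℕ) (v : L) : J j v = lp.single 2 j v := rfl
  have hent (i j : ℕ) : E i ∘L q ∘L J j ∈ Set.centralizer S := by
    intro a ha
    ext v
    change a (q (lp.single 2 j v) i) = q (lp.single 2 j (a v)) i
    rw [← ampl_apply, ← mul_apply_eq_comp, hq a ha, mul_apply_eq_comp, ampl_single]
  refine lp.ext_continuousLinearMap (by simp) fun j => ?_
  ext v i
  have h := DFunLike.congr_fun (hm _ (hent i j)) v
  change q (lp.single 2 j (m v)) i = m (q (lp.single 2 j v) i) at h
  change m (q (lp.single 2 j v) i) = q (ampl m (lp.single 2 j v)) i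
  rw [ampl_single, h]

/-- The upper right entries of the elements of the von Neumann linking algebra belong to `T`, by the
proof of the bicommutant theorem. If `uw ξ η` vanishes on `T`, then the vectors `(ηₙ, 0)` are
orthogonal to an invariant subspace of the linking algebra which contains the vectors `(0, ξₙ)`. -/
theorem entry_mem_of_mem_vnLinking {T : Submodule ℂ (H →L[ℂ] K)} (hT : IsWStarTRO T)
    {m : WithLp 2 (K × H) →L[ℂ] WithLp 2 (K × H)} (hm : m ∈ vnLinking T) : entry K H m ∈ T := by
  by_contra hcon
  obtain ⟨ξ, η, hξη, hne⟩ := exists_uw_separating hT.isClosed_weakStar hcon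
  refine hne ?_
  -- The vectors `(s ξₙ, d ξₙ)ₙ` with `s ∈ T` and `T d ⊆ T` form a subspace which is invariant
  -- under the ampliation of the linking algebra.
  let V₀ : Submodule ℂ (lp (fun _ : ℕ => WithLp 2 (K × H)) 2) :=
    { carrier := {x | ∃ s ∈ T, ∃ d : H →L[ℂ] H, (∀ t ∈ T, t ∘L d ∈ T) ∧
        x = ampl (inlL K H ∘L s + inrL K H ∘L d) ξ}
      add_mem' := by
        rintro _ _ ⟨s, hs, d, hd, rfl⟩ ⟨s', hs', d', hd', rfl⟩
        refine ⟨s + s', add_mem hs hs', d + d', fun t ht => ?_, ?_⟩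
        · rw [comp_add]; exact add_mem (hd t ht) (hd' t ht)
        · ext n
          simp
          abel
      zero_mem' := ⟨0, zero_mem _, 0, fun t _ => by simp, by ext n; simp⟩
      smul_mem' := by
        rintro c _ ⟨s, hs, d, hd, rfl⟩
        refine ⟨c • s, T.smul_mem c hs, c • d, fun t ht => ?_, ?_⟩
        · rw [comp_smul]; exact T.smul_mem c (hd t ht)
        · ext n
          simp }
  let V := V₀.topologicalClosure
  have : CompleteSpace V := (Submodule.isClosed_topologicalClosure _).completeSpace_coe
  have hinv₀ : ∀ a ∈ linkingSet T, ∀ x ∈ V₀, ampl a x ∈ V₀ := by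
    rintro _ ⟨a, ha, b, hb, c, hc, d, hd, rfl⟩ _ ⟨s, hs, d', hd', rfl⟩
    refine ⟨a ∘L s + b ∘L d', add_mem (hT.leftLinking_comp_mem ha hs) (hd' b hb),
      adjoint c ∘L s + d ∘L d', fun t ht => ?_, ?_⟩
    · rw [comp_add]
      exact add_mem (hT.ternary_mem t ht c hc s hs) (hd' _ (hT.comp_rightLinking_mem hd ht))
    · ext n
      refine ext_fstL_sndL ?_ ?_
      · rw [ampl_apply, ampl_apply, fstL_blockOp]; simp
      · rw [ampl_apply, ampl_apply, sndL_blockOp]; simp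
  have hinv : ∀ a ∈ linkingSet T, V ≤ V.comap (ampl a).toLinearMap := by
    intro a ha
    refine Submodule.topologicalClosure_minimal _ (fun x hx => ?_) ?_
    · exact Submodule.le_topologicalClosure _ (hinv₀ a ha x hx)
    · exact (Submodule.isClosed_topologicalClosure V₀).preimage (ampl a).continuous
  have hcomm : ∀ a ∈ linkingSet T, ampl a * V.starProjection = V.starProjection * ampl a := by
    intro a ha
    have ha' : star a ∈ linkingSet T := by
      rw [← star_linkingSet T]; simpa using ha
    refine mul_starProjection_comm (hinv a ha) ?_
    rw [star_eq_adjoint, adjoint_ampl]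
    exact hinv _ ha'
  have h1 := commute_ampl_of_mem_bicommutant hcomm (m := m) hm
  let v := ampl (inrL K H) ξ
  have hv : v ∈ V := Submodule.le_topologicalClosure _
    ⟨0, zero_mem _, 1, fun t ht => ht, by rw [comp_zero, zero_add]; rfl⟩
  have hmv : ampl m v ∈ V := by
    have h2 := DFunLike.congr_fun h1 v
    rw [mul_apply_eq_comp, mul_apply_eq_comp, Submodule.starProjection_eq_self_iff.2 hv] at h2
    exact Submodule.starProjection_eq_self_iff.1 h2.symm
  have horth : ∀ x ∈ V, inner ℂ (ampl (inlL K H) η) x = 0 := by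
    intro x hx
    refine closure_minimal (s := (V₀ : Set _))
      (t := {x | inner ℂ (ampl (inlL K H) η) x = (0 : ℂ)}) ?_
      (isClosed_eq (continuous_const.inner continuous_id) continuous_const)
      (Submodule.topologicalClosure_coe V₀ ▸ hx)
    rintro _ ⟨s, hs, d, hd, rfl⟩
    rw [Set.mem_ofPred_eq, ← hξη s hs]
    have h2 := lp.hasSum_inner (𝕜 := ℂ) (ampl (inlL K H) η) (ampl (inlL K H ∘L s + inrL K H ∘L d) ξ)
    refine h2.unique ((hasSum_uw ξ η s).congr_fun fun n => ?_)
    rw [ampl_apply, ampl_apply, inner_inlL_left]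
    simp
  rw [← horth _ hmv]
  refine (hasSum_uw ξ η _).unique
    ((lp.hasSum_inner (𝕜 := ℂ) (ampl (inlL K H) η) (ampl m v)).congr_fun fun n => ?_)
  rw [ampl_apply, inner_inlL_left]
  rfl

end Block

/-! ### Range projections and the supports of a W*-TRO -/

section RangeProj

variable {L : Type*} [NormedAddCommGroup L] [InnerProductSpace ℂ L]

/-- The closed linear span of the ranges of a set of operators. -/
def rangeSpan (S : Set (L →L[ℂ] L)) : Submodule ℂ L :=
  (Submodule.span ℂ {w | ∃ s ∈ S, ∃ v, w = s v}).topologicalClosure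

theorem apply_mem_rangeSpan {S : Set (L →L[ℂ] L)} {s : L →L[ℂ] L} (hs : s ∈ S) (v : L) :
    s v ∈ rangeSpan S :=
  Submodule.le_topologicalClosure _ (Submodule.subset_span ⟨s, hs, v, rfl⟩)

theorem rangeSpan_le {S : Set (L →L[ℂ] L)} {V : Submodule ℂ L} (hV : IsClosed (V : Set L))
    (h : ∀ s ∈ S, ∀ v, s v ∈ V) : rangeSpan S ≤ V := by
  refine Submodule.topologicalClosure_minimal _ (Submodule.span_le.2 ?_) hV
  rintro _ ⟨s, hs, v, rfl⟩
  exact h s hs v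

variable [CompleteSpace L]

instance (S : Set (L →L[ℂ] L)) : CompleteSpace (rangeSpan S) :=
  (Submodule.isClosed_topologicalClosure _).completeSpace_coe

/-- The projection onto the closed linear span of the ranges of a set of operators. -/
noncomputable def rangeProj (S : Set (L →L[ℂ] L)) : L →L[ℂ] L :=
  (rangeSpan S).starProjection

theorem isStarProjection_rangeProj (S : Set (L →L[ℂ] L)) : IsStarProjection (rangeProj S) :=
  isStarProjection_starProjection

theorem rangeProj_mul {S : Set (L →L[ℂ] L)} {s : L →L[ℂ] L} (hs : s ∈ S) :
    rangeProj S * s = s := by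
  ext v
  exact Submodule.starProjection_eq_self_iff.2 (apply_mem_rangeSpan hs v)

theorem mul_rangeProj_congr {S : Set (L →L[ℂ] L)} {a b : L →L[ℂ] L}
    (h : ∀ s ∈ S, a * s = b * s) : a * rangeProj S = b * rangeProj S := by
  ext v
  have h1 : rangeSpan S ≤ LinearMap.eqLocus a.toLinearMap b.toLinearMap :=
    rangeSpan_le (isClosed_eq a.continuous b.continuous) fun s hs w =>
      DFunLike.congr_fun (h s hs) w
  exact h1 (Submodule.starProjection_apply_mem _ v)

theorem rangeProj_apply_eq_zero {S : Set (L →L[ℂ] L)} {v : L} (h : ∀ s ∈ S, star s v = 0) :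
    rangeProj S v = 0 := by
  refine (Submodule.starProjection_apply_eq_zero_iff _).2 fun w hw => ?_
  have h1 : rangeSpan S ≤ LinearMap.ker (innerSL ℂ v).toLinearMap :=
    rangeSpan_le (innerSL ℂ v).isClosed_ker fun s hs u => by
      change inner ℂ v (s u) = 0
      rw [← adjoint_inner_left, ← star_eq_adjoint, h s hs, inner_zero_left]
  have h2 : inner ℂ v w = 0 := h1 hw
  rw [← inner_conj_symm, h2, map_zero]

theorem rangeProj_mem {N : VonNeumannAlgebra L} {S : Set (L →L[ℂ] L)} (hS : ∀ s ∈ S, s ∈ N) :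
    rangeProj S ∈ N := by
  refine vn_mem_iff.2 fun g hg => ?_
  have hinv (g : L →L[ℂ] L) (hg : g ∈ N.commutant) :
      rangeSpan S ≤ (rangeSpan S).comap g.toLinearMap := by
    refine rangeSpan_le ((Submodule.isClosed_topologicalClosure _).preimage g.continuous)
      fun s hs v => ?_
    have h1 : g (s v) = s (g v) := DFunLike.congr_fun (vn_mem_iff.1 (hS s hs) g hg) v
    change g (s v) ∈ rangeSpan S
    rw [h1]
    exact apply_mem_rangeSpan hs _
  exact mul_starProjection_comm (hinv g hg) (hinv _ (star_mem hg))

theorem mul_eq_zero_symm {p q : L →L[ℂ] L} (hp : IsStarProjection p) (hq : IsStarProjection q)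
    (h : p * q = 0) : q * p = 0 := by
  have h1 := congrArg star h
  rwa [star_mul, hp.isSelfAdjoint.star_eq, hq.isSelfAdjoint.star_eq, star_zero] at h1

end RangeProj

section Support

variable {H K : Type*}
  [NormedAddCommGroup H] [InnerProductSpace ℂ H] [NormedAddCommGroup K] [InnerProductSpace ℂ K]

theorem upper_mul_upper (a b : H →L[ℂ] K) : upper K H a * upper K H b = 0 := by
  ext v
  rw [mul_apply_eq_comp, upper_apply, upper_apply, sndL_inlL, map_zero, map_zero, zero_apply]

theorem upper_entry (m : WithLp 2 (K × H) →L[ℂ] WithLp 2 (K × H)) :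
    upper K H (entry K H m) = (inlL K H ∘L fstL K H) * m * (inrL K H ∘L sndL K H) := rfl

theorem isClosed_uw_eq_zero (ξ : lp (fun _ : ℕ => H) 2) (η : lp (fun _ : ℕ => K) 2) :
    @IsClosed _ (weakStar H K) {a | uw ξ η a = 0} := by
  let : TopologicalSpace (H →L[ℂ] K) := weakStar H K
  have h : Continuous fun a : H →L[ℂ] K => uw ξ η a :=
    continuous_iInf_dom (i := ξ) (continuous_iInf_dom (i := η) continuous_induced_dom)
  exact isClosed_singleton.preimage h

variable [CompleteSpace H] [CompleteSpace K]

/-- The left support of `X`: the projection onto the closed linear span of `X H` in `K ⊕ H`. -/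
noncomputable def leftSupport (X : Submodule ℂ (H →L[ℂ] K)) :
    WithLp 2 (K × H) →L[ℂ] WithLp 2 (K × H) :=
  rangeProj {m | ∃ x ∈ X, m = upper K H x}

/-- The right support of `X`: the projection onto the closed linear span of `X* K` in `K ⊕ H`. -/
noncomputable def rightSupport (X : Submodule ℂ (H →L[ℂ] K)) :
    WithLp 2 (K × H) →L[ℂ] WithLp 2 (K × H) :=
  rangeProj {m | ∃ x ∈ X, m = star (upper K H x)}

theorem star_upper_apply (a : H →L[ℂ] K) (v : WithLp 2 (K × H)) :
    star (upper K H a) v = inrL K H (adjoint a (fstL K H v)) := by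
  refine ext_inner_left ℂ fun w => ?_
  rw [star_eq_adjoint, adjoint_inner_right, upper_apply, inner_inlL_left, ← adjoint_inner_right,
    ← inner_conj_symm, ← inner_conj_symm w, inner_inrL_left]

theorem upper_mul_star_mul (a b c : H →L[ℂ] K) :
    upper K H a * star (upper K H b) * upper K H c = upper K H (a ∘L adjoint b ∘L c) := by
  ext v
  rw [mul_apply_eq_comp, mul_apply_eq_comp, upper_apply, star_upper_apply, upper_apply]
  simp [upper_apply]

theorem upper_mem_vnLinking {T : Submodule ℂ (H →L[ℂ] K)} {t : H →L[ℂ] K} (ht : t ∈ T) :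
    upper K H t ∈ vnLinking T := by
  rw [upper_eq_blockOp]
  exact blockOp_mem_vnLinking ⟨t, ht⟩

theorem vnLinking_mono {X T : Submodule ℂ (H →L[ℂ] K)} (h : X ≤ T) :
    vnLinking X ≤ vnLinking T := by
  have hl : leftLinking X ≤ leftLinking T := Submodule.topologicalClosure_mono <|
    Submodule.span_mono fun _ ⟨s, hs, t, ht, e⟩ => ⟨s, h hs, t, h ht, e⟩
  have hr : rightLinking X ≤ rightLinking T := Submodule.topologicalClosure_mono <|
    Submodule.span_mono fun _ ⟨s, hs, t, ht, e⟩ => ⟨s, h hs, t, h ht, e⟩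
  have hs : linkingSet X ⊆ linkingSet T := fun _ ⟨a, ha, b, hb, c, hc, d, hd, e⟩ =>
    ⟨a, hl ha, b, h hb, c, h hc, d, hr hd, e⟩
  exact Set.centralizer_subset (Set.centralizer_subset hs)

section

variable (X : Submodule ℂ (H →L[ℂ] K))

theorem leftSupport_mem : leftSupport X ∈ vnLinking X :=
  rangeProj_mem fun _ ⟨_, hx, e⟩ => e ▸ upper_mem_vnLinking hx

theorem rightSupport_mem : rightSupport X ∈ vnLinking X :=
  rangeProj_mem fun _ ⟨_, hx, e⟩ => e ▸ star_mem (upper_mem_vnLinking hx)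

theorem isStarProjection_leftSupport : IsStarProjection (leftSupport X) :=
  isStarProjection_rangeProj _

theorem isStarProjection_rightSupport : IsStarProjection (rightSupport X) :=
  isStarProjection_rangeProj _

theorem star_leftSupport : star (leftSupport X) = leftSupport X :=
  (isStarProjection_leftSupport X).isSelfAdjoint.star_eq

theorem star_rightSupport : star (rightSupport X) = rightSupport X :=
  (isStarProjection_rightSupport X).isSelfAdjoint.star_eq

variable {X} in
theorem leftSupport_mul_upper {x : H →L[ℂ] K} (hx : x ∈ X) :
    leftSupport X * upper K H x = upper K H x :=
  rangeProj_mul ⟨x, hx, rfl⟩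

variable {X} in
theorem rightSupport_mul_star_upper {x : H →L[ℂ] K} (hx : x ∈ X) :
    rightSupport X * star (upper K H x) = star (upper K H x) :=
  rangeProj_mul ⟨x, hx, rfl⟩

variable {X} in
theorem upper_mul_rightSupport {x : H →L[ℂ] K} (hx : x ∈ X) :
    upper K H x * rightSupport X = upper K H x := by
  have h := congrArg star (rightSupport_mul_star_upper hx)
  rwa [star_mul, star_star, star_rightSupport] at h

theorem upper_mul_leftSupport (a : H →L[ℂ] K) : upper K H a * leftSupport X = 0 := by
  have h := mul_rangeProj_congr (S := {m | ∃ x ∈ X, m = upper K H x}) (a := upper K H a) (b := 0)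
    (by rintro _ ⟨x, -, rfl⟩; rw [upper_mul_upper, zero_mul])
  rwa [zero_mul] at h

theorem leftSupport_mul_rightSupport : leftSupport X * rightSupport X = 0 := by
  have h := mul_rangeProj_congr (S := {m | ∃ x ∈ X, m = star (upper K H x)}) (a := leftSupport X)
    (b := 0) (by
      rintro _ ⟨x, -, rfl⟩
      rw [zero_mul, ← star_leftSupport, ← star_mul, upper_mul_leftSupport, star_zero])
  rwa [zero_mul] at h

theorem rightSupport_mul_leftSupport : rightSupport X * leftSupport X = 0 :=
  mul_eq_zero_symm (isStarProjection_leftSupport X) (isStarProjection_rightSupport X)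
    (leftSupport_mul_rightSupport X)

theorem leftSupport_mul_inl : leftSupport X * (inlL K H ∘L fstL K H) = leftSupport X := by
  have h : (inlL K H ∘L fstL K H) * leftSupport X = leftSupport X := by
    have h := mul_rangeProj_congr (S := {m | ∃ x ∈ X, m = upper K H x})
      (a := inlL K H ∘L fstL K H) (b := 1) (by rintro _ ⟨x, -, rfl⟩; rfl)
    rwa [one_mul] at h
  have h2 : star (inlL K H ∘L fstL K H) = inlL K H ∘L fstL K H := by
    rw [star_eq_adjoint]; symm
    rw [eq_adjoint_iff]
    intro v w
    rw [comp_apply, comp_apply, inner_inlL_left, ← inner_conj_symm v, inner_inlL_left,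
      inner_conj_symm]
  have h3 := congrArg star h
  rwa [star_mul, h2, star_leftSupport] at h3

theorem inr_mul_rightSupport : (inrL K H ∘L sndL K H) * rightSupport X = rightSupport X := by
  have h := mul_rangeProj_congr (S := {m | ∃ x ∈ X, m = star (upper K H x)})
    (a := inrL K H ∘L sndL K H) (b := 1) (by
      rintro _ ⟨x, -, rfl⟩
      ext v
      rw [mul_apply_eq_comp, one_mul, star_upper_apply]; rfl)
  rwa [one_mul] at h

theorem leftSupport_mul_mul_rightSupport (m : WithLp 2 (K × H) →L[ℂ] WithLp 2 (K × H)) :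
    leftSupport X * m * rightSupport X =
      leftSupport X * upper K H (entry K H m) * rightSupport X := by
  rw [upper_entry, ← mul_assoc, ← mul_assoc, leftSupport_mul_inl,
    mul_assoc (leftSupport X * m) _ (rightSupport X), inr_mul_rightSupport]

theorem isStarProjection_leftSupport_add_rightSupport :
    IsStarProjection (leftSupport X + rightSupport X) :=
  (isStarProjection_leftSupport X).add (isStarProjection_rightSupport X)
    (leftSupport_mul_rightSupport X)

end

/-- An identity `a (0 t; 0 0) b = 0` extends from a set of `t` to its weak* closure. -/
theorem mul_upper_mul_eq_zero_of_mem_closure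
    {a b : WithLp 2 (K × H) →L[ℂ] WithLp 2 (K × H)} {S : Set (H →L[ℂ] K)}
    (h : ∀ s ∈ S, a * upper K H s * b = 0) {t : H →L[ℂ] K}
    (ht : t ∈ @closure _ (weakStar H K) S) : a * upper K H t * b = 0 := by
  have key (t : H →L[ℂ] K) (v w : WithLp 2 (K × H)) :
      inner ℂ w ((a * upper K H t * b) v) =
        uw (lp.single 2 0 (sndL K H (b v))) (lp.single 2 0 (fstL K H (adjoint a w))) t := by
    rw [uw_single, mul_apply_eq_comp, mul_apply_eq_comp, upper_apply, ← adjoint_inner_left,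
      ← inner_conj_symm, inner_inlL_left, inner_conj_symm]
  ext v
  refine ext_inner_left ℂ fun w => ?_
  rw [key, zero_apply, inner_zero_right]
  let _ : TopologicalSpace (H →L[ℂ] K) := weakStar H K
  exact closure_minimal (fun s hs => by
    rw [Set.mem_ofPred_eq, ← key, h s hs, zero_apply, inner_zero_right])
    (isClosed_uw_eq_zero _ _) ht

variable {X T : Submodule ℂ (H →L[ℂ] K)}

theorem IsWStarNondegenerate.leftSupport_mul (hnd : IsWStarNondegenerate X T) {t : H →L[ℂ] K}
    (ht : t ∈ T) : leftSupport X * upper K H t = upper K H t := by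
  have h := mul_upper_mul_eq_zero_of_mem_closure (a := 1 - leftSupport X) (b := 1) ?_
    (hnd.dense_left ht)
  · rw [mul_one, sub_mul, one_mul, sub_eq_zero] at h
    exact h.symm
  · intro s hs
    rw [mul_one]
    induction hs using Submodule.span_induction with
    | mem x hx =>
      obtain ⟨x, hx, s, -, t, -, rfl⟩ := hx
      rw [← upper_mul_star_mul, ← mul_assoc, ← mul_assoc, sub_mul, one_mul,
        leftSupport_mul_upper hx, sub_self, zero_mul, zero_mul]
    | zero => rw [map_zero, mul_zero]
    | add x y _ _ hx hy => rw [map_add, mul_add, hx, hy, add_zero]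
    | smul c x _ hx => rw [map_smul, mul_smul_comm, hx]; exact smul_zero (A := WithLp 2 (K × H) →L[ℂ] WithLp 2 (K × H)) c

theorem IsWStarNondegenerate.mul_rightSupport (hnd : IsWStarNondegenerate X T) {t : H →L[ℂ] K}
    (ht : t ∈ T) : upper K H t * rightSupport X = upper K H t := by
  have h := mul_upper_mul_eq_zero_of_mem_closure (a := 1) (b := 1 - rightSupport X) ?_
    (hnd.dense_right ht)
  · rw [one_mul, mul_sub, mul_one, sub_eq_zero] at h
    exact h.symm
  · intro s hs
    rw [one_mul]
    induction hs using Submodule.span_induction with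
    | mem x hx =>
      obtain ⟨s, -, t, -, x, hx, rfl⟩ := hx
      rw [← upper_mul_star_mul, mul_assoc, mul_sub, mul_one, upper_mul_rightSupport hx, sub_self,
        mul_zero]
    | zero => rw [map_zero, zero_mul]
    | add x y _ _ hx hy => rw [map_add, add_mul, hx, hy, add_zero]
    | smul c x _ hx => rw [map_smul, smul_mul_assoc, hx]; exact smul_zero (A := WithLp 2 (K × H) →L[ℂ] WithLp 2 (K × H)) c

/-- The supports of a nondegenerate `X` add up to a unit of the linking algebra of `T`. -/
theorem IsWStarNondegenerate.support_mul (hnd : IsWStarNondegenerate X T)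
    {m : WithLp 2 (K × H) →L[ℂ] WithLp 2 (K × H)} (hm : m ∈ linkingSet T) :
    (leftSupport X + rightSupport X) * m = m := by
  set p := leftSupport X + rightSupport X with hp
  have hu {t : H →L[ℂ] K} (ht : t ∈ T) : p * upper K H t = upper K H t := by
    rw [hp, add_mul, hnd.leftSupport_mul ht, ← hnd.leftSupport_mul ht, ← mul_assoc,
      rightSupport_mul_leftSupport, zero_mul, add_zero]
  have hu' {t : H →L[ℂ] K} (ht : t ∈ T) : p * star (upper K H t) = star (upper K H t) := by
    have h1 := congrArg star (hnd.mul_rightSupport ht)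
    rw [star_mul, star_rightSupport] at h1
    rw [hp, add_mul, h1, ← h1, ← mul_assoc, leftSupport_mul_rightSupport, zero_mul, zero_add]
  obtain ⟨a, ha, b, hb, c, hc, d, hd, rfl⟩ := hm
  have hda : p * (inlL K H ∘L a ∘L fstL K H) = inlL K H ∘L a ∘L fstL K H := by
    refine closure_minimal (t := {a | p * (inlL K H ∘L a ∘L fstL K H) = inlL K H ∘L a ∘L fstL K H})
      (fun x hx => ?_) ?_ ha
    · induction hx using Submodule.span_induction with
      | mem x hx =>
        obtain ⟨s, hs, t, ht, rfl⟩ := hx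
        have h1 : inlL K H ∘L (s ∘L adjoint t) ∘L fstL K H =
            upper K H s * star (upper K H t) := by
          ext v
          rw [mul_apply_eq_comp, star_upper_apply, upper_apply]; rfl
        rw [Set.mem_ofPred_eq, h1, ← mul_assoc, hu hs]
      | zero => simp
      | add x y _ _ hx hy =>
        rw [Set.mem_ofPred_eq] at *
        rw [add_comp, comp_add, mul_add, hx, hy]
      | smul c x _ hx =>
        rw [Set.mem_ofPred_eq] at *
        rw [smul_comp, comp_smul, mul_smul_comm, hx]
    · have hc : Continuous fun a : K →L[ℂ] K => inlL K H ∘L a ∘L fstL K H :=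
        continuous_const.clm_comp (continuous_id.clm_comp continuous_const)
      exact isClosed_eq (continuous_const.mul hc) hc
  have hdd : p * (inrL K H ∘L d ∘L sndL K H) = inrL K H ∘L d ∘L sndL K H := by
    refine closure_minimal (t := {d | p * (inrL K H ∘L d ∘L sndL K H) = inrL K H ∘L d ∘L sndL K H})
      (fun x hx => ?_) ?_ hd
    · induction hx using Submodule.span_induction with
      | mem x hx =>
        obtain ⟨s, hs, t, ht, rfl⟩ := hx
        have h1 : inrL K H ∘L (adjoint s ∘L t) ∘L sndL K H =
            star (upper K H s) * upper K H t := by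
          ext v
          rw [mul_apply_eq_comp, star_upper_apply, upper_apply]; rfl
        rw [Set.mem_ofPred_eq, h1, ← mul_assoc, hu' hs]
      | zero => simp
      | add x y _ _ hx hy =>
        rw [Set.mem_ofPred_eq] at *
        rw [add_comp, comp_add, mul_add, hx, hy]
      | smul c x _ hx =>
        rw [Set.mem_ofPred_eq] at *
        rw [smul_comp, comp_smul, mul_smul_comm, hx]
    · have hc : Continuous fun d : H →L[ℂ] H => inrL K H ∘L d ∘L sndL K H :=
        continuous_const.clm_comp (continuous_id.clm_comp continuous_const)
      exact isClosed_eq (continuous_const.mul hc) hc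
  have hsum : blockOp a b (adjoint c) d = inlL K H ∘L a ∘L fstL K H + upper K H b +
      star (upper K H c) + inrL K H ∘L d ∘L sndL K H := by
    ext v
    refine ext_fstL_sndL ?_ ?_
    · rw [fstL_blockOp]
      simp [star_upper_apply, upper_apply]
    · rw [sndL_blockOp]
      simp [star_upper_apply, upper_apply]
  rw [hsum, mul_add, mul_add, mul_add, hda, hu hb, hu' hc, hdd]

theorem IsWStarNondegenerate.mul_support (hnd : IsWStarNondegenerate X T)
    {m : WithLp 2 (K × H) →L[ℂ] WithLp 2 (K × H)} (hm : m ∈ linkingSet T) :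
    m * (leftSupport X + rightSupport X) = m := by
  have hm' : star m ∈ linkingSet T := by
    rw [← star_linkingSet T]; simpa using hm
  have h := congrArg star (hnd.support_mul hm')
  rwa [star_mul, star_star,
    (isStarProjection_leftSupport_add_rightSupport X).isSelfAdjoint.star_eq] at h

theorem IsWStarNondegenerate.mul_support_comm (hnd : IsWStarNondegenerate X T)
    {m : WithLp 2 (K × H) →L[ℂ] WithLp 2 (K × H)} (hm : m ∈ vnLinking T) :
    m * (leftSupport X + rightSupport X) = (leftSupport X + rightSupport X) * m :=
  (hm _ fun _ ha => (hnd.mul_support ha).trans (hnd.support_mul ha).symm).symm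

/-- The linking von Neumann algebras of `X` and `T` have the same part off the support of `X`,
namely the scalars. -/
theorem IsWStarNondegenerate.compl_support_mul_mem (hnd : IsWStarNondegenerate X T)
    {m : WithLp 2 (K × H) →L[ℂ] WithLp 2 (K × H)} (hm : m ∈ vnLinking T) :
    (1 - (leftSupport X + rightSupport X)) * m ∈ vnLinking X := by
  set p := leftSupport X + rightSupport X with hp
  intro g hg
  have hpg : g * p = p * g := add_mem (leftSupport_mem X) (rightSupport_mem X) g hg
  have h1 : (1 - p) * g ∈ Set.centralizer (linkingSet T) := by
    intro a ha
    have h2 : g * (1 - p) = (1 - p) * g := by rw [mul_sub, sub_mul, hpg, one_mul, mul_one]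
    rw [← mul_assoc, mul_sub, mul_one, hnd.mul_support ha, sub_self, zero_mul, ← h2, mul_assoc,
      sub_mul, one_mul, hnd.support_mul ha, sub_self, mul_zero]
  have h3 : (1 - p) * g * m = m * ((1 - p) * g) := hm _ h1
  have h2 : g * (1 - p) = (1 - p) * g := by rw [mul_sub, sub_mul, hpg, one_mul, mul_one]
  rw [← mul_assoc, h2, h3, ← mul_assoc, sub_mul 1 p m, one_mul, mul_sub, mul_one,
    hnd.mul_support_comm hm]

theorem IsWStarNondegenerate.isCentralSupport_leftSupport (hnd : IsWStarNondegenerate X T) :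
    IsCentralSupport (vnLinking T) (vnLinking X) (leftSupport X)
      (leftSupport X + rightSupport X) where
  proj := isStarProjection_leftSupport_add_rightSupport X
  mem := add_mem (leftSupport_mem X) (rightSupport_mem X)
  comm _ hm := hnd.mul_support_comm hm
  mul_eq := by
    rw [add_mul, rightSupport_mul_leftSupport,
      (isStarProjection_leftSupport X).isIdempotentElem.eq, add_zero]
  eq_zero v hv := by
    have h1 : leftSupport X v = 0 := hv 1 (one_mem _)
    have h2 : rightSupport X v = 0 := rangeProj_apply_eq_zero (by
      rintro _ ⟨x, hx, rfl⟩
      have h3 := hv _ (upper_mem_vnLinking hx)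
      rwa [← mul_apply_eq_comp, leftSupport_mul_upper hx, ← star_star (upper K H x)] at h3)
    rw [add_apply, h1, h2, add_zero]

theorem IsWStarNondegenerate.isCentralSupport_rightSupport (hnd : IsWStarNondegenerate X T) :
    IsCentralSupport (vnLinking T) (vnLinking X) (rightSupport X)
      (leftSupport X + rightSupport X) where
  proj := isStarProjection_leftSupport_add_rightSupport X
  mem := add_mem (leftSupport_mem X) (rightSupport_mem X)
  comm _ hm := hnd.mul_support_comm hm
  mul_eq := by
    rw [add_mul, leftSupport_mul_rightSupport,
      (isStarProjection_rightSupport X).isIdempotentElem.eq, zero_add]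
  eq_zero v hv := by
    have h1 : rightSupport X v = 0 := hv 1 (one_mem _)
    have h2 : leftSupport X v = 0 := rangeProj_apply_eq_zero (by
      rintro _ ⟨x, hx, rfl⟩
      have h3 := hv _ (star_mem (upper_mem_vnLinking hx))
      rwa [← mul_apply_eq_comp, rightSupport_mul_star_upper hx] at h3)
    rw [add_apply, h1, h2, add_zero]

/-- A contractive projection `Q` of `T` onto `X` acts on the corner of the linking algebra. -/
theorem isCornerProj_upper_entry (hX : IsWStarTRO X) (hT : IsWStarTRO T) (hXT : X ≤ T)
    (hnd : IsWStarNondegenerate X T) (Q : (H →L[ℂ] K) →ₗ[ℂ] (H →L[ℂ] K))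
    (hQ : ∀ t ∈ T, Q t ∈ X) (hQX : ∀ x ∈ X, Q x = x) (hQn : ∀ t ∈ T, ‖Q t‖ ≤ ‖t‖) :
    IsCornerProj (vnLinking T) (vnLinking X) (leftSupport X) (rightSupport X)
      (upper K H ∘ₗ Q ∘ₗ entry K H) where
  le := vnLinking_mono hXT
  left_proj := isStarProjection_leftSupport X
  right_proj := isStarProjection_rightSupport X
  left_mem := leftSupport_mem X
  right_mem := rightSupport_mem X
  map_mem _ ha := upper_mem_vnLinking (hQ _ (entry_mem_of_mem_vnLinking hT ha))
  mul_map _ ha := leftSupport_mul_upper (hQ _ (entry_mem_of_mem_vnLinking hT ha))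
  map_mul _ ha := upper_mul_rightSupport (hQ _ (entry_mem_of_mem_vnLinking hT ha))
  map_compress a ha := by
    have h1 := entry_mem_of_mem_vnLinking hT ha
    change upper K H (Q (entry K H _)) = upper K H (Q (entry K H a))
    rw [leftSupport_mul_mul_rightSupport, hnd.leftSupport_mul h1, hnd.mul_rightSupport h1,
      entry_upper]
  map_of_mem n hn := by
    have h1 := entry_mem_of_mem_vnLinking hX hn
    change upper K H (Q (entry K H n)) = _
    rw [hQX _ h1, leftSupport_mul_mul_rightSupport, leftSupport_mul_upper h1,
      upper_mul_rightSupport h1]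
  norm_le a ha := (norm_upper_le _).trans <|
    (hQn _ (entry_mem_of_mem_vnLinking hT ha)).trans (norm_entry_le a)

end Support

/-! ### Normal functionals and normal maps -/

section Normal

variable {H K H' K' : Type*}
  [NormedAddCommGroup H] [InnerProductSpace ℂ H] [NormedAddCommGroup K] [InnerProductSpace ℂ K]
  [NormedAddCommGroup H'] [InnerProductSpace ℂ H'] [NormedAddCommGroup K'] [InnerProductSpace ℂ K']

/-- A functional is normal on a set of operators if it agrees there with an ultraweakly continuous
functional `uw ξ η`. -/
def IsNormalOn (S : Set (H →L[ℂ] K)) (φ : (H →L[ℂ] K) → ℂ) : Prop :=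
  ∃ ξ η, ∀ a ∈ S, φ a = uw ξ η a

namespace IsNormalOn

variable {S : Set (H →L[ℂ] K)} {φ ψ : (H →L[ℂ] K) → ℂ}

theorem congr (hφ : IsNormalOn S φ) (h : ∀ a ∈ S, ψ a = φ a) : IsNormalOn S ψ := by
  obtain ⟨ξ, η, hξ⟩ := hφ
  exact ⟨ξ, η, fun a ha => (h a ha).trans (hξ a ha)⟩

theorem add (hφ : IsNormalOn S φ) (hψ : IsNormalOn S ψ) : IsNormalOn S fun a => φ a + ψ a := by
  obtain ⟨ξ, η, hξ⟩ := hφ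
  obtain ⟨ξ', η', hξ'⟩ := hψ
  obtain ⟨ξ'', η'', -, -, h⟩ := exists_uw_add ξ ξ' η η'
  exact ⟨ξ'', η'', fun a ha => by beta_reduce; rw [hξ a ha, hξ' a ha, h, add_apply]⟩

theorem zero : IsNormalOn S fun _ => 0 := ⟨0, 0, fun a _ => by rw [uw_zero_left, zero_apply]⟩

theorem smul (c : ℂ) (hφ : IsNormalOn S φ) : IsNormalOn S fun a => c * φ a := by
  obtain ⟨ξ, η, hξ⟩ := hφ
  exact ⟨c • ξ, η, fun a ha => by beta_reduce; rw [hξ a ha, uw_smul_left, smul_apply, smul_eq_mul]⟩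

theorem inner (v : H) (w : K) : IsNormalOn S fun a => Inner.inner ℂ w (a v) :=
  ⟨_, _, fun a _ => (uw_single v w a).symm⟩

end IsNormalOn

theorem isNormalMap_of_isNormalOn {S : Set (H →L[ℂ] K)} {S' : Set (H' →L[ℂ] K')} {f : S → S'}
    {F : (H →L[ℂ] K) → (H' →L[ℂ] K')} (hF : ∀ s, (f s : H' →L[ℂ] K') = F s)
    (h : ∀ ξ η, IsNormalOn S fun a => uw ξ η (F a)) : IsNormalMap f := by
  refine continuous_induced_rng.2 (continuous_iInf_rng.2 fun ξ => continuous_iInf_rng.2 fun η =>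
    continuous_induced_rng.2 ?_)
  obtain ⟨ξ', η', h'⟩ := h ξ η
  have h1 : @Continuous _ _ (weakStar H K) _ fun a : H →L[ℂ] K => uw ξ' η' a :=
    continuous_iInf_dom (i := ξ') (continuous_iInf_dom (i := η') continuous_induced_dom)
  have h2 : @Continuous _ _ (weakStarOn S) _ fun s : S => uw ξ' η' (s : H →L[ℂ] K) :=
    @Continuous.comp _ _ _ (weakStarOn S) (weakStar H K) _ _ _ h1 continuous_induced_dom
  have h3 : (fun s : S => uw ξ' η' (s : H →L[ℂ] K)) = fun s : S => uw ξ η (f s : H' →L[ℂ] K') :=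
    funext fun s => by rw [← h' s s.2, hF]
  rw [h3] at h2
  exact h2

theorem uw_sub_left (ξ ξ' : lp (fun _ : ℕ => H) 2) (η : lp (fun _ : ℕ => K) 2) (a : H →L[ℂ] K) :
    uw (ξ - ξ') η a = uw ξ η a - uw ξ' η a := by
  rw [uw_eq_inner, uw_eq_inner, uw_eq_inner, map_sub, inner_sub_right]

theorem uw_single_left (i : ℕ) (v : H) (η : lp (fun _ : ℕ => K) 2) (a : H →L[ℂ] K) :
    uw (lp.single 2 i v) η a = inner ℂ (η i) (a v) := by
  rw [uw_apply, tsum_eq_single i]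
  · simp
  · intro n hn
    rw [lp.single_apply_ne _ _ _ hn]; simp

variable [CompleteSpace H] [CompleteSpace K]

/-- A family of functionals depending Lipschitz continuously on a parameter is normal on a closed
set of parameters, as the predual of a weak* closed space is complete. -/
theorem isClosed_setOf_isNormalOn {S : Submodule ℂ (H →L[ℂ] K)}
    (hS : @IsClosed _ (weakStar H K) (S : Set (H →L[ℂ] K))) {E : Type*} [SeminormedAddCommGroup E]
    (ψ : E → (H →L[ℂ] K) →ₗ[ℂ] ℂ) (C : ℝ)
    (h : ∀ x y, ∀ a ∈ S, ‖ψ x a - ψ y a‖ ≤ C * ‖x - y‖ * ‖a‖) :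
    IsClosed {x | IsNormalOn (S : Set (H →L[ℂ] K)) (ψ x)} := by
  refine isClosed_of_closure_subset fun x hx => ?_
  have h1 : @Continuous S ℂ (weakStarOn (S : Set (H →L[ℂ] K))) _ ((ψ x).domRestrict S) := by
    refine continuous_weakStarOn_of_approx hS _ fun ε hε => ?_
    have hC : 0 < |C| + 1 := by positivity
    obtain ⟨y, ⟨ξ, η, hy⟩, hxy⟩ := SeminormedAddCommGroup.mem_closure_iff.1 hx (ε / (|C| + 1))
      (by positivity)
    refine ⟨(ψ y).domRestrict S, (continuous_weakStarOn_iff _).2 ⟨ξ, η, fun s => hy s s.2⟩,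
      fun s => (h x y s s.2).trans ?_⟩
    gcongr
    calc C * ‖x - y‖ ≤ (|C| + 1) * (ε / (|C| + 1)) := by
          gcongr
          linarith [le_abs_self C]
      _ = ε := by field_simp
  obtain ⟨ξ, η, h2⟩ := (continuous_weakStarOn_iff _).1 h1
  exact ⟨ξ, η, fun a ha => h2 ⟨a, ha⟩⟩

section

variable {S : Submodule ℂ (H →L[ℂ] K)} {F : (H →L[ℂ] K) →ₗ[ℂ] (H' →L[ℂ] K')}

theorem isClosed_setOf_isNormalOn_left
    (hS : @IsClosed _ (weakStar H K) (S : Set (H →L[ℂ] K))) (hF : ∀ a ∈ S, ‖F a‖ ≤ ‖a‖)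
    (η : lp (fun _ : ℕ => K') 2) :
    IsClosed {ξ | IsNormalOn (S : Set (H →L[ℂ] K)) fun a => uw ξ η (F a)} :=
  isClosed_setOf_isNormalOn hS (fun ξ => (uw ξ η).toLinearMap ∘ₗ F) ‖η‖ fun ξ ξ' a ha => by
    change ‖uw ξ η (F a) - uw ξ' η (F a)‖ ≤ _
    rw [← uw_sub_left]
    exact (norm_uw_apply_le _ _ _).trans (by gcongr; exact hF a ha)

theorem isClosed_setOf_isNormalOn_inner_left
    (hS : @IsClosed _ (weakStar H K) (S : Set (H →L[ℂ] K))) (hF : ∀ a ∈ S, ‖F a‖ ≤ ‖a‖)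
    (w : K') :
    IsClosed {v | IsNormalOn (S : Set (H →L[ℂ] K)) fun a => inner ℂ w (F a v)} := by
  have h := (isClosed_setOf_isNormalOn_left hS hF (lp.single 2 0 w)).preimage
    (lp.singleContinuousLinearMap ℂ (fun _ : ℕ => H') 2 0).continuous
  simpa only [Set.preimage_ofPred_eq, lp.singleContinuousLinearMap_apply, uw_single] using h

theorem isClosed_setOf_isNormalOn_inner_right
    (hS : @IsClosed _ (weakStar H K) (S : Set (H →L[ℂ] K))) (hF : ∀ a ∈ S, ‖F a‖ ≤ ‖a‖)
    (v : H') :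
    IsClosed {w | IsNormalOn (S : Set (H →L[ℂ] K)) fun a => inner ℂ w (F a v)} := by
  have h : IsClosed {w | IsNormalOn (S : Set (H →L[ℂ] K)) fun a =>
      uw (lp.single 2 0 v) (lp.single 2 0 w) (F a)} := isClosed_setOf_isNormalOn hS
    (fun w : K' => (uw (lp.single 2 0 v) (lp.single 2 0 w)).toLinearMap ∘ₗ F) ‖v‖
    fun w w' a ha => by
      change ‖uw _ _ (F a) - uw _ _ (F a)‖ ≤ _
      rw [uw_single, uw_single, ← inner_sub_left, mul_comm ‖v‖, mul_assoc, mul_comm ‖v‖]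
      refine (norm_inner_le_norm _ _).trans ?_
      gcongr
      exact (le_opNorm _ _).trans (by gcongr; exact hF a ha)
  simpa only [uw_single] using h

/-- A contraction is normal as soon as its vector functionals are. -/
theorem isNormalOn_uw_of_inner
    (hS : @IsClosed _ (weakStar H K) (S : Set (H →L[ℂ] K))) (hF : ∀ a ∈ S, ‖F a‖ ≤ ‖a‖)
    (h : ∀ v w, IsNormalOn (S : Set (H →L[ℂ] K)) fun a => inner ℂ w (F a v))
    (ξ : lp (fun _ : ℕ => H') 2) (η : lp (fun _ : ℕ => K') 2) :
    IsNormalOn (S : Set (H →L[ℂ] K)) fun a => uw ξ η (F a) := by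
  refine (isClosed_setOf_isNormalOn_left hS hF η).mem_of_tendsto
    (lp.hasSum_single (by simp) ξ) (.of_forall fun s => ?_)
  induction s using Finset.induction_on with
  | empty =>
    refine IsNormalOn.zero.congr fun a _ => ?_
    rw [Finset.sum_empty, uw_zero_left, zero_apply]
  | insert i s hi ih =>
    refine (ih.add (h (ξ i) (η i))).congr fun a _ => ?_
    rw [Finset.sum_insert hi, ← sub_neg_eq_add, uw_sub_left, uw_single_left, ← zero_sub,
      uw_sub_left, uw_zero_left, zero_apply]
    ring

end

end Normal

section VonNeumann

variable {L : Type*} [NormedAddCommGroup L] [InnerProductSpace ℂ L] [CompleteSpace L]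

theorem isClosed_weakStar_vonNeumannAlgebra (M : VonNeumannAlgebra L) :
    @IsClosed _ (weakStar L L) (M : Set (L →L[ℂ] L)) := by
  have h1 (v w : L) : @Continuous _ _ (weakStar L L) _ fun a : L →L[ℂ] L => inner ℂ w (a v) := by
    simp_rw [← uw_single v w]
    exact continuous_iInf_dom (i := lp.single 2 0 v)
      (continuous_iInf_dom (i := lp.single 2 0 w) continuous_induced_dom)
  have h2 : (M : Set (L →L[ℂ] L)) = ⋂ g ∈ M.commutant, ⋂ (v : L) (w : L),
      {a | inner ℂ (adjoint g w) (a v) = inner ℂ w (a (g v))} := by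
    ext a
    simp only [Set.mem_iInter, Set.mem_ofPred_eq, SetLike.mem_coe, adjoint_inner_left]
    rw [vn_mem_iff]
    refine forall₂_congr fun g _ => ⟨fun h v w => ?_, fun h => ?_⟩
    · exact congrArg _ (DFunLike.congr_fun h v)
    · ext v
      exact ext_inner_left ℂ (h v)
  rw [h2]
  let _ : TopologicalSpace (L →L[ℂ] L) := weakStar L L
  exact isClosed_biInter fun g _ => isClosed_iInter fun v => isClosed_iInter fun w =>
    isClosed_eq (h1 _ _) (h1 _ _)

variable {M N : VonNeumannAlgebra L} {e f p : L →L[ℂ] L}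

/-- The support of `f` projects onto the closed linear span of `N f L`. -/
theorem IsCentralSupport.apply_mem (hp : IsCentralSupport M N f p) (hf : IsStarProjection f)
    {V : Submodule ℂ L} (hV : IsClosed (V : Set L)) (h : ∀ n ∈ N, ∀ v, n (f v) ∈ V) (v : L) :
    p v ∈ V := by
  have : CompleteSpace V := hV.completeSpace_coe
  have h1 := hp.mul_eq_zero hf (d := 1 - V.starProjection) fun n hn => by
    ext u
    have h2 := Submodule.starProjection_eq_self_iff.2 (h n hn u)
    change n (f u) - V.starProjection (n (f u)) = 0
    rw [h2, sub_self]
  rw [sub_mul, one_mul, sub_eq_zero] at h1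
  rw [h1]
  exact Submodule.starProjection_apply_mem V _

/-- A corner projection extending a normal one to the support of the corner is normal, as
`⟪k e w, Ψ a (n f v)⟫ = ⟪w, Φ (k* a n) v⟫` for `k, n ∈ N`. -/
theorem IsCornerProj.isNormalOn_inner {Φ Ψ : (L →L[ℂ] L) →ₗ[ℂ] (L →L[ℂ] L)}
    (hΨ : IsCornerProj M N p p Ψ) (hpe : IsCentralSupport M N e p)
    (hpf : IsCentralSupport M N f p) (he : IsStarProjection e) (hf : IsStarProjection f)
    (hΦ : ∀ a ∈ M, e * Ψ a * f = Φ a)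
    (hnormal : ∀ k ∈ N, ∀ n ∈ N, ∀ v w,
      IsNormalOn (M : Set (L →L[ℂ] L)) fun a => inner ℂ w (Φ (k * a * n) v)) (v w : L) :
    IsNormalOn (M : Set (L →L[ℂ] L)) fun a => inner ℂ w (Ψ a v) := by
  let S : Submodule ℂ (L →L[ℂ] L) := Subalgebra.toSubmodule M.toStarSubalgebra.toSubalgebra
  have hS : @IsClosed _ (weakStar L L) (S : Set (L →L[ℂ] L)) :=
    isClosed_weakStar_vonNeumannAlgebra M
  have hΨn : ∀ a ∈ S, ‖Ψ a‖ ≤ ‖a‖ := hΨ.norm_le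
  -- The vectors for which the functional is normal form closed subspaces.
  let V (w : L) : Submodule ℂ L :=
    { carrier := {v | IsNormalOn (S : Set (L →L[ℂ] L)) fun a => inner ℂ w (Ψ a v)}
      add_mem' := fun hx hy => (hx.add hy).congr fun a _ => by rw [map_add, inner_add_right]
      zero_mem' := IsNormalOn.zero.congr fun a _ => by rw [map_zero, inner_zero_right]
      smul_mem' := fun c _ hx => (hx.smul c).congr fun a _ => by rw [map_smul, inner_smul_right] }
  let W (v : L) : Submodule ℂ L :=
    { carrier := {w | IsNormalOn (S : Set (L →L[ℂ] L)) fun a => inner ℂ w (Ψ a v)}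
      add_mem' := fun hx hy => (hx.add hy).congr fun a _ => by rw [inner_add_left]
      zero_mem' := IsNormalOn.zero.congr fun a _ => by rw [inner_zero_left]
      smul_mem' := fun c _ hx => (hx.smul (starRingEnd ℂ c)).congr fun a _ => by
        rw [inner_smul_left] }
  have hVcl (w : L) : IsClosed (V w : Set L) := isClosed_setOf_isNormalOn_inner_left hS hΨn w
  have hWcl (v : L) : IsClosed (W v : Set L) := isClosed_setOf_isNormalOn_inner_right hS hΨn v
  have h1 (k : L →L[ℂ] L) (hk : k ∈ N) (w v : L) : p v ∈ V (k (e w)) := by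
    refine hpf.apply_mem hf (hVcl _) (fun n hn v => ?_) v
    refine (hnormal (star k) (star_mem hk) n hn v w).congr fun a ha => ?_
    have hka : star k * a ∈ M := mul_mem (hΨ.le (star_mem hk)) ha
    rw [← hΦ _ (mul_mem hka (hΨ.le hn)), hΨ.map_mul_right hn (hpf.comm n (hΨ.le hn)) hka,
      hΨ.map_mul_left (star_mem hk) (hpf.comm _ (hΨ.le (star_mem hk))) ha]
    have he' : adjoint e = e := he.isSelfAdjoint.star_eq
    change _ = inner ℂ w (e (star k (Ψ a (n (f v)))))
    rw [← adjoint_inner_left e, he', star_eq_adjoint, adjoint_inner_right]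
  have h2 (v w : L) : p w ∈ W (p v) :=
    hpe.apply_mem he (hWcl _) (fun k hk w => h1 k hk w v) w
  refine (h2 v w).congr fun a ha => ?_
  have hp' : adjoint p = p := hΨ.left_proj.isSelfAdjoint.star_eq
  change _ = inner ℂ (p w) ((Ψ a * p) v)
  rw [hΨ.map_mul a ha, ← hp', adjoint_inner_left, ← mul_apply_eq_comp p, hΨ.mul_map a ha]

end VonNeumann

section Corner

variable {H K : Type*}
  [NormedAddCommGroup H] [InnerProductSpace ℂ H]
  [NormedAddCommGroup K] [InnerProductSpace ℂ K] [CompleteSpace K]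

theorem uw_comp {H' K' : Type*} [NormedAddCommGroup H'] [InnerProductSpace ℂ H']
    [NormedAddCommGroup K'] [InnerProductSpace ℂ K'] [CompleteSpace K']
    (ξ : lp (fun _ : ℕ => H) 2) (η : lp (fun _ : ℕ => K) 2) (a : K' →L[ℂ] K) (m : H' →L[ℂ] K')
    (b : H →L[ℂ] H') :
    uw ξ η (a ∘L m ∘L b) = uw (ampl b ξ) (ampl (adjoint a) η) m := by
  rw [uw_apply, uw_apply]
  refine tsum_congr fun n => ?_
  rw [ampl_apply, ampl_apply, adjoint_inner_left]
  rfl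

/-- The normality of a map on `T` in terms of the linking algebra of `T`. -/
theorem isNormalOn_upper_entry [CompleteSpace H] {X T : Submodule ℂ (H →L[ℂ] K)} (hT : IsWStarTRO T)
    (hXT : X ≤ T) {P : T →ₗ[ℂ] X}
    (hP : IsNormalMap (S := (T : Set (H →L[ℂ] K))) (S' := (X : Set (H →L[ℂ] K))) P)
    {Q : (H →L[ℂ] K) →ₗ[ℂ] (H →L[ℂ] K)} (hQ : ∀ t : T, Q t = P t)
    {k n : WithLp 2 (K × H) →L[ℂ] WithLp 2 (K × H)} (hk : k ∈ vnLinking X) (hn : n ∈ vnLinking X)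
    (v w : WithLp 2 (K × H)) :
    IsNormalOn (vnLinking T : Set (WithLp 2 (K × H) →L[ℂ] WithLp 2 (K × H)))
      fun a => inner ℂ w ((upper K H ∘ₗ Q ∘ₗ entry K H) (k * a * n) v) := by
  let φ : X →ₗ[ℂ] ℂ :=
    (uw (lp.single 2 0 (sndL K H v)) (lp.single 2 0 (fstL K H w))).toLinearMap ∘ₗ X.subtype
  have h1 : @Continuous X ℂ (weakStarOn (X : Set (H →L[ℂ] K))) _ φ :=
    (continuous_weakStarOn_iff φ).2 ⟨_, _, fun _ => rfl⟩
  obtain ⟨ξ, η, h2⟩ := (continuous_weakStarOn_iff (φ ∘ₗ P)).1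
    (@Continuous.comp _ _ _ (weakStarOn (T : Set (H →L[ℂ] K)))
      (weakStarOn (X : Set (H →L[ℂ] K))) _ _ _ h1 hP)
  refine ⟨ampl (n ∘L inrL K H) ξ, ampl (adjoint (fstL K H ∘L k)) η, fun a ha => ?_⟩
  have h3 : entry K H (k * a * n) ∈ T := entry_mem_of_mem_vnLinking hT
    (mul_mem (mul_mem (vnLinking_mono hXT hk) ha) (vnLinking_mono hXT hn))
  have h4 : φ (P ⟨_, h3⟩) = uw ξ η (entry K H (k * a * n)) := h2 ⟨_, h3⟩
  rw [← uw_comp]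
  refine Eq.trans ?_ h4
  change inner ℂ w (upper K H (Q (entry K H (k * a * n))) v) =
    uw _ _ ((P ⟨_, h3⟩ : X) : H →L[ℂ] K)
  rw [uw_single, ← hQ, upper_apply, ← inner_conj_symm, inner_inlL_left, inner_conj_symm]

end Corner

end WTRO

theorem theorem3p3 {H K : Type*}
    [NormedAddCommGroup H] [InnerProductSpace ℂ H] [CompleteSpace H]
    [NormedAddCommGroup K] [InnerProductSpace ℂ K] [CompleteSpace K]
    (X T : Submodule ℂ (H →L[ℂ] K)) (hX : WTRO.IsWStarTRO X) (hT : WTRO.IsWStarTRO T)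
    (hXT : X ≤ T) (hnd : WTRO.IsWStarNondegenerate X T)
    (P : T →ₗ[ℂ] X)
    (hP_normal : WTRO.IsNormalMap (S := (T : Set (H →L[ℂ] K))) (S' := (X : Set (H →L[ℂ] K))) P)
    (hP_contractive : ∀ t : T, ‖P t‖ ≤ ‖t‖)
    (hP_surjective : Function.Surjective P)
    (hP_idempotent : ∀ t : T, P (Submodule.inclusion hXT (P t)) = P t) :
    ∃ E : (WTRO.vnLinking T).toStarSubalgebra →ₗ[ℂ] (WTRO.vnLinking X).toStarSubalgebra,
      WTRO.IsCondExp (WTRO.vnLinking T) (WTRO.vnLinking X) E ∧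
      WTRO.IsNormalMap
        (S := (WTRO.vnLinking T : Set (WithLp 2 (K × H) →L[ℂ] WithLp 2 (K × H))))
        (S' := (WTRO.vnLinking X : Set (WithLp 2 (K × H) →L[ℂ] WithLp 2 (K × H)))) E ∧
      ∀ t : T, E (WTRO.corner t) = WTRO.corner (P t) := by
  open WTRO ContinuousLinearMap in
  obtain ⟨Q, hQ⟩ := LinearMap.exists_extend (X.subtype ∘ₗ P)
  have hQP (t : T) : Q t = P t := DFunLike.congr_fun hQ t
  have hQX : ∀ x ∈ X, Q x = x := by
    intro x hx
    obtain ⟨t, ht⟩ := hP_surjective ⟨x, hx⟩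
    have h1 := hP_idempotent t
    rw [ht] at h1
    have h2 := hQP (Submodule.inclusion hXT ⟨x, hx⟩)
    rwa [h1] at h2
  have hΦ := isCornerProj_upper_entry hX hT hXT hnd Q (fun t ht => hQP ⟨t, ht⟩ ▸ (P _).2) hQX
    fun t ht => by
      rw [hQP ⟨t, ht⟩]
      exact hP_contractive ⟨t, ht⟩
  have hpe := hnd.isCentralSupport_leftSupport
  have hpf := hnd.isCentralSupport_rightSupport
  obtain ⟨Ψ, hΨ, hΨΦ⟩ := hΦ.exists_extension hpe hpf
  have hE₀ := hΨ.add_compl hpe.comm fun m hm => hnd.compl_support_mul_mem hm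
  have hinner := hΨ.isNormalOn_inner hpe hpf hΦ.left_proj hΦ.right_proj hΨΦ
    fun k hk n hn v w => isNormalOn_upper_entry hT hXT hP_normal hQP hk hn v w
  set p := leftSupport X + rightSupport X with hp
  set E₀ := Ψ + LinearMap.mulLeft ℂ (1 - p) with hE₀_def
  let E : (vnLinking T).toStarSubalgebra →ₗ[ℂ] (vnLinking X).toStarSubalgebra :=
    { toFun := fun m => ⟨E₀ m, hE₀.map_mem m m.2⟩
      map_add' := fun a b => Subtype.ext (map_add E₀ _ _)
      map_smul' := fun c a => Subtype.ext (map_smul E₀ c _) }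
  refine ⟨E, ⟨hE₀.le, ?_, ?_, ?_, ?_⟩, ?_, ?_⟩
  · intro b hb
    change E₀ b = b
    rw [hE₀.map_of_mem _ hb, one_mul, mul_one]
  · exact fun a => hE₀.norm_le a a.2
  · exact fun a ha => hE₀.isPositive_map a.2 ha
  · intro a b c hb hc
    change E₀ (b * a * c) = b * E₀ a * c
    rw [hE₀.map_mul_right hc (by rw [mul_one, one_mul]) (mul_mem b.2 a.2),
      hE₀.map_mul_left hb (by rw [mul_one, one_mul]) a.2]
  · refine isNormalMap_of_isNormalOn (F := E₀) (fun _ => rfl) ?_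
    refine isNormalOn_uw_of_inner
      (S := Subalgebra.toSubmodule (vnLinking T).toStarSubalgebra.toSubalgebra)
      (isClosed_weakStar_vonNeumannAlgebra (vnLinking T)) hE₀.norm_le fun v w => ?_
    refine ((hinner v w).add (.inner v (adjoint (1 - p) w))).congr fun a _ => ?_
    rw [adjoint_inner_left, ← inner_add_right]
    rfl
  · intro t
    refine Subtype.ext ?_
    change E₀ (blockOp 0 (t : H →L[ℂ] K) 0 0) = blockOp 0 (P t : H →L[ℂ] K) 0 0
    rw [← upper_eq_blockOp, ← upper_eq_blockOp]
    have htM := upper_mem_vnLinking t.2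
    have he := hnd.leftSupport_mul t.2
    have hf := hnd.mul_rightSupport t.2
    have hpt : p * upper K H (t : H →L[ℂ] K) = upper K H (t : H →L[ℂ] K) := by
      rw [hp, add_mul, he, ← he, ← mul_assoc, rightSupport_mul_leftSupport, zero_mul, add_zero]
    -- By the bimodule property `Ψ (e t f) = e Ψ(t) f`, and this is the original corner map.
    have h1 : Ψ (upper K H (t : H →L[ℂ] K)) = upper K H (P t : H →L[ℂ] K) := by
      have hsum : Ψ (upper K H (t : H →L[ℂ] K)) =
          leftSupport X * Ψ (upper K H (t : H →L[ℂ] K)) * rightSupport X := by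
        rw [← hΨ.map_mul_left (leftSupport_mem X) (hpe.comm _ (hΨ.le (leftSupport_mem X))) htM, he,
          ← hΨ.map_mul_right (rightSupport_mem X) (hpe.comm _ (hΨ.le (rightSupport_mem X))) htM, hf]
      rw [hsum, hΨΦ _ htM]
      change upper K H (Q (entry K H (upper K H (t : H →L[ℂ] K)))) = _
      rw [entry_upper, hQP]
    change Ψ (upper K H (t : H →L[ℂ] K)) + (1 - p) * upper K H (t : H →L[ℂ] K) = _
    rw [h1, sub_mul, one_mul, hpt, sub_self, add_zero]
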